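/- For $\tau$ in the upper half-plane $\mathbb H$ and $q=e^{2\pi i\tau}$ let $\theta_3(\tau)=\sum_{n\in\mathbb Z}q^{n^2}$, $\theta_4(\tau)=\sum_{n\in\mathbb Z}(-1)^nq^{n^2}$ and $t(\tau)=\theta_4(\tau)^2/\theta_3(\tau)^2$. For $\tau_1,\tau_2\in\mathbb H$ put $t_1=t(\tau_1)$, $t_2=t(\tau_2)$ and $$x=\frac{(t_1+t_2)^2(1-t_1t_2)^2}{(1+t_1t_2)^4},\qquad y=\frac{t_1t_2(1-t_1^2)(1-t_2^2)}{(t_1+t_2)^2(1-t_1t_2)^2},\qquad F=\frac{1+t_1t_2}{2}\,\theta_3(\tau_1)^2\theta_3(\tau_2)^2 .$$ Let $\Gamma$ be a congruence subgroup of $\mathrm{SL}(2,\mathbb Z)$, $N(\Gamma)$ its normalizer in $\mathrm{SL}(2,\mathbb R)$, $G$ a group with $\Gamma\le G\le N(\Gamma)$, and $\chi_1:\Gamma\to\mathbb C^\times$, $\chi_2:G\to\mathbb C^\times$ characters with $\chi_2|_\Gamma=\chi_1^2$. A function $F$ on $\mathbb H^2$ is a bimodular form of weight $k$ on $(\Gamma,G)$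 with characters $(\chi_1,\chi_2)$ if it is holomorphic on $\mathbb H^2$ and, in each variable separately, a modular form (holomorphic also at the cusps) of weight $k$ with character $\chi_1$, that is, $$F(\gamma\tau_1,\tau_2)=\chi_1(\gamma)(c\tau_1+d)^kF(\tau_1,\tau_2),\qquad F(\tau_1,\gamma\tau_2)=\chi_1(\gamma)(c\tau_2+d)^kF(\tau_1,\tau_2)$$ for all $\gamma=\begin{pmatrix}a&b\\c&d\end{pmatrix}\in\Gamma$, and if $$F(\gamma\tau_1,\gamma\tau_2)=\chi_2(\gamma)(c\tau_1+d)^k(c\tau_2+d)^kF(\tau_1,\tau_2)$$ for all $\gamma=\begin{pmatrix}a&b\\c&d\end{pmatrix}\in G$. A bimodular function on $(\Gamma,G)$ is a meromorphic function on $\mathbb H^2$ that satisfies these transformation laws with $k=0$ and trivial characters. Then the following hold. 1. $x$ and $y$ are bimodular functions on $(\Gamma_0(8),N(\Gamma_0(8)))$. 2. The matrices $\sigma_1=\frac1{\sqrt8}\begin{pmatrix}0&-1\\8&-4\end{pmatrix}$ and $\sigma_2=\frac1{\sqrt8}\begin{pmatrix}0&-1\\8&0\end{pmatrix}$ lie in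 $N(\Gamma_0(8))$, and $F$ is a bimodular form of weight $1$ on $(\Gamma_0(8),N(\Gamma_0(8)))$ with characters $(\chi_1,\chi_2)$, where $\chi_1\begin{pmatrix}*&*\\ *&d\end{pmatrix}=\left(\frac{-1}{d}\right)$ is $1$ if $d\equiv1$ and $-1$ if $d\equiv3\pmod 4$, and $\chi_2$ is the unique character of $N(\Gamma_0(8))$ with $\chi_2|_{\Gamma_0(8)}=\chi_1^2$ and $\chi_2(\sigma_1)=\chi_2(\sigma_2)=-1$. 3. As a function of $x$ and $y$, $F$ satisfies the system $$4\theta_x(\theta_x-\theta_y)F-x(2\theta_x+1)^2F-2x(2\theta_x+1)\bigl(4y\theta_x+(1-4y)\theta_y\bigr)F=0,$$ $$\theta_y^2F-y(2\theta_y-2\theta_x)(2\theta_y-2\theta_x+1)F=0,$$ where $\theta_x=x\,\partial/\partial x$ and $\theta_y=y\,\partial/\partial y$. More precisely, the points of $\mathbb H^2$ where $1+t_1t_2$, $t_1+t_2$, $1-t_1t_2$ and the Jacobian $\partial(x,y)/\partial(\tau_1,\tau_2)$ are all nonzero are dense in $\mathbb H^2$, and near each of them $F=\Phi(x,y)$ for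 a holomorphic function $\Phi$ on an open neighbourhood in $\mathbb C^2$ of the value of $(x,y)$ at that point, such that $\Phi$ satisfies the system there. -/

import Mathlib

open scoped UpperHalfPlane MatrixGroups ModularForm Topology

noncomputable section

namespace Bimodular

/-! ### Functions on the product of two upper half-planes -/

/-- The product of two upper half-planes, as an open subset of `ℂ × ℂ`. -/
def halfPlaneSq : Set (ℂ × ℂ) := {z | 0 < z.1.im ∧ 0 < z.2.im}

/-- A function on `ℍ × ℍ`, read as a function of two complex variables; only its values on
`halfPlaneSq` carry information. -/
def lift (f : ℍ → ℍ → ℂ) : ℂ × ℂ → ℂ :=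
  fun z => f (UpperHalfPlane.ofComplex z.1) (UpperHalfPlane.ofComplex z.2)

/-- `f` is holomorphic on `ℍ × ℍ`. -/
def IsHolomorphic (f : ℍ → ℍ → ℂ) : Prop := AnalyticOnNhd ℂ (lift f) halfPlaneSq

/-- `f` is meromorphic on `ℍ × ℍ`: near every point it is a quotient `g / h` of holomorphic
functions, where `h` does not vanish identically near the point. -/
def IsMeromorphic (f : ℍ → ℍ → ℂ) : Prop :=
  ∀ p ∈ halfPlaneSq, ∃ g h : ℂ × ℂ → ℂ, AnalyticAt ℂ g p ∧ AnalyticAt ℂ h p ∧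
    (∃ᶠ z in 𝓝 p, h z ≠ 0) ∧ ∀ᶠ z in 𝓝 p, h z ≠ 0 → lift f z = g z / h z

/-! ### Bimodular functions and bimodular forms -/

/-- The inclusion of `SL(2, ℤ)` into `SL(2, ℝ)`. -/
def toReal : SL(2, ℤ) →* SL(2, ℝ) := Matrix.SpecialLinearGroup.map (Int.castRingHom ℝ)

/-- The normalizer of `Γ` in `SL(2, ℝ)`. -/
def normalizerSL2R (Γ : Subgroup SL(2, ℤ)) : Subgroup SL(2, ℝ) :=
  Subgroup.normalizer (Γ.map toReal : Set SL(2, ℝ))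

/-- The factor `c τ + d` of a matrix with lower row `(c, d)`. -/
def autFactor (γ : SL(2, ℝ)) (τ : ℍ) : ℂ := ((γ 1 0 : ℝ) : ℂ) * τ + ((γ 1 1 : ℝ) : ℂ)

/-- `Γ` is a congruence subgroup and `G` is a subgroup of its normalizer that contains it. -/
structure IsAdmissiblePair (Γ : Subgroup SL(2, ℤ)) (G : Subgroup SL(2, ℝ)) : Prop where
  congruence : CongruenceSubgroup.IsCongruenceSubgroup Γ
  le : Γ.map toReal ≤ G
  le_normalizer : G ≤ normalizerSL2R Γ

/-- The restriction of `χ₂` to `Γ` is the square of `χ₁`. -/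
def CompatibleCharacters {Γ : Subgroup SL(2, ℤ)} {G : Subgroup SL(2, ℝ)}
    (χ₁ : Γ →* ℂˣ) (χ₂ : G →* ℂˣ) : Prop :=
  ∀ (γ : Γ) (g : G), (g : SL(2, ℝ)) = toReal γ → χ₂ g = χ₁ γ ^ 2

/-- The two transformation laws of weight `k` with characters `χ₁`, `χ₂`. -/
structure IsBimodularInvariant {Γ : Subgroup SL(2, ℤ)} {G : Subgroup SL(2, ℝ)}
    (k : ℤ) (χ₁ : Γ →* ℂˣ) (χ₂ : G →* ℂˣ) (F : ℍ → ℍ → ℂ) : Prop where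
  left : ∀ (γ : Γ) (τ₁ τ₂ : ℍ),
    F ((γ : SL(2, ℤ)) • τ₁) τ₂ = (χ₁ γ : ℂ) * autFactor (toReal γ) τ₁ ^ k * F τ₁ τ₂
  right : ∀ (γ : Γ) (τ₁ τ₂ : ℍ),
    F τ₁ ((γ : SL(2, ℤ)) • τ₂) = (χ₁ γ : ℂ) * autFactor (toReal γ) τ₂ ^ k * F τ₁ τ₂
  diag : ∀ (γ : G) (τ₁ τ₂ : ℍ),
    F ((γ : SL(2, ℝ)) • τ₁) ((γ : SL(2, ℝ)) • τ₂) =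
      (χ₂ γ : ℂ) * autFactor γ τ₁ ^ k * autFactor γ τ₂ ^ k * F τ₁ τ₂

/-- `F` is a bimodular form of weight `k` on `(Γ, G)` with characters `(χ₁, χ₂)`. Being a modular
form in each variable includes holomorphy on the upper half-plane and at all cusps. -/
structure IsBimodularForm (Γ : Subgroup SL(2, ℤ)) (G : Subgroup SL(2, ℝ))
    (k : ℤ) (χ₁ : Γ →* ℂˣ) (χ₂ : G →* ℂˣ) (F : ℍ → ℍ → ℂ) : Prop where
  pair : IsAdmissiblePair Γ G
  compatible : CompatibleCharacters χ₁ χ₂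
  holomorphic : IsHolomorphic F
  bounded_left : ∀ (τ₂ : ℍ) (γ : SL(2, ℤ)),
    UpperHalfPlane.IsBoundedAtImInfty ((fun τ₁ : ℍ => F τ₁ τ₂) ∣[k] γ)
  bounded_right : ∀ (τ₁ : ℍ) (γ : SL(2, ℤ)),
    UpperHalfPlane.IsBoundedAtImInfty ((fun τ₂ : ℍ => F τ₁ τ₂) ∣[k] γ)
  invariant : IsBimodularInvariant k χ₁ χ₂ F

/-- `f` is a bimodular function on `(Γ, G)`: meromorphic, with the transformation laws of weight
`0` and trivial characters. -/
structure IsBimodularFunction (Γ : Subgroup SL(2, ℤ)) (G : Subgroup SL(2, ℝ))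
    (f : ℍ → ℍ → ℂ) : Prop where
  pair : IsAdmissiblePair Γ G
  meromorphic : IsMeromorphic f
  invariant : IsBimodularInvariant 0 (1 : Γ →* ℂˣ) (1 : G →* ℂˣ) f

/-! ### The functions built from theta series -/

/-- `θ₃(τ) = ∑ q ^ (n ^ 2)` with `q = exp (2 π i τ)`. -/
def theta3 (τ : ℍ) : ℂ :=
  ∑' n : ℤ, Complex.exp (2 * Real.pi * Complex.I * (n : ℂ) ^ 2 * τ)

/-- `θ₄(τ) = ∑ (-1) ^ n q ^ (n ^ 2)` with `q = exp (2 π i τ)`. -/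
def theta4 (τ : ℍ) : ℂ :=
  ∑' n : ℤ, (-1 : ℂ) ^ n * Complex.exp (2 * Real.pi * Complex.I * (n : ℂ) ^ 2 * τ)

def t (τ : ℍ) : ℂ := theta4 τ ^ 2 / theta3 τ ^ 2

def x (τ₁ τ₂ : ℍ) : ℂ :=
  (t τ₁ + t τ₂) ^ 2 * (1 - t τ₁ * t τ₂) ^ 2 / (1 + t τ₁ * t τ₂) ^ 4

def y (τ₁ τ₂ : ℍ) : ℂ :=
  t τ₁ * t τ₂ * (1 - t τ₁ ^ 2) * (1 - t τ₂ ^ 2) /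
    ((t τ₁ + t τ₂) ^ 2 * (1 - t τ₁ * t τ₂) ^ 2)

def F (τ₁ τ₂ : ℍ) : ℂ := (1 + t τ₁ * t τ₂) / 2 * theta3 τ₁ ^ 2 * theta3 τ₂ ^ 2

/-! ### The group `Γ₀(8)`, its normalizer and the characters -/

def Γ : Subgroup SL(2, ℤ) := CongruenceSubgroup.Gamma0 8

def N : Subgroup SL(2, ℝ) := normalizerSL2R Γ

/-- The matrix `(0, -1; 8, -4)`, divided by the square root `√8` of its determinant. -/
def σ₁ : SL(2, ℝ) :=
  ⟨!![0, -1 / √8; 8 / √8, -4 / √8], by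
    rw [Matrix.det_fin_two_of]; field_simp; norm_num⟩

/-- The matrix `(0, -1; 8, 0)`, divided by the square root `√8` of its determinant. -/
def σ₂ : SL(2, ℝ) :=
  ⟨!![0, -1 / √8; 8 / √8, 0], by
    rw [Matrix.det_fin_two_of]; field_simp; norm_num⟩

/-- The character `(-1 / d)` of `Γ₀(8)`, where `d` is the lower right entry: it is `1` for
`d ≡ 1` and `-1` for `d ≡ 3` modulo `4`. -/
def χ₁ : Γ →* ℂˣ :=
  ((((Int.castRingHom ℂ : ℤ →* ℂ).comp ZMod.χ₄.toMonoidHom).comp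
    (ZMod.castHom (by norm_num : 4 ∣ 8) (ZMod 4) : ZMod 8 →* ZMod 4)).comp
      (CongruenceSubgroup.Gamma0Map 8)).toHomUnits

/-! ### The system of partial differential equations -/

/-- `θ_x = x ∂/∂x`. -/
def thetaX (Φ : ℂ × ℂ → ℂ) : ℂ × ℂ → ℂ := fun p => p.1 * deriv (fun s => Φ (s, p.2)) p.1

/-- `θ_y = y ∂/∂y`. -/
def thetaY (Φ : ℂ × ℂ → ℂ) : ℂ × ℂ → ℂ := fun p => p.2 * deriv (fun s => Φ (p.1, s)) p.2

/-- `2 θ_x + 1`. -/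
def opA (Φ : ℂ × ℂ → ℂ) : ℂ × ℂ → ℂ := fun p => 2 * thetaX Φ p + Φ p

/-- `4 y θ_x + (1 - 4 y) θ_y`. -/
def opB (Φ : ℂ × ℂ → ℂ) : ℂ × ℂ → ℂ :=
  fun p => 4 * p.2 * thetaX Φ p + (1 - 4 * p.2) * thetaY Φ p

/-- `2 θ_y - 2 θ_x`. -/
def opC (Φ : ℂ × ℂ → ℂ) : ℂ × ℂ → ℂ := fun p => 2 * thetaY Φ p - 2 * thetaX Φ p

/-- `Φ` satisfies, at the point `p = (x, y)`, the system
`4 θ_x (θ_x - θ_y) Φ - x (2 θ_x + 1)² Φ - 2 x (2 θ_x + 1) (4 y θ_x + (1 - 4 y) θ_y) Φ = 0`,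
`θ_y² Φ - y (2 θ_y - 2 θ_x) (2 θ_y - 2 θ_x + 1) Φ = 0`. -/
def SatisfiesSystemAt (Φ : ℂ × ℂ → ℂ) (p : ℂ × ℂ) : Prop :=
  4 * thetaX (fun z => thetaX Φ z - thetaY Φ z) p - p.1 * opA (opA Φ) p
      - 2 * p.1 * opA (opB Φ) p = 0 ∧
  thetaY (thetaY Φ) p - p.2 * opC (fun z => opC Φ z + Φ z) p = 0

/-- The Jacobian determinant `∂(u, v)/∂(τ₁, τ₂)`. -/
def jacobian (u v : ℍ → ℍ → ℂ) (τ₁ τ₂ : ℍ) : ℂ :=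
  deriv (fun s => lift u (s, (τ₂ : ℂ))) (τ₁ : ℂ) * deriv (fun s => lift v ((τ₁ : ℂ), s)) (τ₂ : ℂ)
    - deriv (fun s => lift u ((τ₁ : ℂ), s)) (τ₂ : ℂ) *
      deriv (fun s => lift v (s, (τ₂ : ℂ))) (τ₁ : ℂ)

/-- The points of `ℍ × ℍ` at which `x` and `y` are defined (have no pole) and form a system of
local coordinates. -/
def regularSet : Set (ℍ × ℍ) :=
  {p | 1 + t p.1 * t p.2 ≠ 0 ∧ t p.1 + t p.2 ≠ 0 ∧ 1 - t p.1 * t p.2 ≠ 0 ∧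
    jacobian x y p.1 p.2 ≠ 0}

/-- Near `(τ₁, τ₂)` the function `F`, as a holomorphic function `Φ` of `(x, y)`, satisfies the
system. -/
def SatisfiesSystemNear (τ₁ τ₂ : ℍ) : Prop :=
  ∃ (V : Set (ℂ × ℂ)) (Φ : ℂ × ℂ → ℂ), IsOpen V ∧ (x τ₁ τ₂, y τ₁ τ₂) ∈ V ∧
    AnalyticOnNhd ℂ Φ V ∧
    (∀ᶠ p : ℍ × ℍ in 𝓝 (τ₁, τ₂), F p.1 p.2 = Φ (x p.1 p.2, y p.1 p.2)) ∧
    ∀ p ∈ V, SatisfiesSystemAt Φ p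

end Bimodular

end

/-! Write A = θ₃² and B = θ₄² as functions of q in the unit disc, so that t = B/A. Everything
analytic comes from two identities, A(q) + B(q) = 2A(q²) and A(q)B(q) = B(q²)²: passing from q to q²
is one step of the arithmetic-geometric mean. Since q^(2^n) → 0, an expression that scales in a
known way under q ↦ q² is determined by its behaviour at q = 0. This shows that θ₃ has no zeros,
that t² ≠ 1 for q ≠ 0, that q t'/t = -(A² - B²)/2 (`logDerivRatio_eq`), and that L = qA'/A satisfies
qL' = L² + B²(A² - B²)/4 (`riccatiDefect_eq_zero`). The last two say that A, as a local function of
t, solves the Legendre equation of K(√(1 - t²)) (`exists_local_solution`).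

The system follows from these equations. F is (1 + t₁t₂)/2 times a product of solutions in t₁ and in
t₂, hence solves one second-order equation in each variable. The chain rule rewrites both in terms
of θ_x and θ_y, and each equation of the system is a combination of the two with rational
multipliers; comparing coefficients leaves twelve rational identities
(`satisfiesSystemAt_of_eventually`). Where the Jacobian does not vanish, (t₁, t₂) ↦ (x, y) is
locally invertible, which produces Φ. Density holds because t is an open map and the excluded pairs
(t₁, t₂) are zeros of polynomials.

For modularity, A satisfies the weight one law on Γ₀(4), by Euclidean descent to translations and
their Fricke conjugates (`thetaLaw_of_dvd`); conjugation by z ↦ z + 1/2 gives the law of B on Γ₀(8).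
So t is invariant under Γ₀(8), and F = (A₁A₂ + B₁B₂)/2 has the required law in each variable. The
half translation exchanges A and B, that is t ↦ 1/t, and σ₂ acts by t ↦ (1 - t)/(1 + t). Applied to
both variables, these fix x and y and multiply F by 1 and -1 times the automorphy factors. An
arithmetic argument shows that Γ₀(8), σ₁ and σ₂ generate the normalizer (`N_le_generated`); hence
every element has a multiplier on F, unique because F is not zero, and these multipliers form χ₂.
Growth at the cusps reduces to the three functions, up to scalars, in the SL(2, ℤ)-orbit of the
square of Jacobi's theta function. -/

noncomputable section
namespace Bimodular

/-! ### The theta series as a function on the unit disc -/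

/-- The theta series `∑ q ^ (n ^ 2)` as a function of `q` in the unit disc. -/
def discTheta (q : ℂ) : ℂ := ∑' n : ℤ, q ^ (n.natAbs ^ 2)

lemma summable_pow_natAbs_sq {r : ℝ} (h0 : 0 ≤ r) (h1 : r < 1) :
    Summable fun n : ℤ => r ^ (n.natAbs ^ 2) := by
  have hs : Summable fun n : ℕ => r ^ (n ^ 2) :=
    (summable_geometric_of_lt_one h0 h1).of_nonneg_of_le (fun n => by positivity)
      fun n => pow_le_pow_of_le_one h0 h1.le (Nat.le_self_pow two_ne_zero n)
  exact Summable.of_nat_of_neg (by simpa using hs) (by simpa using hs)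

lemma summable_norm_discTheta {q : ℂ} (hq : ‖q‖ < 1) :
    Summable fun n : ℤ => ‖q ^ (n.natAbs ^ 2)‖ := by
  simpa [norm_pow] using summable_pow_natAbs_sq (norm_nonneg q) hq

lemma discTheta_zero : discTheta 0 = 1 := by
  rw [discTheta, tsum_eq_single 0]
  · simp
  · intro n hn
    simp [hn]

lemma discTheta_mul {p q : ℂ} (hp : ‖p‖ < 1) (hq : ‖q‖ < 1) :
    discTheta p * discTheta q = ∑' z : ℤ × ℤ, p ^ (z.1.natAbs ^ 2) * q ^ (z.2.natAbs ^ 2) :=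
  tsum_mul_tsum_of_summable_norm (summable_norm_discTheta hp) (summable_norm_discTheta hq)

lemma summable_discTheta_mul {p q : ℂ} (hp : ‖p‖ < 1) (hq : ‖q‖ < 1) :
    Summable fun z : ℤ × ℤ => p ^ (z.1.natAbs ^ 2) * q ^ (z.2.natAbs ^ 2) :=
  summable_mul_of_summable_norm (f := fun n : ℤ => p ^ (n.natAbs ^ 2))
    (g := fun n : ℤ => q ^ (n.natAbs ^ 2))
    (summable_norm_discTheta hp) (summable_norm_discTheta hq)

lemma injective_add_sub : Function.Injective fun z : ℤ × ℤ => (z.1 + z.2, z.1 - z.2) := by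
  rintro ⟨a, b⟩ ⟨c, d⟩ h
  simp only [Prod.mk.injEq] at h ⊢
  omega

/-- A sum over `ℤ × ℤ` that is supported on the pairs with even sum. -/
lemma tsum_eq_tsum_add_sub {f : ℤ × ℤ → ℂ} (hf : ∀ z : ℤ × ℤ, Odd (z.1 + z.2) → f z = 0) :
    ∑' z, f z = ∑' z : ℤ × ℤ, f (z.1 + z.2, z.1 - z.2) := by
  refine (injective_add_sub.tsum_eq ?_).symm
  rintro ⟨m, n⟩ h
  have he : Even (m + n) := by
    by_contra ho
    exact h (hf _ (Int.not_even_iff_odd.mp ho))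
  obtain ⟨a, ha⟩ := he
  exact ⟨(a, a - n), by simp only [Prod.mk.injEq]; omega⟩

lemma neg_pow_natAbs_sq (q : ℂ) (n : ℤ) :
    (-q) ^ (n.natAbs ^ 2) = (-1) ^ n.natAbs * q ^ (n.natAbs ^ 2) := by
  rw [neg_pow]
  congr 1
  rcases Nat.even_or_odd n.natAbs with h | h
  · rw [h.neg_one_pow, (h.pow_of_ne_zero two_ne_zero).neg_one_pow]
  · rw [h.neg_one_pow, h.pow.neg_one_pow]

lemma neg_one_pow_natAbs_mul_of_even {m n : ℤ} (h : Even (m + n)) :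
    (-1 : ℂ) ^ m.natAbs = (-1) ^ n.natAbs := by
  rcases Int.even_or_odd n with hn | hn
  · have hm : Even m := (Int.even_add.mp h).mpr hn
    rw [(Int.natAbs_even.mpr hm).neg_one_pow, (Int.natAbs_even.mpr hn).neg_one_pow]
  · have hm : Odd m := by
      rw [← Int.not_even_iff_odd] at hn ⊢
      exact fun h' => hn ((Int.even_add.mp h).mp h')
    rw [(Int.natAbs_odd.mpr hm).neg_one_pow, (Int.natAbs_odd.mpr hn).neg_one_pow]

lemma neg_one_pow_natAbs_of_odd {m n : ℤ} (h : Odd (m + n)) :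
    (-1 : ℂ) ^ m.natAbs = -(-1) ^ n.natAbs := by
  rcases Int.even_or_odd n with hn | hn
  · have hm : Odd m := by
      rcases Int.even_or_odd m with hm | hm
      · exact absurd (hm.add hn) (Int.not_even_iff_odd.mpr h)
      · exact hm
    rw [(Int.natAbs_odd.mpr hm).neg_one_pow, (Int.natAbs_even.mpr hn).neg_one_pow]
  · have hm : Even m := by
      rcases Int.even_or_odd m with hm | hm
      · exact hm
      · exact absurd (hm.add_odd hn) (Int.not_even_iff_odd.mpr h)
    rw [(Int.natAbs_even.mpr hm).neg_one_pow, (Int.natAbs_odd.mpr hn).neg_one_pow, neg_neg]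

lemma pow_natAbs_add_sub (q : ℂ) (a b : ℤ) :
    q ^ ((a + b).natAbs ^ 2) * q ^ ((a - b).natAbs ^ 2) =
      (q ^ 2) ^ (a.natAbs ^ 2) * (q ^ 2) ^ (b.natAbs ^ 2) := by
  rw [← pow_add, ← pow_mul, ← pow_mul, ← pow_add]
  congr 1
  zify
  simp only [sq_abs]
  ring

lemma norm_sq_lt_one {q : ℂ} (hq : ‖q‖ < 1) : ‖q ^ 2‖ < 1 := by
  rw [norm_pow]
  exact pow_lt_one₀ (norm_nonneg q) hq two_ne_zero

/-- In the double series over (m, n) the terms with m + n odd cancel and the others double. Putting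
m = a + b, n = a - b gives m² + n² = 2(a² + b²). -/
lemma discTheta_sq_add {q : ℂ} (hq : ‖q‖ < 1) :
    discTheta q ^ 2 + discTheta (-q) ^ 2 = 2 * discTheta (q ^ 2) ^ 2 := by
  have hq' : ‖-q‖ < 1 := by rwa [norm_neg]
  have h2 := norm_sq_lt_one hq
  rw [sq, sq, sq, discTheta_mul hq hq, discTheta_mul hq' hq', discTheta_mul h2 h2,
    ← (summable_discTheta_mul hq hq).tsum_add (summable_discTheta_mul hq' hq'),
    tsum_eq_tsum_add_sub, ← tsum_mul_left]
  · refine tsum_congr fun z => ?_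
    have h1 : (-1 : ℂ) ^ (z.1 + z.2).natAbs = (-1) ^ (z.1 - z.2).natAbs :=
      neg_one_pow_natAbs_mul_of_even ⟨z.1, by ring⟩
    simp only [neg_pow_natAbs_sq, h1]
    have h3 : ((-1 : ℂ) ^ (z.1 - z.2).natAbs) * (-1) ^ (z.1 - z.2).natAbs = 1 := by
      rw [← mul_pow]; norm_num
    linear_combination (1 + (-1 : ℂ) ^ (z.1 - z.2).natAbs * (-1) ^ (z.1 - z.2).natAbs) *
      pow_natAbs_add_sub q z.1 z.2 + (q ^ 2) ^ (z.1.natAbs ^ 2) * (q ^ 2) ^ (z.2.natAbs ^ 2) * h3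
  · intro z hz
    have h3 : ((-1 : ℂ) ^ z.2.natAbs) * (-1) ^ z.2.natAbs = 1 := by
      rw [← mul_pow]; norm_num
    rw [neg_pow_natAbs_sq, neg_pow_natAbs_sq, neg_one_pow_natAbs_of_odd hz]
    linear_combination (-q ^ (z.1.natAbs ^ 2) * q ^ (z.2.natAbs ^ 2)) * h3

lemma discTheta_mul_neg {q : ℂ} (hq : ‖q‖ < 1) :
    discTheta q * discTheta (-q) = discTheta (-q ^ 2) ^ 2 := by
  have hq' : ‖-q‖ < 1 := by rwa [norm_neg]
  have h2 : ‖-q ^ 2‖ < 1 := by rw [norm_neg]; exact norm_sq_lt_one hq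
  -- Adding the product in the other order makes the terms with m + n odd cancel one by one.
  have key : discTheta q * discTheta (-q) + discTheta (-q) * discTheta q =
      2 * discTheta (-q ^ 2) ^ 2 := by
    rw [sq, discTheta_mul hq hq', discTheta_mul hq' hq, discTheta_mul h2 h2,
      ← (summable_discTheta_mul hq hq').tsum_add (summable_discTheta_mul hq' hq),
      tsum_eq_tsum_add_sub, ← tsum_mul_left]
    · refine tsum_congr fun z => ?_
      have h1 : (-1 : ℂ) ^ (z.1 + z.2).natAbs = (-1) ^ (z.1 - z.2).natAbs :=
        neg_one_pow_natAbs_mul_of_even ⟨z.1, by ring⟩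
      have h3 : (-1 : ℂ) ^ (z.1 - z.2).natAbs = (-1) ^ z.1.natAbs * (-1) ^ z.2.natAbs := by
        rw [← pow_add]
        have := @neg_one_pow_natAbs_mul_of_even (z.1 - z.2) ((z.1.natAbs : ℤ) + z.2.natAbs) (by
          rcases abs_choice z.1 with ha | ha <;> rcases abs_choice z.2 with hb | hb <;>
            simp only [Int.natCast_natAbs, ha, hb]
          · exact ⟨z.1, by ring⟩
          · exact ⟨z.1 - z.2, by ring⟩
          · exact ⟨0, by ring⟩
          · exact ⟨-z.2, by ring⟩)
        rw [this]
        congr 1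
      simp only [neg_pow_natAbs_sq, h1]
      rw [h3]
      linear_combination (2 * (-1 : ℂ) ^ z.1.natAbs * (-1) ^ z.2.natAbs) *
        pow_natAbs_add_sub q z.1 z.2
    · intro z hz
      rw [neg_pow_natAbs_sq, neg_pow_natAbs_sq, neg_one_pow_natAbs_of_odd hz]
      ring
  linear_combination key / 2

/-- The series `∑ q ^ (n ^ 2 + 2 n)`, which is `(θ - 1) / (2 q)`. -/
def discThetaTail (q : ℂ) : ℂ := ∑' n : ℕ, q ^ (n ^ 2 + 2 * n)

lemma differentiableOn_discThetaTail : DifferentiableOn ℂ discThetaTail (Metric.ball 0 1) := by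
  intro q hq
  rw [mem_ball_zero_iff] at hq
  obtain ⟨r, hr, hr1⟩ := exists_between hq
  have h0 : 0 ≤ r := (norm_nonneg q).trans hr.le
  have : DifferentiableOn ℂ discThetaTail (Metric.ball 0 r) := by
    refine Complex.differentiableOn_tsum_of_summable_norm
      (u := fun n : ℕ => r ^ n) (summable_geometric_of_lt_one h0 hr1)
      (fun n => (differentiable_id.pow _).differentiableOn) Metric.isOpen_ball fun n w hw => ?_
    rw [mem_ball_zero_iff] at hw
    rw [norm_pow]
    exact (pow_le_pow_left₀ (norm_nonneg w) hw.le _).trans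
      (pow_le_pow_of_le_one h0 hr1.le (by nlinarith))
  exact (this.differentiableAt (Metric.isOpen_ball.mem_nhds (by simpa using hr)))
    |>.differentiableWithinAt

/-- Folding n with -n displays both the analyticity and the values θ(0) = 1, θ'(0) = 2 that
normalize the later limits at q = 0. -/
lemma discTheta_eq {q : ℂ} (hq : ‖q‖ < 1) : discTheta q = 1 + 2 * q * discThetaTail q := by
  have hs : Summable fun n : ℕ => q ^ (n ^ 2) := by
    refine Summable.of_norm ?_
    refine (summable_geometric_of_lt_one (norm_nonneg q) hq).of_nonneg_of_le
      (fun n => norm_nonneg _) fun n => ?_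
    rw [norm_pow]
    exact pow_le_pow_of_le_one (norm_nonneg q) hq.le (Nat.le_self_pow two_ne_zero n)
  have hS := (summable_norm_discTheta hq).of_norm
  have h1 := hS.hasSum.nat_add_neg.tsum_eq
  have h2 : ∑' n : ℕ, (q ^ ((n : ℤ).natAbs ^ 2) + q ^ ((-(n : ℤ)).natAbs ^ 2)) =
      2 * ∑' n : ℕ, q ^ (n ^ 2) := by
    rw [← tsum_mul_left]
    exact tsum_congr fun n => by simp; ring
  have h3 : ∑' n : ℕ, q ^ (n ^ 2) = 1 + q * discThetaTail q := by
    rw [hs.tsum_eq_zero_add, discThetaTail, ← tsum_mul_left]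
    congr 1
    exact tsum_congr fun n => by ring
  have h4 : discTheta q + q ^ ((0 : ℤ).natAbs ^ 2) = 2 * ∑' n : ℕ, q ^ (n ^ 2) := by
    rw [← h2, h1]; rfl
  rw [h3] at h4
  simp at h4
  linear_combination h4

lemma differentiableOn_discTheta : DifferentiableOn ℂ discTheta (Metric.ball 0 1) := by
  refine DifferentiableOn.congr (f := fun q => 1 + 2 * q * discThetaTail q) ?_
    fun q hq => discTheta_eq (by simpa using hq)
  exact (((differentiable_id.const_mul 2).differentiableOn).mul
    differentiableOn_discThetaTail).const_add 1

lemma analyticAt_discTheta {q : ℂ} (hq : ‖q‖ < 1) : AnalyticAt ℂ discTheta q :=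
  differentiableOn_discTheta.analyticAt (Metric.isOpen_ball.mem_nhds (by simpa using hq))

lemma hasDerivAt_discTheta_zero : HasDerivAt discTheta 2 0 := by
  have hK : HasDerivAt discThetaTail (deriv discThetaTail 0) 0 :=
    (differentiableOn_discThetaTail.differentiableAt
      (Metric.isOpen_ball.mem_nhds (by simp))).hasDerivAt
  have hK0 : discThetaTail 0 = 1 := by
    rw [discThetaTail, tsum_eq_single 0]
    · simp
    · intro n hn
      simp [hn]
  have h : HasDerivAt (fun q : ℂ => 1 + 2 * q * discThetaTail q) 2 0 := by
    have := ((((hasDerivAt_id (0 : ℂ)).const_mul 2).mul hK).const_add 1)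
    simpa [hK0] using! this
  refine h.congr_of_eventuallyEq ?_
  filter_upwards [Metric.isOpen_ball.mem_nhds (Metric.mem_ball_self (x := (0 : ℂ)) one_pos)]
    with q hq
  exact discTheta_eq (by simpa using hq)

lemma tendsto_pow_two_pow {q : ℂ} (hq : ‖q‖ < 1) :
    Filter.Tendsto (fun n : ℕ => q ^ 2 ^ n) Filter.atTop (𝓝 0) :=
  (tendsto_pow_atTop_nhds_zero_of_norm_lt_one hq).comp
    (tendsto_pow_atTop_atTop_of_one_lt one_lt_two)

lemma norm_pow_two_pow_lt {q : ℂ} (hq : ‖q‖ < 1) (n : ℕ) : ‖q ^ 2 ^ n‖ < 1 := by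
  rw [norm_pow]
  exact pow_lt_one₀ (norm_nonneg q) hq (by positivity)

/-- By `discTheta_mul_neg` a zero at q propagates to -q², -q⁴, -q⁸, …, which tend to 0, where the
series is 1. -/
lemma discTheta_ne_zero {q : ℂ} (hq : ‖q‖ < 1) : discTheta q ≠ 0 := by
  intro h0
  have hn : ∀ n : ℕ, discTheta (-q ^ 2 ^ (n + 1)) = 0 := by
    intro n
    induction n with
    | zero =>
      have := discTheta_mul_neg hq
      rw [h0, zero_mul] at this
      simpa using this.symm
    | succ n ih =>
      have := discTheta_mul_neg (norm_pow_two_pow_lt hq (n + 1))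
      rw [ih, mul_zero, ← pow_mul, ← pow_succ] at this
      exact pow_eq_zero_iff two_ne_zero |>.mp this.symm
  have hc : Filter.Tendsto (fun n : ℕ => discTheta (-q ^ 2 ^ (n + 1))) Filter.atTop (𝓝 1) := by
    have h1 : Filter.Tendsto discTheta (𝓝 0) (𝓝 1) := by
      simpa [discTheta_zero] using (analyticAt_discTheta (q := 0) (by simp)).continuousAt.tendsto
    refine h1.comp ?_
    simpa using ((Filter.tendsto_add_atTop_iff_nat 1).mpr (tendsto_pow_two_pow hq)).neg
  simp only [hn] at hc
  exact zero_ne_one (tendsto_nhds_unique tendsto_const_nhds hc)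

end Bimodular
end

noncomputable section
namespace Bimodular

/-! ### The arithmetic-geometric mean and the differential equation of `θ₃ ^ 2` -/

/-- `θ₃ ^ 2` as a function of `q`. -/
def discA (q : ℂ) : ℂ := discTheta q ^ 2

/-- `θ₄ ^ 2` as a function of `q`. -/
def discB (q : ℂ) : ℂ := discTheta (-q) ^ 2

/-- `θ₄ ^ 2 / θ₃ ^ 2` as a function of `q`. -/
def discT (q : ℂ) : ℂ := discB q / discA q

variable {q : ℂ}

lemma discA_ne_zero (hq : ‖q‖ < 1) : discA q ≠ 0 := pow_ne_zero 2 (discTheta_ne_zero hq)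

lemma discB_ne_zero (hq : ‖q‖ < 1) : discB q ≠ 0 :=
  pow_ne_zero 2 (discTheta_ne_zero (by rwa [norm_neg]))

lemma analyticAt_discA (hq : ‖q‖ < 1) : AnalyticAt ℂ discA q := (analyticAt_discTheta hq).pow 2

lemma analyticAt_discB (hq : ‖q‖ < 1) : AnalyticAt ℂ discB q :=
  ((analyticAt_discTheta (q := -q) (by rwa [norm_neg])).comp analyticAt_id.neg).pow 2

lemma analyticAt_discT (hq : ‖q‖ < 1) : AnalyticAt ℂ discT q :=
  (analyticAt_discB hq).div (analyticAt_discA hq) (discA_ne_zero hq)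

lemma hasDerivAt_discA (hq : ‖q‖ < 1) : HasDerivAt discA (deriv discA q) q :=
  (analyticAt_discA hq).differentiableAt.hasDerivAt

lemma hasDerivAt_discB (hq : ‖q‖ < 1) : HasDerivAt discB (deriv discB q) q :=
  (analyticAt_discB hq).differentiableAt.hasDerivAt

/-- With `discB_sq` this is the step of the arithmetic-geometric mean: the value of A at q² is the
arithmetic mean of A and B, and that of B is a geometric mean. -/
lemma discA_sq (hq : ‖q‖ < 1) : 2 * discA (q ^ 2) = discA q + discB q := by
  rw [discA, discA, discB, discTheta_sq_add hq]

lemma discB_sq (hq : ‖q‖ < 1) : discB (q ^ 2) ^ 2 = discA q * discB q := by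
  rw [discA, discB, discB, ← discTheta_mul_neg hq]
  ring

lemma eventually_norm_lt_one (hq : ‖q‖ < 1) : ∀ᶠ z : ℂ in 𝓝 q, ‖z‖ < 1 :=
  (continuous_norm.tendsto q).eventually_lt_const hq

lemma deriv_discA_zero : deriv discA 0 = 4 := by
  have := (hasDerivAt_discTheta_zero.pow 2).deriv
  rw [show discA = discTheta ^ 2 from rfl, this, discTheta_zero]
  norm_num

lemma hasDerivAt_discB_zero : HasDerivAt discB (-4) 0 := by
  have h : HasDerivAt discA 4 (-0) := by
    have := hasDerivAt_discA (q := 0) (by simp)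
    rwa [deriv_discA_zero, ← neg_zero] at this
  exact (h.comp 0 (hasDerivAt_neg 0)).congr_deriv (by norm_num)

lemma discA_zero : discA 0 = 1 := by simp [discA, discTheta_zero]

lemma discB_zero : discB 0 = 1 := by simp [discB, discTheta_zero]

lemma hasDerivAt_sq_sub_sq_zero : HasDerivAt (fun q => discA q ^ 2 - discB q ^ 2) 16 0 := by
  have hA := hasDerivAt_discA (q := 0) (by simp)
  rw [deriv_discA_zero] at hA
  have := (hA.pow 2).sub (hasDerivAt_discB_zero.pow 2)
  refine this.congr_deriv ?_
  rw [discA_zero, discB_zero]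
  norm_num

lemma sq_sub_sq_sq (hq : ‖q‖ < 1) :
    4 * (discA (q ^ 2) ^ 2 - discB (q ^ 2) ^ 2) = (discA q - discB q) ^ 2 := by
  linear_combination (2 * discA (q ^ 2) + discA q + discB q) * discA_sq hq - 4 * discB_sq hq

lemma discA_add_discB_ne_zero (hq : ‖q‖ < 1) : discA q + discB q ≠ 0 := by
  rw [← discA_sq hq]
  exact mul_ne_zero two_ne_zero (discA_ne_zero (norm_sq_lt_one hq))

lemma tendsto_pow_two_pow_ne (h0 : q ≠ 0) (hq : ‖q‖ < 1) :
    Filter.Tendsto (fun n : ℕ => q ^ 2 ^ n) Filter.atTop (𝓝[≠] 0) :=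
  tendsto_nhdsWithin_iff.mpr ⟨tendsto_pow_two_pow hq, .of_forall fun _ => pow_ne_zero _ h0⟩

lemma tendsto_slope_sq_sub_sq :
    Filter.Tendsto (fun q => q⁻¹ * (discA q ^ 2 - discB q ^ 2)) (𝓝[≠] 0) (𝓝 16) := by
  have := hasDerivAt_iff_tendsto_slope_zero.mp hasDerivAt_sq_sub_sq_zero
  simpa [discA_zero, discB_zero] using this

/-- As A + B never vanishes, a zero at q forces A = B there, and then `sq_sub_sq_sq` gives a zero at
q². Iterating contradicts (A² - B²)/q → 16 at the origin. -/
lemma sq_sub_sq_ne_zero (h0 : q ≠ 0) (hq : ‖q‖ < 1) : discA q ^ 2 - discB q ^ 2 ≠ 0 := by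
  intro h
  have hn : ∀ n : ℕ, discA (q ^ 2 ^ n) ^ 2 - discB (q ^ 2 ^ n) ^ 2 = 0 := by
    intro n
    induction n with
    | zero => simpa using h
    | succ n ih =>
      have hq' := norm_pow_two_pow_lt hq n
      have h1 : discA (q ^ 2 ^ n) - discB (q ^ 2 ^ n) = 0 := by
        rw [sq_sub_sq] at ih
        exact (mul_eq_zero.mp ih).resolve_left (discA_add_discB_ne_zero hq')
      have h2 := sq_sub_sq_sq hq'
      rw [h1, ← pow_mul, ← pow_succ] at h2
      linear_combination h2 / 4
  have hc := tendsto_slope_sq_sub_sq.comp (tendsto_pow_two_pow_ne h0 hq)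
  simp only [Function.comp_def, hn, mul_zero] at hc
  have := tendsto_nhds_unique tendsto_const_nhds hc
  norm_num at this

lemma deriv_discA_sq (hq : ‖q‖ < 1) :
    4 * q * deriv discA (q ^ 2) = deriv discA q + deriv discB q := by
  have h2 := hasDerivAt_discA (norm_sq_lt_one hq)
  have h1 : HasDerivAt (fun z => 2 * discA (z ^ 2)) (2 * (deriv discA (q ^ 2) * (2 * q))) q := by
    simpa using! (h2.comp q (hasDerivAt_pow 2 q)).const_mul 2
  have h3 := (hasDerivAt_discA hq).add (hasDerivAt_discB hq)
  have := (h3.congr_of_eventuallyEq (f₁ := fun z => 2 * discA (z ^ 2)) (by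
    filter_upwards [eventually_norm_lt_one hq] with z hz using discA_sq hz)).unique h1
  linear_combination -this

lemma deriv_discB_sq (hq : ‖q‖ < 1) :
    4 * q * discB (q ^ 2) * deriv discB (q ^ 2) =
      deriv discA q * discB q + discA q * deriv discB q := by
  have h2 := hasDerivAt_discB (norm_sq_lt_one hq)
  have h1 : HasDerivAt (fun z => discB (z ^ 2) ^ 2)
      (2 * discB (q ^ 2) * (deriv discB (q ^ 2) * (2 * q))) q := by
    simpa using! (h2.comp q (hasDerivAt_pow 2 q)).pow 2
  have h3 := (hasDerivAt_discA hq).mul (hasDerivAt_discB hq)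
  have := (h3.congr_of_eventuallyEq (f₁ := fun z => discB (z ^ 2) ^ 2) (by
    filter_upwards [eventually_norm_lt_one hq] with z hz using discB_sq hz)).unique h1
  linear_combination -this

/-- The logarithmic derivative of `discT`, divided by `discA ^ 2 - discB ^ 2`. -/
def logDerivRatio (q : ℂ) : ℂ :=
  q * (deriv discB q * discA q - deriv discA q * discB q) /
    (discA q * discB q * (discA q ^ 2 - discB q ^ 2))

/-- Numerator and denominator at q², after multiplication by 8B(q²), are A - B times those at q;
these are `e1` and `e2`. -/
lemma logDerivRatio_sq (h0 : q ≠ 0) (hq : ‖q‖ < 1) :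
    logDerivRatio (q ^ 2) = logDerivRatio q := by
  have hq2 := norm_sq_lt_one hq
  have hA := discA_ne_zero hq
  have hB := discB_ne_zero hq
  have hA' := discA_ne_zero hq2
  have hB' := discB_ne_zero hq2
  have h1 := sq_sub_sq_ne_zero h0 hq
  have h2 := sq_sub_sq_ne_zero (pow_ne_zero 2 h0) hq2
  have hm : discA q - discB q ≠ 0 := fun h => h1 (by rw [sq_sub_sq, h, mul_zero])
  have hp := discA_add_discB_ne_zero hq
  have e1 : q ^ 2 * (deriv discB (q ^ 2) * discA (q ^ 2) - deriv discA (q ^ 2) * discB (q ^ 2)) *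
      discB (q ^ 2) * 8 = (discA q - discB q) *
        (q * (deriv discB q * discA q - deriv discA q * discB q)) := by
    linear_combination (2 * q * discA (q ^ 2)) * deriv_discB_sq hq -
      (2 * q * discB (q ^ 2) ^ 2) * deriv_discA_sq hq +
      q * (deriv discA q * discB q + discA q * deriv discB q) * discA_sq hq -
      2 * q * (deriv discA q + deriv discB q) * discB_sq hq
  have e2 : discA (q ^ 2) * discB (q ^ 2) * (discA (q ^ 2) ^ 2 - discB (q ^ 2) ^ 2) *
      discB (q ^ 2) * 8 =
      (discA q - discB q) * (discA q * discB q * (discA q ^ 2 - discB q ^ 2)) := by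
    linear_combination (8 * discA (q ^ 2) * (discA (q ^ 2) ^ 2 - discB (q ^ 2) ^ 2)) *
      discB_sq hq + (4 * discA q * discB q * (discA (q ^ 2) ^ 2 - discB (q ^ 2) ^ 2)) *
      discA_sq hq + discA q * discB q * (discA q + discB q) * sq_sub_sq_sq hq
  rw [logDerivRatio, logDerivRatio,
    ← mul_div_mul_left _ (discA q * discB q * (discA q ^ 2 - discB q ^ 2)) hm, ← e1, ← e2,
    mul_assoc _ (discB (q ^ 2)) 8, mul_assoc _ (discB (q ^ 2)) 8,
    mul_div_mul_right _ _ (mul_ne_zero hB' (by norm_num))]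

lemma tendsto_logDerivRatio : Filter.Tendsto logDerivRatio (𝓝[≠] 0) (𝓝 (-1 / 2)) := by
  have hz : ‖(0 : ℂ)‖ < 1 := by simp
  have hA : Filter.Tendsto discA (𝓝[≠] 0) (𝓝 1) := by
    simpa [discA_zero] using (analyticAt_discA hz).continuousAt.tendsto.mono_left nhdsWithin_le_nhds
  have hB : Filter.Tendsto discB (𝓝[≠] 0) (𝓝 1) := by
    simpa [discB_zero] using (analyticAt_discB hz).continuousAt.tendsto.mono_left nhdsWithin_le_nhds
  have hA' : Filter.Tendsto (deriv discA) (𝓝[≠] 0) (𝓝 4) := by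
    simpa [deriv_discA_zero] using
      (analyticAt_discA hz).deriv.continuousAt.tendsto.mono_left nhdsWithin_le_nhds
  have hB' : Filter.Tendsto (deriv discB) (𝓝[≠] 0) (𝓝 (-4)) := by
    simpa [hasDerivAt_discB_zero.deriv] using
      (analyticAt_discB hz).deriv.continuousAt.tendsto.mono_left nhdsWithin_le_nhds
  have h := ((hB'.mul hA).sub (hA'.mul hB)).div ((hA.mul hB).mul tendsto_slope_sq_sub_sq)
    (by norm_num)
  have e : ((-4 : ℂ) * 1 - 4 * 1) / (1 * 1 * 16) = -1 / 2 := by norm_num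
  rw [e] at h
  refine h.congr' ?_
  filter_upwards [self_mem_nhdsWithin] with z hz
  have hz' : z ≠ 0 := hz
  rw [logDerivRatio]
  simp only [Pi.div_apply]
  rw [← mul_div_mul_left _ _ hz']
  congr 1
  field_simp

/-- Invariance under q ↦ q² makes the ratio equal to its limit along q^(2^n) → 0. -/
lemma logDerivRatio_eq (h0 : q ≠ 0) (hq : ‖q‖ < 1) : logDerivRatio q = -1 / 2 := by
  have hn : ∀ n : ℕ, logDerivRatio (q ^ 2 ^ n) = logDerivRatio q := by
    intro n
    induction n with
    | zero => simp
    | succ n ih =>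
      rw [← ih, pow_succ, pow_mul, logDerivRatio_sq (pow_ne_zero _ h0) (norm_pow_two_pow_lt hq n)]
  have hc := tendsto_logDerivRatio.comp (tendsto_pow_two_pow_ne h0 hq)
  simp only [Function.comp_def, hn] at hc
  exact tendsto_nhds_unique tendsto_const_nhds hc

lemma deriv_discB_mul (hq : ‖q‖ < 1) :
    2 * q * (deriv discB q * discA q - deriv discA q * discB q) =
      -(discA q * discB q * (discA q ^ 2 - discB q ^ 2)) := by
  rcases eq_or_ne q 0 with rfl | h0
  · simp [discA_zero, discB_zero]
  · have h := logDerivRatio_eq h0 hq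
    rw [logDerivRatio, div_eq_div_iff (mul_ne_zero (mul_ne_zero (discA_ne_zero hq)
      (discB_ne_zero hq)) (sq_sub_sq_ne_zero h0 hq)) two_ne_zero] at h
    linear_combination h

/-- The logarithmic derivative `q A' / A`. -/
def logDerivA (q : ℂ) : ℂ := q * deriv discA q / discA q

lemma analyticAt_logDerivA (hq : ‖q‖ < 1) : AnalyticAt ℂ logDerivA q :=
  (analyticAt_id.mul (analyticAt_discA hq).deriv).div (analyticAt_discA hq) (discA_ne_zero hq)

lemma mul_deriv_discA (hq : ‖q‖ < 1) : q * deriv discA q = logDerivA q * discA q := by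
  rw [logDerivA, div_mul_cancel₀ _ (discA_ne_zero hq)]

lemma mul_deriv_discB (hq : ‖q‖ < 1) :
    q * deriv discB q = discB q * (logDerivA q - (discA q ^ 2 - discB q ^ 2) / 2) := by
  refine mul_right_cancel₀ (discA_ne_zero hq) ?_
  linear_combination deriv_discB_mul hq / 2 + discB q * mul_deriv_discA hq

lemma logDerivA_sq (hq : ‖q‖ < 1) :
    2 * logDerivA (q ^ 2) = logDerivA q - discB q * (discA q - discB q) / 2 := by
  refine mul_right_cancel₀ (discA_add_discB_ne_zero hq) ?_
  linear_combination (-2 * logDerivA (q ^ 2)) * discA_sq hq - 4 * mul_deriv_discA (norm_sq_lt_one hq)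
    + q * deriv_discA_sq hq + mul_deriv_discA hq + mul_deriv_discB hq

lemma deriv_logDerivA_sq (hq : ‖q‖ < 1) :
    4 * q * deriv logDerivA (q ^ 2) = deriv logDerivA q -
      (deriv discB q * (discA q - discB q) + discB q * (deriv discA q - deriv discB q)) / 2 := by
  have h2 := (analyticAt_logDerivA (norm_sq_lt_one hq)).differentiableAt.hasDerivAt
  have h1 : HasDerivAt (fun z => 2 * logDerivA (z ^ 2))
      (2 * (deriv logDerivA (q ^ 2) * (2 * q))) q := by
    simpa using! (h2.comp q (hasDerivAt_pow 2 q)).const_mul 2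
  have h3 := (analyticAt_logDerivA hq).differentiableAt.hasDerivAt.sub
    (((hasDerivAt_discB hq).mul ((hasDerivAt_discA hq).sub (hasDerivAt_discB hq))).div_const 2)
  have := (h3.congr_of_eventuallyEq (f₁ := fun z => 2 * logDerivA (z ^ 2)) (by
    filter_upwards [eventually_norm_lt_one hq] with z hz using logDerivA_sq hz)).unique h1
  simp only [Pi.sub_apply] at this
  linear_combination -this

/-- The defect in the Riccati equation of `logDerivA`. -/
def riccatiDefect (q : ℂ) : ℂ :=
  q * deriv logDerivA q - logDerivA q ^ 2 - discB q ^ 2 * (discA q ^ 2 - discB q ^ 2) / 4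

/-- Both quadratic contributions scale alike: differentiating 2L(q²) by q d/dq gives 4(qL')(q²), and
squaring it gives 4L(q²)². The term in A and B absorbs the inhomogeneous part of `logDerivA_sq`. -/
lemma riccatiDefect_sq (hq : ‖q‖ < 1) : 4 * riccatiDefect (q ^ 2) = riccatiDefect q := by
  simp only [riccatiDefect]
  linear_combination q * deriv_logDerivA_sq hq -
    (2 * logDerivA (q ^ 2) + logDerivA q - discB q * (discA q - discB q) / 2) * logDerivA_sq hq
    - (discB q / 2) * mul_deriv_discA hq + (-(discA q - discB q) / 2 + discB q / 2) *
      mul_deriv_discB hq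
    - discB (q ^ 2) ^ 2 / 4 * sq_sub_sq_sq hq - (discA q - discB q) ^ 2 / 4 * discB_sq hq

lemma riccatiDefect_zero : riccatiDefect 0 = 0 := by
  simp [riccatiDefect, logDerivA, discA_zero, discB_zero]

lemma analyticAt_riccatiDefect (hq : ‖q‖ < 1) : AnalyticAt ℂ riccatiDefect q :=
  ((analyticAt_id.mul (analyticAt_logDerivA hq).deriv).sub ((analyticAt_logDerivA hq).pow 2)).sub
    ((((analyticAt_discB hq).pow 2).mul
      (((analyticAt_discA hq).pow 2).sub ((analyticAt_discB hq).pow 2))).div_const)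

lemma tendsto_four_pow_mul (hq : ‖q‖ < 1) :
    Filter.Tendsto (fun n : ℕ => (4 : ℂ) ^ n * q ^ 2 ^ n) Filter.atTop (𝓝 0) := by
  have h := tendsto_pow_const_mul_const_pow_of_abs_lt_one 2 (r := ‖q‖) (by simpa using hq)
  have h2 := h.comp (tendsto_pow_atTop_atTop_of_one_lt (one_lt_two (α := ℕ)))
  rw [tendsto_zero_iff_norm_tendsto_zero]
  refine h2.congr fun n => ?_
  simp only [Function.comp_def, norm_mul, norm_pow, RCLike.norm_ofNat]
  push_cast
  rw [← pow_mul, mul_comm n 2, pow_mul]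
  norm_num

/-- The defect at q is 4^n times the defect at q^(2^n). It is O(q) at the origin, and q^(2^n) decays
faster than 4^n grows. -/
lemma riccatiDefect_eq_zero (hq : ‖q‖ < 1) : riccatiDefect q = 0 := by
  have hn : ∀ n : ℕ, 4 ^ n * riccatiDefect (q ^ 2 ^ n) = riccatiDefect q := by
    intro n
    induction n with
    | zero => simp
    | succ n ih =>
      rw [← ih, pow_succ 2, pow_mul, ← riccatiDefect_sq (norm_pow_two_pow_lt hq n), pow_succ]
      ring
  have hO : riccatiDefect =O[𝓝 0] fun z : ℂ => z := by
    have := (analyticAt_riccatiDefect (q := 0) (by simp)).differentiableAt.isBigO_sub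
    simpa [riccatiDefect_zero] using this
  have hO2 := (Asymptotics.isBigO_refl (fun n : ℕ => (4 : ℂ) ^ n) Filter.atTop).mul
    (hO.comp_tendsto (tendsto_pow_two_pow hq))
  have hc := hO2.trans_tendsto (tendsto_four_pow_mul hq)
  simp only [Function.comp_def, hn] at hc
  exact tendsto_nhds_unique tendsto_const_nhds hc

end Bimodular
end

/-! ### Legendre's equation for θ₃² as a function of t -/

noncomputable section
namespace Bimodular

variable {q : ℂ}

lemma discT_ne_zero (hq : ‖q‖ < 1) : discT q ≠ 0 := div_ne_zero (discB_ne_zero hq) (discA_ne_zero hq)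

lemma discT_mul (hq : ‖q‖ < 1) : discT q * discA q = discB q :=
  div_mul_cancel₀ _ (discA_ne_zero hq)

lemma one_sub_discT_sq_ne_zero (h0 : q ≠ 0) (hq : ‖q‖ < 1) : 1 - discT q ^ 2 ≠ 0 := by
  intro h
  apply sq_sub_sq_ne_zero h0 hq
  rw [← discT_mul hq]
  linear_combination discA q ^ 2 * h

lemma mul_deriv_discT (hq : ‖q‖ < 1) :
    2 * q * deriv discT q = -(discT q * discA q ^ 2 * (1 - discT q ^ 2)) := by
  have hA := discA_ne_zero hq
  have h : HasDerivAt discT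
      ((deriv discB q * discA q - discB q * deriv discA q) / discA q ^ 2) q :=
    (hasDerivAt_discB hq).div (hasDerivAt_discA hq) hA
  rw [h.deriv, mul_div_assoc', div_eq_iff (pow_ne_zero 2 hA)]
  linear_combination deriv_discB_mul hq + (discA q ^ 3 - discA q * ((discT q * discA q) ^ 2 +
    discT q * discA q * discB q + discB q ^ 2)) * discT_mul hq

/-- This makes t a local coordinate, which is needed both to write θ₃² as a function of t and to see
that t is open. -/
lemma deriv_discT_ne_zero (h0 : q ≠ 0) (hq : ‖q‖ < 1) : deriv discT q ≠ 0 := by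
  intro h
  have := mul_deriv_discT hq
  rw [h, mul_zero, eq_comm, neg_eq_zero] at this
  exact mul_ne_zero (mul_ne_zero (discT_ne_zero hq) (pow_ne_zero 2 (discA_ne_zero hq)))
    (one_sub_discT_sq_ne_zero h0 hq) this

/-- `f` satisfies at `s` the differential equation of the complete elliptic integral
`K(√(1 - s ^ 2))`. -/
def SatisfiesLegendreAt (f : ℂ → ℂ) (s : ℂ) : Prop :=
  s * (1 - s ^ 2) * deriv (deriv f) s + (1 - 3 * s ^ 2) * deriv f s - s * f s = 0

/-- Locally `θ₃ ^ 2` is a function of `t` that satisfies Legendre's equation. -/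
theorem exists_local_solution (h0 : q ≠ 0) (hq : ‖q‖ < 1) :
    ∃ f : ℂ → ℂ, AnalyticAt ℂ f (discT q) ∧ (∀ᶠ z in 𝓝 q, f (discT z) = discA z) ∧
      ∀ᶠ s in 𝓝 (discT q), SatisfiesLegendreAt f s := by
  have hT := analyticAt_discT hq
  have hT' := deriv_discT_ne_zero h0 hq
  set r := hT.hasStrictDerivAt.localInverse _ _ _ hT' with hr
  have hrT : r (discT q) = q := HasStrictFDerivAt.localInverse_apply_image ..
  have hra : AnalyticAt ℂ r (discT q) := hT.analyticAt_localInverse hT'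
  have hleft : ∀ᶠ z in 𝓝 q, r (discT z) = z := HasStrictDerivAt.eventually_left_inverse ..
  have hright : ∀ᶠ s in 𝓝 (discT q), discT (r s) = s :=
    HasStrictDerivAt.eventually_right_inverse ..
  have hf : AnalyticAt ℂ (fun s => discA (r s)) (discT q) := by
    refine AnalyticAt.fun_comp ?_ hra
    rw [hrT]
    exact analyticAt_discA hq
  refine ⟨fun s => discA (r s), hf, ?_, ?_⟩
  · filter_upwards [hleft] with z hz
    rw [hz]
  have hn : ∀ᶠ s in 𝓝 (discT q), ‖r s‖ < 1 := by
    have : ∀ᶠ z in 𝓝 (r (discT q)), ‖z‖ < 1 := by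
      rw [hrT]
      exact eventually_norm_lt_one hq
    exact hra.continuousAt.eventually this
  have hne : ∀ᶠ s in 𝓝 (discT q), r s ≠ 0 := by
    have : ∀ᶠ z in 𝓝 (r (discT q)), z ≠ 0 := by
      rw [hrT]
      exact isOpen_ne.mem_nhds h0
    exact hra.continuousAt.eventually this
  -- With f = A ∘ r, differentiating t(r(s)) = s and inserting `mul_deriv_discT` gives s(1 - s²)f' =
  -- -2L/A at r(s).
  have hfirst : ∀ᶠ s in 𝓝 (discT q), HasDerivAt r (deriv r s) s ∧
      r s = -(s * discA (r s) ^ 2 * (1 - s ^ 2)) * deriv r s / 2 ∧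
      HasDerivAt (fun s => discA (r s)) (deriv discA (r s) * deriv r s) s ∧
      s * (1 - s ^ 2) * deriv (fun s => discA (r s)) s =
        -2 * logDerivA (r s) / discA (r s) := by
    filter_upwards [hn, hne, hright.eventually_nhds, hra.eventually_analyticAt] with s h1 h2 h3 h4
    have hs : discT (r s) = s := h3.self_of_nhds
    have hd := h4.differentiableAt.hasDerivAt
    have h5 : HasDerivAt (fun z => discT (r z)) (deriv discT (r s) * deriv r s) s :=
      (analyticAt_discT h1).differentiableAt.hasDerivAt.comp s hd
    have h6 : deriv discT (r s) * deriv r s = 1 :=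
      h5.unique ((hasDerivAt_id s).congr_of_eventuallyEq h3)
    have h7 : HasDerivAt (fun z => discA (r z)) (deriv discA (r s) * deriv r s) s :=
      (hasDerivAt_discA h1).comp s hd
    have h8 := mul_deriv_discT h1
    rw [hs] at h8
    have h9 : r s = -(s * discA (r s) ^ 2 * (1 - s ^ 2)) * deriv r s / 2 := by
      linear_combination (-r s) * h6 + deriv r s / 2 * h8
    refine ⟨hd, h9, h7, ?_⟩
    have hA := discA_ne_zero h1
    rw [h7.deriv, eq_div_iff hA]
    refine mul_right_cancel₀ hA ?_
    linear_combination (2 * deriv discA (r s)) * h9 - 2 * mul_deriv_discA h1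
  filter_upwards [hn, hne, hright, hfirst.eventually_nhds, hf.eventually_analyticAt]
    with s h1 h2 hs h3 h4
  obtain ⟨hd, h9, h7, -⟩ := h3.self_of_nhds
  have hA := discA_ne_zero h1
  have e1 : HasDerivAt (fun s => s * (1 - s ^ 2) * deriv (fun s => discA (r s)) s)
      ((1 - 3 * s ^ 2) * deriv (fun s => discA (r s)) s +
        s * (1 - s ^ 2) * deriv (deriv (fun s => discA (r s))) s) s := by
    have h := ((hasDerivAt_id s).mul ((hasDerivAt_pow 2 s).const_sub 1)).mul
      h4.deriv.differentiableAt.hasDerivAt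
    refine h.congr_deriv ?_
    simp only [Pi.mul_apply, id]
    push_cast
    ring
  have e2 : HasDerivAt (fun s => -2 * logDerivA (r s) / discA (r s))
      ((-2 * (deriv logDerivA (r s) * deriv r s) * discA (r s) -
        -2 * logDerivA (r s) * (deriv discA (r s) * deriv r s)) / discA (r s) ^ 2) s :=
    (((analyticAt_logDerivA h1).differentiableAt.hasDerivAt.comp s hd).const_mul (-2)).div h7 hA
  have e3 := (e1.congr_of_eventuallyEq (h3.mono fun s h => h.2.2.2.symm)).unique e2
  have h10 := riccatiDefect_eq_zero h1
  rw [riccatiDefect, ← discT_mul h1, hs] at h10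
  have h11 := mul_deriv_discA h1
  have hs0 : s ≠ 0 := hs ▸ discT_ne_zero h1
  have hs1 : 1 - s ^ 2 ≠ 0 := by
    have := one_sub_discT_sq_ne_zero h2 h1
    rwa [hs] at this
  rw [SatisfiesLegendreAt]
  -- By the Riccati equation the derivative of -2L/A along r is s·f, so (s(1 - s²)f')' = s f, which
  -- is Legendre's equation. The factor r(s) ≠ 0 is cancelled.
  have e4 : (-2 * (deriv logDerivA (r s) * deriv r s) * discA (r s) -
        -2 * logDerivA (r s) * (deriv discA (r s) * deriv r s)) / discA (r s) ^ 2 =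
      s * discA (r s) := by
    rw [div_eq_iff (pow_ne_zero 2 hA)]
    refine mul_right_cancel₀ h2 ?_
    linear_combination (-2 * deriv r s * discA (r s)) * h10 + 2 * deriv r s * logDerivA (r s) * h11
      - s * discA (r s) ^ 3 * h9
  linear_combination e3 + e4

end Bimodular
end

noncomputable section
namespace Bimodular

/-! ### The coordinates `x` and `y` as functions of `t₁` and `t₂` -/

/-- `x` as a function of `t₁` and `t₂`. -/
def coordX (a b : ℂ) : ℂ := (a + b) ^ 2 * (1 - a * b) ^ 2 / (1 + a * b) ^ 4

/-- `y` as a function of `t₁` and `t₂`. -/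
def coordY (a b : ℂ) : ℂ :=
  a * b * (1 - a ^ 2) * (1 - b ^ 2) / ((a + b) ^ 2 * (1 - a * b) ^ 2)

lemma coordX_comm (a b : ℂ) : coordX a b = coordX b a := by
  rw [coordX, coordX, add_comm a, mul_comm a]

lemma coordY_comm (a b : ℂ) : coordY a b = coordY b a := by
  rw [coordY, coordY, add_comm a, mul_comm a]
  ring

/-- The pairs `(t₁, t₂)` at which `x` and `y` have neither a zero nor a pole. -/
structure IsGood (a b : ℂ) : Prop where
  left : a ≠ 0
  right : b ≠ 0
  left_sq : 1 - a ^ 2 ≠ 0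
  right_sq : 1 - b ^ 2 ≠ 0
  add : a + b ≠ 0
  one_sub : 1 - a * b ≠ 0
  one_add : 1 + a * b ≠ 0

variable {a b : ℂ}

lemma IsGood.symm (h : IsGood a b) : IsGood b a :=
  ⟨h.right, h.left, h.right_sq, h.left_sq, by rw [add_comm]; exact h.add,
    by rw [mul_comm]; exact h.one_sub, by rw [mul_comm]; exact h.one_add⟩

/-- The partial logarithmic derivative of `x` with respect to `t₁`. -/
def logDerivX (a b : ℂ) : ℂ := 2 / (a + b) - 2 * b / (1 - a * b) - 4 * b / (1 + a * b)

/-- The partial logarithmic derivative of `y` with respect to `t₁`. -/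
def logDerivY (a b : ℂ) : ℂ :=
  1 / a - 2 * a / (1 - a ^ 2) - 2 / (a + b) + 2 * b / (1 - a * b)

/-- The partial derivative of `logDerivX` with respect to `t₁`. -/
def logDerivX' (a b : ℂ) : ℂ :=
  -2 / (a + b) ^ 2 - 2 * b ^ 2 / (1 - a * b) ^ 2 + 4 * b ^ 2 / (1 + a * b) ^ 2

/-- The partial derivative of `logDerivY` with respect to `t₁`. -/
def logDerivY' (a b : ℂ) : ℂ :=
  -1 / a ^ 2 - 2 * (1 + a ^ 2) / (1 - a ^ 2) ^ 2 + 2 / (a + b) ^ 2 + 2 * b ^ 2 / (1 - a * b) ^ 2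

lemma hasDerivAt_add_right (a b : ℂ) : HasDerivAt (fun s => s + b) 1 a :=
  (hasDerivAt_id a).add_const b

lemma hasDerivAt_one_sub_mul (a b : ℂ) : HasDerivAt (fun s => 1 - s * b) (-b) a := by
  simpa using ((hasDerivAt_id a).mul_const b).const_sub 1

lemma hasDerivAt_one_add_mul (a b : ℂ) : HasDerivAt (fun s => 1 + s * b) b a := by
  simpa using ((hasDerivAt_id a).mul_const b).const_add 1

lemma hasDerivAt_one_sub_sq (a : ℂ) : HasDerivAt (fun s : ℂ => 1 - s ^ 2) (-(2 * a)) a := by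
  simpa using! (hasDerivAt_pow 2 a).const_sub 1

lemma hasDerivAt_coordX (h : IsGood a b) :
    HasDerivAt (fun s => coordX s b) (coordX a b * logDerivX a b) a := by
  have h1 := h.add
  have h2 := h.one_sub
  have h3 := h.one_add
  refine ((((hasDerivAt_add_right a b).pow 2).mul ((hasDerivAt_one_sub_mul a b).pow 2)).div
    ((hasDerivAt_one_add_mul a b).pow 4) (pow_ne_zero 4 h3)).congr_deriv ?_
  simp only [Pi.mul_apply, Pi.pow_apply, coordX, logDerivX]
  field_simp
  ring

lemma hasDerivAt_coordY (h : IsGood a b) :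
    HasDerivAt (fun s => coordY s b) (coordY a b * logDerivY a b) a := by
  have h1 := h.add
  have h2 := h.one_sub
  have h3 := h.left
  have h4 := h.left_sq
  refine (((((hasDerivAt_id a).mul_const b).mul (hasDerivAt_one_sub_sq a)).mul_const
    (1 - b ^ 2)).div (((hasDerivAt_add_right a b).pow 2).mul ((hasDerivAt_one_sub_mul a b).pow 2))
    (mul_ne_zero (pow_ne_zero 2 h1) (pow_ne_zero 2 h2))).congr_deriv ?_
  simp only [Pi.mul_apply, Pi.pow_apply, coordY, logDerivY, id]
  generalize hs : a + b = s at h1 ⊢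
  generalize hm : 1 - a * b = m at h2 ⊢
  generalize ha : 1 - a ^ 2 = a' at h4 ⊢
  field_simp
  subst hs hm ha
  ring

lemma hasDerivAt_logDerivX (h : IsGood a b) :
    HasDerivAt (fun s => logDerivX s b) (logDerivX' a b) a := by
  have h1 := h.add
  have h2 := h.one_sub
  have h3 := h.one_add
  refine ((((hasDerivAt_const a 2).div (hasDerivAt_add_right a b) h1).sub
    ((hasDerivAt_const a (2 * b)).div (hasDerivAt_one_sub_mul a b) h2)).sub
    ((hasDerivAt_const a (4 * b)).div (hasDerivAt_one_add_mul a b) h3)).congr_deriv ?_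
  simp only [logDerivX']
  ring

lemma hasDerivAt_logDerivY (h : IsGood a b) :
    HasDerivAt (fun s => logDerivY s b) (logDerivY' a b) a := by
  have h1 := h.add
  have h2 := h.one_sub
  have h3 := h.left
  have h4 := h.left_sq
  refine (((((hasDerivAt_const a 1).div (hasDerivAt_id a) h3).sub
    (((hasDerivAt_id a).const_mul 2).div (hasDerivAt_one_sub_sq a) h4)).sub
    ((hasDerivAt_const a 2).div (hasDerivAt_add_right a b) h1)).add
    ((hasDerivAt_const a (2 * b)).div (hasDerivAt_one_sub_mul a b) h2)).congr_deriv ?_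
  simp only [logDerivY', id]
  ring

/-- The Jacobian of `(log x, log y)` with respect to `(t₁, t₂)`. -/
def logJacobian (a b : ℂ) : ℂ :=
  logDerivX a b * logDerivY b a - logDerivX b a * logDerivY a b

/-- The polynomial whose zeros are the critical points of `(x, y)`. -/
def criticalPoly (a b : ℂ) : ℂ :=
  (a - b) * (a * b - (a + b) - 1) * (a * b + (a + b) - 1)

/-- The factors of `criticalPoly` are the fixed curves of symmetries of (x, y), which must be
critical: the exchange of a and b, alone or combined with one of the involutions s ↦ (s + 1)/(s - 1)
and s ↦ (1 - s)/(1 + s) in both variables. -/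
lemma logJacobian_eq (h : IsGood a b) :
    logJacobian a b * (a * b * (1 - a ^ 2) * (1 - b ^ 2) * (a + b) * (1 - a * b)) =
      2 * (1 + a * b) * criticalPoly a b := by
  have h1 := h.add
  have h2 := h.one_sub
  have h3 := h.left
  have h4 := h.left_sq
  have h5 := h.right
  have h6 := h.right_sq
  have h7 := h.one_add
  have h1' := h.symm.add
  have h2' := h.symm.one_sub
  have h7' := h.symm.one_add
  simp only [logJacobian, logDerivX, logDerivY, criticalPoly]
  rw [add_comm b a, mul_comm b a]
  field_simp
  ring

/-! ### The system of differential equations in the coordinates `t₁` and `t₂` -/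

/-- The coefficient of the second derivative in the equation of `F` with respect to `t₁`. -/
def coeff₂ (a b : ℂ) : ℂ := (1 + a * b) ^ 2 * a * (1 - a ^ 2)

/-- The coefficient of the first derivative in the equation of `F` with respect to `t₁`. -/
def coeff₁ (a b : ℂ) : ℂ :=
  (1 + a * b) ^ 2 * (1 - 3 * a ^ 2) - 2 * b * (1 + a * b) * a * (1 - a ^ 2)

/-- The coefficient of `F` in the equation of `F` with respect to `t₁`. -/
def coeff₀ (a b : ℂ) : ℂ :=
  2 * b ^ 2 * a * (1 - a ^ 2) - b * (1 + a * b) * (1 - 3 * a ^ 2) - a * (1 + a * b) ^ 2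

/-- The multiplier of the equation with respect to `t₁` in the first equation of the system. -/
def mult₁ (a b : ℂ) : ℂ :=
  (a + b) * (1 - a * b) * a * (1 - a ^ 2) * (1 + b ^ 2) ^ 2 / ((1 + a * b) ^ 5 * criticalPoly a b)

/-- The multiplier of the equation with respect to `t₁` in the second equation of the system. -/
def mult₂ (a b : ℂ) : ℂ :=
  -(a * b * (1 - a ^ 2) * (1 - b ^ 2)) / ((1 + a * b) ^ 3 * criticalPoly a b)

lemma criticalPoly_comm (a b : ℂ) : criticalPoly b a = -criticalPoly a b := by
  simp only [criticalPoly]; ring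

/-! ### Coefficient identities expressing the system through the equations in t₁ and t₂ -/

section Identities

variable (h : IsGood a b) (hc : criticalPoly a b ≠ 0)
include h hc

/-- The suffixes uu, uv, vv, u, v, zero stand for θ_x², θ_xθ_y (half its coefficient), θ_y², θ_x,
θ_y and 1. Off the critical curves the three identities of order two already determine both
multipliers; the remaining three are then genuine checks. -/
lemma second_uu : mult₂ a b * coeff₂ a b * logDerivX a b ^ 2 +
    mult₂ b a * coeff₂ b a * logDerivX b a ^ 2 =
      -4 * coordY a b := by
  obtain ⟨h1, h2, h3, h4, h5, h6, h7⟩ := h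
  simp only [mult₂, coeff₂, logDerivX, coordY, criticalPoly_comm a b]
  rw [add_comm b a, mul_comm b a]
  -- The factors of the denominators are made atomic while fractions are cleared, and expanded again
  -- for the polynomial identity.
  generalize hc' : criticalPoly a b = c at hc ⊢
  generalize hs : a + b = s at h5 ⊢
  generalize hm : 1 - a * b = m at h6 ⊢
  generalize hp : 1 + a * b = p at h7 ⊢
  generalize ha : 1 - a ^ 2 = a' at h3 ⊢
  generalize hb : 1 - b ^ 2 = b' at h4 ⊢
  field_simp
  subst hs hm hp ha hb hc'
  rw [criticalPoly]
  ring

lemma second_uv : mult₂ a b * coeff₂ a b * (logDerivX a b * logDerivY a b) +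
    mult₂ b a * coeff₂ b a * (logDerivX b a * logDerivY b a) =
      4 * coordY a b := by
  obtain ⟨h1, h2, h3, h4, h5, h6, h7⟩ := h
  simp only [mult₂, coeff₂, logDerivX, logDerivY, coordY, criticalPoly_comm a b]
  rw [add_comm b a, mul_comm b a]
  generalize hc' : criticalPoly a b = c at hc ⊢
  generalize hs : a + b = s at h5 ⊢
  generalize hm : 1 - a * b = m at h6 ⊢
  generalize hp : 1 + a * b = p at h7 ⊢
  generalize ha : 1 - a ^ 2 = a' at h3 ⊢
  generalize hb : 1 - b ^ 2 = b' at h4 ⊢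
  field_simp
  subst hs hm hp ha hb hc'
  rw [criticalPoly]
  ring

lemma second_vv : mult₂ a b * coeff₂ a b * logDerivY a b ^ 2 +
    mult₂ b a * coeff₂ b a * logDerivY b a ^ 2 =
      1 - 4 * coordY a b := by
  obtain ⟨h1, h2, h3, h4, h5, h6, h7⟩ := h
  simp only [mult₂, coeff₂, logDerivY, coordY, criticalPoly_comm a b]
  rw [add_comm b a, mul_comm b a]
  generalize hc' : criticalPoly a b = c at hc ⊢
  generalize hs : a + b = s at h5 ⊢
  generalize hm : 1 - a * b = m at h6 ⊢
  generalize hp : 1 + a * b = p at h7 ⊢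
  generalize ha : 1 - a ^ 2 = a' at h3 ⊢
  generalize hb : 1 - b ^ 2 = b' at h4 ⊢
  field_simp
  subst hs hm hp ha hb hc'
  rw [criticalPoly]
  ring

lemma first_uu : mult₁ a b * coeff₂ a b * logDerivX a b ^ 2 +
    mult₁ b a * coeff₂ b a * logDerivX b a ^ 2 =
      4 - 4 * coordX a b - 16 * coordX a b * coordY a b := by
  obtain ⟨h1, h2, h3, h4, h5, h6, h7⟩ := h
  simp only [mult₁, coeff₂, logDerivX, coordX, coordY, criticalPoly_comm a b]
  rw [add_comm b a, mul_comm b a]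
  generalize hc' : criticalPoly a b = c at hc ⊢
  generalize hs : a + b = s at h5 ⊢
  generalize hm : 1 - a * b = m at h6 ⊢
  generalize hp : 1 + a * b = p at h7 ⊢
  generalize ha : 1 - a ^ 2 = a' at h3 ⊢
  generalize hb : 1 - b ^ 2 = b' at h4 ⊢
  field_simp
  subst hs hm hp ha hb hc'
  rw [criticalPoly]
  ring

lemma first_uv : mult₁ a b * coeff₂ a b * (logDerivX a b * logDerivY a b) +
    mult₁ b a * coeff₂ b a * (logDerivX b a * logDerivY b a) =
      -2 - 2 * coordX a b * (1 - 4 * coordY a b) := by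
  obtain ⟨h1, h2, h3, h4, h5, h6, h7⟩ := h
  simp only [mult₁, coeff₂, logDerivX, logDerivY, coordX, coordY, criticalPoly_comm a b]
  rw [add_comm b a, mul_comm b a]
  generalize hc' : criticalPoly a b = c at hc ⊢
  generalize hs : a + b = s at h5 ⊢
  generalize hm : 1 - a * b = m at h6 ⊢
  generalize hp : 1 + a * b = p at h7 ⊢
  generalize ha : 1 - a ^ 2 = a' at h3 ⊢
  generalize hb : 1 - b ^ 2 = b' at h4 ⊢
  field_simp
  subst hs hm hp ha hb hc'
  rw [criticalPoly]
  ring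

lemma first_vv : mult₁ a b * coeff₂ a b * logDerivY a b ^ 2 +
    mult₁ b a * coeff₂ b a * logDerivY b a ^ 2 =
      0 := by
  obtain ⟨h1, h2, h3, h4, h5, h6, h7⟩ := h
  simp only [mult₁, coeff₂, logDerivY, criticalPoly_comm a b]
  rw [add_comm b a, mul_comm b a]
  generalize hc' : criticalPoly a b = c at hc ⊢
  generalize hs : a + b = s at h5 ⊢
  generalize hm : 1 - a * b = m at h6 ⊢
  generalize hp : 1 + a * b = p at h7 ⊢
  generalize ha : 1 - a ^ 2 = a' at h3 ⊢
  generalize hb : 1 - b ^ 2 = b' at h4 ⊢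
  field_simp
  subst hs hm hp ha hb hc'
  rw [criticalPoly]
  ring

lemma second_u : mult₂ a b * (coeff₂ a b * logDerivX' a b + coeff₁ a b * logDerivX a b) +
    mult₂ b a * (coeff₂ b a * logDerivX' b a + coeff₁ b a * logDerivX b a) =
      2 * coordY a b := by
  obtain ⟨h1, h2, h3, h4, h5, h6, h7⟩ := h
  simp only [mult₂, coeff₂, coeff₁, logDerivX', logDerivX, coordY, criticalPoly_comm a b]
  rw [add_comm b a, mul_comm b a]
  generalize hc' : criticalPoly a b = c at hc ⊢
  generalize hs : a + b = s at h5 ⊢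
  generalize hm : 1 - a * b = m at h6 ⊢
  generalize hp : 1 + a * b = p at h7 ⊢
  generalize ha : 1 - a ^ 2 = a' at h3 ⊢
  generalize hb : 1 - b ^ 2 = b' at h4 ⊢
  field_simp
  subst hs hm hp ha hb hc'
  rw [criticalPoly]
  ring

lemma second_v : mult₂ a b * (coeff₂ a b * logDerivY' a b + coeff₁ a b * logDerivY a b) +
    mult₂ b a * (coeff₂ b a * logDerivY' b a + coeff₁ b a * logDerivY b a) =
      -2 * coordY a b := by
  obtain ⟨h1, h2, h3, h4, h5, h6, h7⟩ := h
  simp only [mult₂, coeff₂, coeff₁, logDerivY', logDerivY, coordY, criticalPoly_comm a b]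
  rw [add_comm b a, mul_comm b a]
  generalize hc' : criticalPoly a b = c at hc ⊢
  generalize hs : a + b = s at h5 ⊢
  generalize hm : 1 - a * b = m at h6 ⊢
  generalize hp : 1 + a * b = p at h7 ⊢
  generalize ha : 1 - a ^ 2 = a' at h3 ⊢
  generalize hb : 1 - b ^ 2 = b' at h4 ⊢
  field_simp
  subst hs hm hp ha hb hc'
  rw [criticalPoly]
  ring

lemma first_u : mult₁ a b * (coeff₂ a b * logDerivX' a b + coeff₁ a b * logDerivX a b) +
    mult₁ b a * (coeff₂ b a * logDerivX' b a + coeff₁ b a * logDerivX b a) =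
      -4 * coordX a b - 8 * coordX a b * coordY a b := by
  obtain ⟨h1, h2, h3, h4, h5, h6, h7⟩ := h
  simp only [mult₁, coeff₂, coeff₁, logDerivX', logDerivX, coordX, coordY, criticalPoly_comm a b]
  rw [add_comm b a, mul_comm b a]
  generalize hc' : criticalPoly a b = c at hc ⊢
  generalize hs : a + b = s at h5 ⊢
  generalize hm : 1 - a * b = m at h6 ⊢
  generalize hp : 1 + a * b = p at h7 ⊢
  generalize ha : 1 - a ^ 2 = a' at h3 ⊢
  generalize hb : 1 - b ^ 2 = b' at h4 ⊢
  field_simp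
  subst hs hm hp ha hb hc'
  rw [criticalPoly]
  ring

lemma first_v : mult₁ a b * (coeff₂ a b * logDerivY' a b + coeff₁ a b * logDerivY a b) +
    mult₁ b a * (coeff₂ b a * logDerivY' b a + coeff₁ b a * logDerivY b a) =
      -2 * coordX a b * (1 - 4 * coordY a b) := by
  obtain ⟨h1, h2, h3, h4, h5, h6, h7⟩ := h
  simp only [mult₁, coeff₂, coeff₁, logDerivY', logDerivY, coordX, coordY, criticalPoly_comm a b]
  rw [add_comm b a, mul_comm b a]
  generalize hc' : criticalPoly a b = c at hc ⊢
  generalize hs : a + b = s at h5 ⊢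
  generalize hm : 1 - a * b = m at h6 ⊢
  generalize hp : 1 + a * b = p at h7 ⊢
  generalize ha : 1 - a ^ 2 = a' at h3 ⊢
  generalize hb : 1 - b ^ 2 = b' at h4 ⊢
  field_simp
  subst hs hm hp ha hb hc'
  rw [criticalPoly]
  ring

lemma second_zero : mult₂ a b * coeff₀ a b + mult₂ b a * coeff₀ b a = 0 := by
  obtain ⟨h1, h2, h3, h4, h5, h6, h7⟩ := h
  simp only [mult₂, coeff₀, criticalPoly_comm a b]
  rw [mul_comm b a]
  generalize hc' : criticalPoly a b = c at hc ⊢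
  generalize hp : 1 + a * b = p at h7 ⊢
  generalize ha : 1 - a ^ 2 = a' at h3 ⊢
  generalize hb : 1 - b ^ 2 = b' at h4 ⊢
  field_simp
  subst hp ha hb hc'
  rw [criticalPoly]
  ring

lemma first_zero : mult₁ a b * coeff₀ a b + mult₁ b a * coeff₀ b a = -coordX a b := by
  obtain ⟨h1, h2, h3, h4, h5, h6, h7⟩ := h
  simp only [mult₁, coeff₀, coordX, criticalPoly_comm a b]
  rw [add_comm b a, mul_comm b a]
  generalize hc' : criticalPoly a b = c at hc ⊢
  generalize hs : a + b = s at h5 ⊢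
  generalize hm : 1 - a * b = m at h6 ⊢
  generalize hp : 1 + a * b = p at h7 ⊢
  generalize ha : 1 - a ^ 2 = a' at h3 ⊢
  generalize hb : 1 - b ^ 2 = b' at h4 ⊢
  field_simp
  subst hs hm hp ha hb hc'
  rw [criticalPoly]
  ring

end Identities
end Bimodular
end

noncomputable section
namespace Bimodular

/-! ### The operators `θ_x` and `θ_y` on analytic functions -/

variable {Φ : ℂ × ℂ → ℂ} {p : ℂ × ℂ}

lemma hasDerivAt_slice_fst (h : AnalyticAt ℂ Φ p) :
    HasDerivAt (fun s => Φ (s, p.2)) (fderiv ℂ Φ p (1, 0)) p.1 :=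
  HasFDerivAt.comp_hasDerivAt (f := fun s => (s, p.2)) p.1 h.differentiableAt.hasFDerivAt
    ((hasDerivAt_id p.1).prodMk (hasDerivAt_const p.1 p.2))

lemma hasDerivAt_slice_snd (h : AnalyticAt ℂ Φ p) :
    HasDerivAt (fun s => Φ (p.1, s)) (fderiv ℂ Φ p (0, 1)) p.2 :=
  HasFDerivAt.comp_hasDerivAt (f := fun s => (p.1, s)) p.2 h.differentiableAt.hasFDerivAt
    ((hasDerivAt_const p.2 p.1).prodMk (hasDerivAt_id p.2))

lemma thetaX_eq (h : AnalyticAt ℂ Φ p) : thetaX Φ p = p.1 * fderiv ℂ Φ p (1, 0) := by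
  rw [thetaX, (hasDerivAt_slice_fst h).deriv]

lemma thetaY_eq (h : AnalyticAt ℂ Φ p) : thetaY Φ p = p.2 * fderiv ℂ Φ p (0, 1) := by
  rw [thetaY, (hasDerivAt_slice_snd h).deriv]

lemma analyticAt_fderiv_apply (h : AnalyticAt ℂ Φ p) (v : ℂ × ℂ) :
    AnalyticAt ℂ (fun z => fderiv ℂ Φ z v) p :=
  ((ContinuousLinearMap.apply ℂ ℂ v).analyticAt _).comp h.fderiv

lemma analyticAt_thetaX (h : AnalyticAt ℂ Φ p) : AnalyticAt ℂ (thetaX Φ) p :=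
  (analyticAt_fst.mul (analyticAt_fderiv_apply h (1, 0))).congr
    (h.eventually_analyticAt.mono fun _ hz => (thetaX_eq hz).symm)

lemma analyticAt_thetaY (h : AnalyticAt ℂ Φ p) : AnalyticAt ℂ (thetaY Φ) p :=
  (analyticAt_snd.mul (analyticAt_fderiv_apply h (0, 1))).congr
    (h.eventually_analyticAt.mono fun _ hz => (thetaY_eq hz).symm)

lemma hasDerivAt_fst (h : AnalyticAt ℂ Φ p) :
    HasDerivAt (fun s => Φ (s, p.2)) (deriv (fun s => Φ (s, p.2)) p.1) p.1 :=
  (hasDerivAt_slice_fst h).differentiableAt.hasDerivAt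

lemma hasDerivAt_snd (h : AnalyticAt ℂ Φ p) :
    HasDerivAt (fun s => Φ (p.1, s)) (deriv (fun s => Φ (p.1, s)) p.2) p.2 :=
  (hasDerivAt_slice_snd h).differentiableAt.hasDerivAt

lemma fderiv_fderiv_apply_comm (h : AnalyticAt ℂ Φ p) (v w : ℂ × ℂ) :
    fderiv ℂ (fun z => fderiv ℂ Φ z v) p w = fderiv ℂ (fun z => fderiv ℂ Φ z w) p v := by
  have h2 := h.fderiv.differentiableAt.hasFDerivAt
  have e : ∀ u : ℂ × ℂ, HasFDerivAt (fun z => fderiv ℂ Φ z u)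
      ((ContinuousLinearMap.apply ℂ ℂ u).comp (fderiv ℂ (fderiv ℂ Φ) p)) p := fun u =>
    (ContinuousLinearMap.apply ℂ ℂ u).hasFDerivAt.comp p h2
  rw [(e v).fderiv, (e w).fderiv]
  exact second_derivative_symmetric_of_eventually
    (h.eventually_analyticAt.mono fun _ hz => hz.differentiableAt.hasFDerivAt) h2 w v

/-- Symmetry of second derivatives; the coordinate factors pass through because each operator leaves
the other coordinate fixed. -/
lemma thetaX_thetaY (h : AnalyticAt ℂ Φ p) : thetaX (thetaY Φ) p = thetaY (thetaX Φ) p := by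
  have hx := analyticAt_fderiv_apply h (1, 0)
  have hy := analyticAt_fderiv_apply h (0, 1)
  have e1 : (fun s => thetaY Φ (s, p.2)) =ᶠ[𝓝 p.1] fun s => p.2 * fderiv ℂ Φ (s, p.2) (0, 1) := by
    have hc : ContinuousAt (fun s : ℂ => (s, p.2)) p.1 := by fun_prop
    exact hc.eventually (h.eventually_analyticAt.mono fun z hz => thetaY_eq hz)
  have e2 : (fun s => thetaX Φ (p.1, s)) =ᶠ[𝓝 p.2] fun s => p.1 * fderiv ℂ Φ (p.1, s) (1, 0) := by
    have hc : ContinuousAt (fun s : ℂ => (p.1, s)) p.2 := by fun_prop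
    exact hc.eventually (h.eventually_analyticAt.mono fun z hz => thetaX_eq hz)
  rw [thetaX, thetaY, e1.deriv_eq, e2.deriv_eq,
    ((hasDerivAt_slice_fst hy).const_mul p.2).deriv,
    ((hasDerivAt_slice_snd hx).const_mul p.1).deriv, fderiv_fderiv_apply_comm h (0, 1) (1, 0)]
  ring

/-- The system of differential equations, written out in terms of the iterates of `θ_x`
and `θ_y`. -/
lemma satisfiesSystemAt_iff (h : AnalyticAt ℂ Φ p) :
    SatisfiesSystemAt Φ p ↔
      (4 - 4 * p.1 - 16 * p.1 * p.2) * thetaX (thetaX Φ) p +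
          2 * (-2 - 2 * p.1 * (1 - 4 * p.2)) * thetaY (thetaX Φ) p +
          (-4 * p.1 - 8 * p.1 * p.2) * thetaX Φ p -
          2 * p.1 * (1 - 4 * p.2) * thetaY Φ p - p.1 * Φ p = 0 ∧
      -4 * p.2 * thetaX (thetaX Φ) p + 2 * (4 * p.2) * thetaY (thetaX Φ) p +
          (1 - 4 * p.2) * thetaY (thetaY Φ) p + 2 * p.2 * thetaX Φ p - 2 * p.2 * thetaY Φ p = 0 := by
  have hU := analyticAt_thetaX h
  have hW := analyticAt_thetaY h
  have eU := hasDerivAt_fst hU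
  have eW := hasDerivAt_fst hW
  have eΦ := hasDerivAt_fst h
  have gU := hasDerivAt_snd hU
  have gW := hasDerivAt_snd hW
  have gΦ := hasDerivAt_snd h
  have hcomm := thetaX_thetaY h
  have k1 : thetaX (fun z => thetaX Φ z - thetaY Φ z) p =
      thetaX (thetaX Φ) p - thetaX (thetaY Φ) p := by
    rw [thetaX, (eU.fun_sub eW).deriv, mul_sub]; rfl
  have k2 : thetaX (opA Φ) p = 2 * thetaX (thetaX Φ) p + thetaX Φ p := by
    have := ((eU.const_mul 2).fun_add eΦ).deriv
    rw [thetaX, show (fun s => opA Φ (s, p.2)) = fun s => 2 * thetaX Φ (s, p.2) + Φ (s, p.2) from rfl,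
      this, mul_add, mul_left_comm]
    rfl
  -- The coefficients inside `opB` depend on y alone, so θ_x passes through them. The other inner
  -- operators have constant coefficients.
  have k3 : thetaX (opB Φ) p =
      4 * p.2 * thetaX (thetaX Φ) p + (1 - 4 * p.2) * thetaX (thetaY Φ) p := by
    have := ((eU.const_mul (4 * p.2)).fun_add (eW.const_mul (1 - 4 * p.2))).deriv
    rw [thetaX, show (fun s => opB Φ (s, p.2)) = fun s => 4 * p.2 * thetaX Φ (s, p.2) +
      (1 - 4 * p.2) * thetaY Φ (s, p.2) from rfl, this, mul_add, mul_left_comm,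
      mul_left_comm _ (1 - 4 * p.2)]
    rfl
  have k4 : thetaX (fun z => opC Φ z + Φ z) p =
      2 * thetaX (thetaY Φ) p - 2 * thetaX (thetaX Φ) p + thetaX Φ p := by
    have := (((eW.const_mul 2).fun_sub (eU.const_mul 2)).fun_add eΦ).deriv
    rw [thetaX, show (fun s => opC Φ (s, p.2) + Φ (s, p.2)) = fun s => 2 * thetaY Φ (s, p.2) -
      2 * thetaX Φ (s, p.2) + Φ (s, p.2) from rfl, this, mul_add, mul_sub, mul_left_comm,
      mul_left_comm _ 2]
    rfl
  have k5 : thetaY (fun z => opC Φ z + Φ z) p =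
      2 * thetaY (thetaY Φ) p - 2 * thetaY (thetaX Φ) p + thetaY Φ p := by
    have := (((gW.const_mul 2).fun_sub (gU.const_mul 2)).fun_add gΦ).deriv
    rw [thetaY, show (fun s => opC Φ (p.1, s) + Φ (p.1, s)) = fun s => 2 * thetaY Φ (p.1, s) -
      2 * thetaX Φ (p.1, s) + Φ (p.1, s) from rfl, this, mul_add, mul_sub, mul_left_comm,
      mul_left_comm _ 2]
    rfl
  rw [SatisfiesSystemAt, opA, k2, opA, opC, k4, k5, hcomm, k1, opA, k3, opB, hcomm]
  refine and_congr ?_ ?_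
  · constructor <;> intro h' <;> linear_combination h'
  · constructor <;> intro h' <;> linear_combination h'

/-! ### The chain rule -/

variable {a b : ℂ}

lemma hasDerivAt_comp_coord (h : IsGood a b) (hΦ : AnalyticAt ℂ Φ (coordX a b, coordY a b)) :
    HasDerivAt (fun s => Φ (coordX s b, coordY s b))
      (logDerivX a b * thetaX Φ (coordX a b, coordY a b) +
        logDerivY a b * thetaY Φ (coordX a b, coordY a b)) a := by
  have h1 := HasFDerivAt.comp_hasDerivAt (f := fun s => (coordX s b, coordY s b)) a
    hΦ.differentiableAt.hasFDerivAt ((hasDerivAt_coordX h).prodMk (hasDerivAt_coordY h))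
  refine h1.congr_deriv ?_
  have e : (coordX a b * logDerivX a b, coordY a b * logDerivY a b) =
      (coordX a b * logDerivX a b) • ((1 : ℂ), (0 : ℂ)) +
        (coordY a b * logDerivY a b) • ((0 : ℂ), (1 : ℂ)) := by simp
  rw [e, map_add, map_smul, map_smul, thetaX_eq hΦ, thetaY_eq hΦ, smul_eq_mul, smul_eq_mul]
  ring

lemma IsGood.eventually (h : IsGood a b) : ∀ᶠ s in 𝓝 a, IsGood s b := by
  have c1 : ContinuousAt (fun s : ℂ => 1 - s ^ 2) a := by fun_prop
  have c2 : ContinuousAt (fun s : ℂ => s + b) a := by fun_prop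
  have c3 : ContinuousAt (fun s : ℂ => 1 - s * b) a := by fun_prop
  have c4 : ContinuousAt (fun s : ℂ => 1 + s * b) a := by fun_prop
  filter_upwards [isOpen_ne.mem_nhds h.left, c1.eventually_ne h.left_sq, c2.eventually_ne h.add,
    c3.eventually_ne h.one_sub, c4.eventually_ne h.one_add] with s h1 h2 h3 h4 h5
  exact ⟨h1, h.right, h2, h.right_sq, h3, h4, h5⟩

lemma continuousAt_coord (h : IsGood a b) :
    ContinuousAt (fun s => (coordX s b, coordY s b)) a :=
  (hasDerivAt_coordX h).continuousAt.prodMk (hasDerivAt_coordY h).continuousAt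

/-- The second-order equation in the `t₁`-direction. -/
lemma equation_fst {f : ℂ → ℂ} {c : ℂ} (h : IsGood a b)
    (hΦ : AnalyticAt ℂ Φ (coordX a b, coordY a b)) (hf : AnalyticAt ℂ f a)
    (hL : SatisfiesLegendreAt f a)
    (he : ∀ᶠ s in 𝓝 a, (1 + s * b) * f s * c = Φ (coordX s b, coordY s b)) :
    let P := (coordX a b, coordY a b)
    coeff₂ a b * (logDerivX a b ^ 2 * thetaX (thetaX Φ) P +
        2 * (logDerivX a b * logDerivY a b) * thetaY (thetaX Φ) P +
        logDerivY a b ^ 2 * thetaY (thetaY Φ) P + logDerivX' a b * thetaX Φ P +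
        logDerivY' a b * thetaY Φ P) +
      coeff₁ a b * (logDerivX a b * thetaX Φ P + logDerivY a b * thetaY Φ P) +
      coeff₀ a b * Φ P = 0 := by
  intro P
  -- The first-order relation is needed near a, since it is differentiated once more below.
  have hd : ∀ᶠ s in 𝓝 a, b * f s * c + (1 + s * b) * deriv f s * c =
      logDerivX s b * thetaX Φ (coordX s b, coordY s b) +
        logDerivY s b * thetaY Φ (coordX s b, coordY s b) := by
    filter_upwards [h.eventually, he.eventually_nhds, hf.eventually_analyticAt,
      (continuousAt_coord h).eventually hΦ.eventually_analyticAt] with s h1 h2 h3 h4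
    have e1 := hasDerivAt_comp_coord h1 h4
    have e2 := ((hasDerivAt_one_add_mul s b).mul h3.differentiableAt.hasDerivAt).mul_const c
    linear_combination -(e1.congr_of_eventuallyEq h2).unique e2
  have e1 := ((hasDerivAt_logDerivX h).mul (hasDerivAt_comp_coord h (analyticAt_thetaX hΦ))).add
    ((hasDerivAt_logDerivY h).mul (hasDerivAt_comp_coord h (analyticAt_thetaY hΦ)))
  have e2 := ((hf.differentiableAt.hasDerivAt.const_mul b).mul_const c).add
    (((hasDerivAt_one_add_mul a b).mul hf.deriv.differentiableAt.hasDerivAt).mul_const c)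
  have k2 := (e1.congr_of_eventuallyEq hd).unique e2
  have k1 := hd.self_of_nhds
  have k0 := he.self_of_nhds
  rw [thetaX_thetaY hΦ] at k2
  rw [SatisfiesLegendreAt] at hL
  rw [coeff₂, coeff₁, coeff₀]
  -- The coefficients come from substituting f = F/((1 + ab)c) into Legendre's equation and
  -- multiplying by (1 + ab)³c.
  linear_combination ((1 + a * b) ^ 2 * a * (1 - a ^ 2)) * k2 -
    ((1 + a * b) ^ 2 * (1 - 3 * a ^ 2) - 2 * b * (1 + a * b) * a * (1 - a ^ 2)) * k1 -
    (2 * b ^ 2 * a * (1 - a ^ 2) - b * (1 + a * b) * (1 - 3 * a ^ 2) - a * (1 + a * b) ^ 2) * k0 +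
    (1 + a * b) ^ 3 * c * hL

/-- If `(1 + t₁ t₂) f(t₁) g(t₂) / 2` is a function of `(x, y)` and `f`, `g` satisfy Legendre's
equation, then this function satisfies the system. -/
theorem satisfiesSystemAt_of_eventually {f g : ℂ → ℂ} (h : IsGood a b)
    (hc : criticalPoly a b ≠ 0) (hΦ : AnalyticAt ℂ Φ (coordX a b, coordY a b))
    (hf : AnalyticAt ℂ f a) (hg : AnalyticAt ℂ g b)
    (hLf : SatisfiesLegendreAt f a) (hLg : SatisfiesLegendreAt g b)
    (he : ∀ᶠ s in 𝓝 (a, b), (1 + s.1 * s.2) / 2 * f s.1 * g s.2 =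
      Φ (coordX s.1 s.2, coordY s.1 s.2)) :
    SatisfiesSystemAt Φ (coordX a b, coordY a b) := by
  have c1 : ContinuousAt (fun s : ℂ => (s, b)) a := by fun_prop
  have c2 : ContinuousAt (fun s : ℂ => (a, s)) b := by fun_prop
  have E1 := equation_fst (c := g b / 2) h hΦ hf hLf ((c1.eventually he).mono fun s hs => by
    rw [← hs]; ring)
  have hΦ' : AnalyticAt ℂ Φ (coordX b a, coordY b a) := by
    rwa [coordX_comm, coordY_comm] at hΦ
  -- Symmetry of x and y gives the equation in t₂ from the one in t₁ with a and b exchanged.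
  have E2 := equation_fst (c := f a / 2) h.symm hΦ' hg hLg ((c2.eventually he).mono fun s hs => by
    rw [coordX_comm s, coordY_comm s, ← hs]; ring)
  rw [satisfiesSystemAt_iff hΦ]
  simp only [coordX_comm b a, coordY_comm b a] at E1 E2
  set P := (coordX a b, coordY a b) with hP
  constructor
  · linear_combination mult₁ a b * E1 + mult₁ b a * E2 - thetaX (thetaX Φ) P * first_uu h hc -
      2 * thetaY (thetaX Φ) P * first_uv h hc - thetaY (thetaY Φ) P * first_vv h hc -
      thetaX Φ P * first_u h hc - thetaY Φ P * first_v h hc - Φ P * first_zero h hc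
  · linear_combination mult₂ a b * E1 + mult₂ b a * E2 - thetaX (thetaX Φ) P * second_uu h hc -
      2 * thetaY (thetaX Φ) P * second_uv h hc - thetaY (thetaY Φ) P * second_vv h hc -
      thetaX Φ P * second_u h hc - thetaY Φ P * second_v h hc - Φ P * second_zero h hc

end Bimodular
end

noncomputable section
namespace Bimodular

/-! ### The functions on the upper half-plane in terms of `q` -/

/-- `q = exp (2 π i z)`. -/
def nome (z : ℂ) : ℂ := Complex.exp (2 * Real.pi * Complex.I * z)

lemma nome_ne_zero (z : ℂ) : nome z ≠ 0 := Complex.exp_ne_zero _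

lemma norm_nome_lt_one {z : ℂ} (hz : 0 < z.im) : ‖nome z‖ < 1 := by
  rw [nome, Complex.norm_exp, Real.exp_lt_one_iff]
  have : (2 * Real.pi * Complex.I * z).re = -(2 * Real.pi * z.im) := by simp
  rw [this]
  have := Real.pi_pos
  simp only [Left.neg_neg_iff]
  positivity

lemma norm_nome_coe_lt_one (τ : ℍ) : ‖nome τ‖ < 1 := norm_nome_lt_one τ.im_pos

lemma hasDerivAt_nome (z : ℂ) : HasDerivAt nome (2 * Real.pi * Complex.I * nome z) z := by
  refine ((hasDerivAt_id z).const_mul (2 * Real.pi * Complex.I : ℂ)).cexp.congr_deriv ?_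
  simp only [nome, id]
  ring

lemma natCast_natAbs_sq (n : ℤ) : ((n.natAbs ^ 2 : ℕ) : ℂ) = (n : ℂ) ^ 2 := by
  have : ((n.natAbs ^ 2 : ℕ) : ℤ) = n ^ 2 := by simp
  rw [← Int.cast_natCast, this, Int.cast_pow]

lemma exp_eq_nome_pow (n : ℤ) (z : ℂ) :
    Complex.exp (2 * Real.pi * Complex.I * (n : ℂ) ^ 2 * z) = nome z ^ (n.natAbs ^ 2) := by
  rw [nome, ← Complex.exp_nat_mul, natCast_natAbs_sq]
  congr 1
  ring

lemma theta3_eq (τ : ℍ) : theta3 τ = discTheta (nome τ) :=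
  tsum_congr fun n => exp_eq_nome_pow n τ

lemma theta4_eq (τ : ℍ) : theta4 τ = discTheta (-nome τ) := by
  refine tsum_congr fun n => ?_
  rw [exp_eq_nome_pow, neg_pow_natAbs_sq]
  congr 1
  rcases Int.even_or_odd n with h | h
  · rw [h.neg_one_zpow, (Int.natAbs_even.mpr h).neg_one_pow]
  · rw [h.neg_one_zpow, (Int.natAbs_odd.mpr h).neg_one_pow]

lemma theta3_sq (τ : ℍ) : theta3 τ ^ 2 = discA (nome τ) := by rw [theta3_eq, discA]

lemma theta4_sq (τ : ℍ) : theta4 τ ^ 2 = discB (nome τ) := by rw [theta4_eq, discB]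

lemma t_eq (τ : ℍ) : t τ = discT (nome τ) := by rw [t, theta3_sq, theta4_sq, discT]

lemma t_ne_zero (τ : ℍ) : t τ ≠ 0 := by
  rw [t_eq]; exact discT_ne_zero (norm_nome_coe_lt_one τ)

lemma one_sub_t_sq_ne_zero (τ : ℍ) : 1 - t τ ^ 2 ≠ 0 := by
  rw [t_eq]; exact one_sub_discT_sq_ne_zero (nome_ne_zero _) (norm_nome_coe_lt_one τ)

lemma one_add_t_ne_zero (τ : ℍ) : 1 + t τ ≠ 0 := fun h =>
  one_sub_t_sq_ne_zero τ (by linear_combination (1 - t τ) * h)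

lemma theta3_sq_ne_zero (τ : ℍ) : theta3 τ ^ 2 ≠ 0 := by
  rw [theta3_sq]; exact discA_ne_zero (norm_nome_coe_lt_one τ)

lemma eventually_im_pos {z : ℂ} (hz : 0 < z.im) : ∀ᶠ w in 𝓝 z, 0 < w.im :=
  UpperHalfPlane.isOpen_upperHalfPlaneSet.mem_nhds hz

lemma coe_ofComplex {z : ℂ} (hz : 0 < z.im) : ((UpperHalfPlane.ofComplex z : ℍ) : ℂ) = z := by
  rw [UpperHalfPlane.ofComplex_apply_of_im_pos hz]

/-- The extension of `t` to the complex plane that underlies `lift`. -/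
def tC (z : ℂ) : ℂ := t (UpperHalfPlane.ofComplex z)

lemma tC_coe (τ : ℍ) : tC τ = t τ := by rw [tC, UpperHalfPlane.ofComplex_apply]

lemma analyticAt_nome (z : ℂ) : AnalyticAt ℂ nome z := by
  have : Differentiable ℂ nome := fun w => (hasDerivAt_nome w).differentiableAt
  exact this.analyticAt z

lemma tC_eventuallyEq {z : ℂ} (hz : 0 < z.im) : tC =ᶠ[𝓝 z] fun w => discT (nome w) := by
  filter_upwards [eventually_im_pos hz] with w hw
  rw [tC, t_eq, coe_ofComplex hw]

lemma analyticAt_tC {z : ℂ} (hz : 0 < z.im) : AnalyticAt ℂ tC z :=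
  ((analyticAt_discT (norm_nome_lt_one hz)).comp (analyticAt_nome z)).congr
    (tC_eventuallyEq hz).symm

lemma deriv_tC_ne_zero {z : ℂ} (hz : 0 < z.im) : deriv tC z ≠ 0 := by
  have h := (analyticAt_discT (norm_nome_lt_one hz)).differentiableAt.hasDerivAt.comp z
    (hasDerivAt_nome z)
  rw [(tC_eventuallyEq hz).deriv_eq,
    show (fun w => discT (nome w)) = discT ∘ nome from rfl, h.deriv]
  exact mul_ne_zero (deriv_discT_ne_zero (nome_ne_zero z) (norm_nome_lt_one hz))
    (mul_ne_zero Complex.two_pi_I_ne_zero (nome_ne_zero z))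

lemma continuous_t : Continuous t := by
  rw [continuous_iff_continuousAt]
  intro τ
  have h : ContinuousAt (fun σ : ℍ => tC σ) τ :=
    ContinuousAt.comp (f := fun σ : ℍ => (σ : ℂ)) (analyticAt_tC τ.im_pos).continuousAt
      UpperHalfPlane.continuous_coe.continuousAt
  simpa only [tC_coe] using h

lemma x_eq (τ₁ τ₂ : ℍ) : x τ₁ τ₂ = coordX (t τ₁) (t τ₂) := rfl

lemma y_eq (τ₁ τ₂ : ℍ) : y τ₁ τ₂ = coordY (t τ₁) (t τ₂) := rfl

lemma isGood_t {τ₁ τ₂ : ℍ} (h1 : 1 + t τ₁ * t τ₂ ≠ 0) (h2 : t τ₁ + t τ₂ ≠ 0)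
    (h3 : 1 - t τ₁ * t τ₂ ≠ 0) : IsGood (t τ₁) (t τ₂) :=
  ⟨t_ne_zero _, t_ne_zero _, one_sub_t_sq_ne_zero _, one_sub_t_sq_ne_zero _, h2, h3, h1⟩

lemma coordX_ne_zero {a b : ℂ} (h : IsGood a b) : coordX a b ≠ 0 :=
  div_ne_zero (mul_ne_zero (pow_ne_zero 2 h.add) (pow_ne_zero 2 h.one_sub))
    (pow_ne_zero 4 h.one_add)

lemma coordY_ne_zero {a b : ℂ} (h : IsGood a b) : coordY a b ≠ 0 :=
  div_ne_zero (mul_ne_zero (mul_ne_zero (mul_ne_zero h.left h.right) h.left_sq) h.right_sq)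
    (mul_ne_zero (pow_ne_zero 2 h.add) (pow_ne_zero 2 h.one_sub))

lemma jacobian_eq {τ₁ τ₂ : ℍ} (h : IsGood (t τ₁) (t τ₂)) :
    jacobian x y τ₁ τ₂ = x τ₁ τ₂ * y τ₁ τ₂ * logJacobian (t τ₁) (t τ₂) *
      (deriv tC τ₁ * deriv tC τ₂) := by
  have d1 := (analyticAt_tC τ₁.im_pos).differentiableAt.hasDerivAt
  have d2 := (analyticAt_tC τ₂.im_pos).differentiableAt.hasDerivAt
  have e1 := HasDerivAt.comp (τ₁ : ℂ) (h₂ := fun s => coordX s (t τ₂)) (h := tC)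
    (by rw [tC_coe]; exact hasDerivAt_coordX h) d1
  have e2 := HasDerivAt.comp (τ₁ : ℂ) (h₂ := fun s => coordY s (t τ₂)) (h := tC)
    (by rw [tC_coe]; exact hasDerivAt_coordY h) d1
  have e3 := HasDerivAt.comp (τ₂ : ℂ) (h₂ := fun s => coordX s (t τ₁)) (h := tC)
    (by rw [tC_coe]; exact hasDerivAt_coordX h.symm) d2
  have e4 := HasDerivAt.comp (τ₂ : ℂ) (h₂ := fun s => coordY s (t τ₁)) (h := tC)
    (by rw [tC_coe]; exact hasDerivAt_coordY h.symm) d2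
  have l1 : (fun s => lift x (s, (τ₂ : ℂ))) = (fun s => coordX s (t τ₂)) ∘ tC := by
    funext s
    simp [lift, x_eq, tC]
  have l2 : (fun s => lift y (s, (τ₂ : ℂ))) = (fun s => coordY s (t τ₂)) ∘ tC := by
    funext s
    simp [lift, y_eq, tC]
  have l3 : (fun s => lift x ((τ₁ : ℂ), s)) = (fun s => coordX s (t τ₁)) ∘ tC := by
    funext s
    simp [lift, x_eq, tC, coordX_comm (t τ₁)]
  have l4 : (fun s => lift y ((τ₁ : ℂ), s)) = (fun s => coordY s (t τ₁)) ∘ tC := by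
    funext s
    simp [lift, y_eq, tC, coordY_comm (t τ₁)]
  rw [jacobian, l1, l2, l3, l4, e1.deriv, e2.deriv, e3.deriv, e4.deriv, logJacobian,
    coordX_comm (t τ₂), coordY_comm (t τ₂), x_eq, y_eq]
  ring

lemma logJacobian_ne_zero_iff {a b : ℂ} (h : IsGood a b) :
    logJacobian a b ≠ 0 ↔ criticalPoly a b ≠ 0 := by
  have e := logJacobian_eq h
  have h1 : a * b * (1 - a ^ 2) * (1 - b ^ 2) * (a + b) * (1 - a * b) ≠ 0 :=
    mul_ne_zero (mul_ne_zero (mul_ne_zero (mul_ne_zero (mul_ne_zero h.left h.right) h.left_sq)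
      h.right_sq) h.add) h.one_sub
  have h2 : 2 * (1 + a * b) ≠ 0 := mul_ne_zero two_ne_zero h.one_add
  rw [not_iff_not]
  constructor
  · intro h0
    rw [h0, zero_mul, eq_comm] at e
    exact (mul_eq_zero.mp e).resolve_left h2
  · intro h0
    rw [h0, mul_zero] at e
    exact (mul_eq_zero.mp e).resolve_right h1

/-- On ℍ the conditions t ≠ 0, t² ≠ 1 and t' ≠ 0 are automatic, so the Jacobian vanishes only
through its factor `logJacobian`. -/
lemma mem_regularSet_iff {τ₁ τ₂ : ℍ} :
    (τ₁, τ₂) ∈ regularSet ↔ IsGood (t τ₁) (t τ₂) ∧ criticalPoly (t τ₁) (t τ₂) ≠ 0 := by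
  have key (h : IsGood (t τ₁) (t τ₂)) :
      jacobian x y τ₁ τ₂ ≠ 0 ↔ criticalPoly (t τ₁) (t τ₂) ≠ 0 := by
    rw [jacobian_eq h, ← logJacobian_ne_zero_iff h, mul_ne_zero_iff, mul_ne_zero_iff,
      mul_ne_zero_iff, mul_ne_zero_iff, x_eq, y_eq]
    simp [coordX_ne_zero h, coordY_ne_zero h, deriv_tC_ne_zero τ₁.im_pos,
      deriv_tC_ne_zero τ₂.im_pos]
  constructor
  · rintro ⟨h1, h2, h3, h4⟩
    have h := isGood_t h1 h2 h3
    exact ⟨h, (key h).mp h4⟩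
  · rintro ⟨h, hc⟩
    exact ⟨h.one_add, h.add, h.one_sub, (key h).mpr hc⟩

/-! ### Local inversion of the coordinates -/

/-- The map `(t₁, t₂) ↦ (x, y)`. -/
def coord (s : ℂ × ℂ) : ℂ × ℂ := (coordX s.1 s.2, coordY s.1 s.2)

lemma analyticAt_coord {a b : ℂ} (h : IsGood a b) : AnalyticAt ℂ coord (a, b) := by
  have h1 : AnalyticAt ℂ (fun s : ℂ × ℂ => s.1) (a, b) := analyticAt_fst
  have h2 : AnalyticAt ℂ (fun s : ℂ × ℂ => s.2) (a, b) := analyticAt_snd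
  have hs := ((h1.fun_add h2).fun_pow 2).fun_mul
    ((analyticAt_const (v := (1 : ℂ)).fun_sub (h1.fun_mul h2)).fun_pow 2)
  have hx : AnalyticAt ℂ (fun s : ℂ × ℂ => coordX s.1 s.2) (a, b) :=
    hs.fun_div ((analyticAt_const.fun_add (h1.fun_mul h2)).fun_pow 4) (pow_ne_zero 4 h.one_add)
  have hy : AnalyticAt ℂ (fun s : ℂ × ℂ => coordY s.1 s.2) (a, b) :=
    (((h1.fun_mul h2).fun_mul (analyticAt_const.fun_sub (h1.fun_pow 2))).fun_mul
      (analyticAt_const.fun_sub (h2.fun_pow 2))).fun_div hs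
      (mul_ne_zero (pow_ne_zero 2 h.add) (pow_ne_zero 2 h.one_sub))
  exact hx.prod hy

lemma fderiv_coord_apply {a b : ℂ} (h : IsGood a b) (v : ℂ × ℂ) :
    fderiv ℂ coord (a, b) v =
      (coordX a b * (logDerivX a b * v.1 + logDerivX b a * v.2),
        coordY a b * (logDerivY a b * v.1 + logDerivY b a * v.2)) := by
  have hd := (analyticAt_coord h).differentiableAt.hasFDerivAt
  have e1 : fderiv ℂ coord (a, b) (1, 0) =
      (coordX a b * logDerivX a b, coordY a b * logDerivY a b) := by
    have h1 := HasFDerivAt.comp_hasDerivAt (f := fun s => (s, b)) a hd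
      ((hasDerivAt_id a).prodMk (hasDerivAt_const a b))
    exact h1.unique ((hasDerivAt_coordX h).prodMk (hasDerivAt_coordY h))
  have e2 : fderiv ℂ coord (a, b) (0, 1) =
      (coordX a b * logDerivX b a, coordY a b * logDerivY b a) := by
    have h1 := HasFDerivAt.comp_hasDerivAt (f := fun s => (a, s)) b hd
      ((hasDerivAt_const b a).prodMk (hasDerivAt_id b))
    have h2 := (hasDerivAt_coordX h.symm).prodMk (hasDerivAt_coordY h.symm)
    simp only [fun s => coordX_comm s a, fun s => coordY_comm s a] at h2
    exact h1.unique h2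
  have e : v = v.1 • ((1 : ℂ), (0 : ℂ)) + v.2 • ((0 : ℂ), (1 : ℂ)) := by ext <;> simp
  rw [e, map_add, map_smul, map_smul, e1, e2]
  ext <;> simp <;> ring

lemma injective_fderiv_coord {a b : ℂ} (h : IsGood a b) (hc : criticalPoly a b ≠ 0) :
    Function.Injective (fderiv ℂ coord (a, b)) := by
  rw [injective_iff_map_eq_zero]
  intro v hv
  rw [fderiv_coord_apply h, Prod.mk_eq_zero, mul_eq_zero, mul_eq_zero] at hv
  have h1 := hv.1.resolve_left (coordX_ne_zero h)
  have h2 := hv.2.resolve_left (coordY_ne_zero h)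
  have hJ := (logJacobian_ne_zero_iff h).mpr hc
  rw [logJacobian] at hJ
  ext
  · refine (mul_eq_zero.mp ?_).resolve_left hJ
    linear_combination logDerivY b a * h1 - logDerivX b a * h2
  · refine (mul_eq_zero.mp ?_).resolve_left hJ
    linear_combination logDerivX a b * h2 - logDerivY a b * h1

/-- Near a noncritical point the map `coord` has an analytic inverse. -/
lemma exists_analytic_inverse {a b : ℂ} (h : IsGood a b) (hc : criticalPoly a b ≠ 0) :
    ∃ ψ : ℂ × ℂ → ℂ × ℂ, ψ (coord (a, b)) = (a, b) ∧ AnalyticAt ℂ ψ (coord (a, b)) ∧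
      (∀ᶠ s in 𝓝 (a, b), ψ (coord s) = s) ∧ ∀ᶠ p in 𝓝 (coord (a, b)), coord (ψ p) = p := by
  have hA := analyticAt_coord h
  let i : (ℂ × ℂ) ≃L[ℂ] (ℂ × ℂ) := (LinearEquiv.ofInjectiveEndo
    (fderiv ℂ coord (a, b) : ℂ × ℂ →ₗ[ℂ] ℂ × ℂ) (injective_fderiv_coord h hc)).toContinuousLinearEquiv
  have hi : (i : ℂ × ℂ →L[ℂ] ℂ × ℂ) = fderiv ℂ coord (a, b) := by
    ext <;> rfl
  have hs : HasStrictFDerivAt coord (i : ℂ × ℂ →L[ℂ] ℂ × ℂ) (a, b) := by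
    rw [hi]; exact hA.hasStrictFDerivAt
  let R := hs.toOpenPartialHomeomorph coord
  have hR : (a, b) ∈ R.source := hs.mem_toOpenPartialHomeomorph_source
  refine ⟨R.symm, R.left_inv hR, R.analyticAt_symm' hR hA hi.symm, ?_, ?_⟩
  · filter_upwards [R.open_source.mem_nhds hR] with s hs using R.left_inv hs
  · filter_upwards [R.open_target.mem_nhds (R.map_source hR)] with p hp using R.right_inv hp

lemma F_eq (τ₁ τ₂ : ℍ) :
    F τ₁ τ₂ = (1 + t τ₁ * t τ₂) / 2 * discA (nome τ₁) * discA (nome τ₂) := by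
  rw [F, theta3_sq, theta3_sq]

lemma IsGood.eventually_prod {a b : ℂ} (h : IsGood a b) :
    ∀ᶠ s : ℂ × ℂ in 𝓝 (a, b), IsGood s.1 s.2 := by
  have c1 : ContinuousAt (fun s : ℂ × ℂ => s.1) (a, b) := by fun_prop
  have c2 : ContinuousAt (fun s : ℂ × ℂ => s.2) (a, b) := by fun_prop
  have c3 : ContinuousAt (fun s : ℂ × ℂ => 1 - s.1 ^ 2) (a, b) := by fun_prop
  have c4 : ContinuousAt (fun s : ℂ × ℂ => 1 - s.2 ^ 2) (a, b) := by fun_prop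
  have c5 : ContinuousAt (fun s : ℂ × ℂ => s.1 + s.2) (a, b) := by fun_prop
  have c6 : ContinuousAt (fun s : ℂ × ℂ => 1 - s.1 * s.2) (a, b) := by fun_prop
  have c7 : ContinuousAt (fun s : ℂ × ℂ => 1 + s.1 * s.2) (a, b) := by fun_prop
  filter_upwards [c1.eventually_ne h.left, c2.eventually_ne h.right, c3.eventually_ne h.left_sq,
    c4.eventually_ne h.right_sq, c5.eventually_ne h.add, c6.eventually_ne h.one_sub,
    c7.eventually_ne h.one_add] with s h1 h2 h3 h4 h5 h6 h7
  exact ⟨h1, h2, h3, h4, h5, h6, h7⟩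

lemma eventually_theta_eq {f : ℂ → ℂ} (τ : ℍ)
    (hf : ∀ᶠ z in 𝓝 (nome τ), f (discT z) = discA z) :
    ∀ᶠ σ : ℍ in 𝓝 τ, f (t σ) = discA (nome σ) := by
  have hc : ContinuousAt (fun σ : ℍ => nome σ) τ :=
    ContinuousAt.comp (f := fun σ : ℍ => (σ : ℂ)) (analyticAt_nome τ).continuousAt
      UpperHalfPlane.continuous_coe.continuousAt
  filter_upwards [hc.eventually hf] with σ hσ
  rw [t_eq, hσ]

theorem satisfiesSystemNear_of_mem {τ₁ τ₂ : ℍ} (hmem : (τ₁, τ₂) ∈ regularSet) :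
    SatisfiesSystemNear τ₁ τ₂ := by
  obtain ⟨h, hc⟩ := mem_regularSet_iff.mp hmem
  obtain ⟨f, hf, hfA, hfL⟩ := exists_local_solution (nome_ne_zero τ₁) (norm_nome_coe_lt_one τ₁)
  obtain ⟨g, hg, hgA, hgL⟩ := exists_local_solution (nome_ne_zero τ₂) (norm_nome_coe_lt_one τ₂)
  rw [← t_eq] at hf hfL hg hgL
  obtain ⟨ψ, hψ0, hψ, hleft, hright⟩ := exists_analytic_inverse h hc
  set a := t τ₁ with ha
  set b := t τ₂ with hb
  -- F as a function of (t₁, t₂); the required Φ is its composite with the local inverse of `coord`.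
  let G : ℂ × ℂ → ℂ := fun s => (1 + s.1 * s.2) / 2 * f s.1 * g s.2
  have hG : AnalyticAt ℂ G (a, b) := by
    have h1 : AnalyticAt ℂ (fun s : ℂ × ℂ => f s.1) (a, b) :=
      AnalyticAt.fun_comp (g := f) hf analyticAt_fst
    have h2 : AnalyticAt ℂ (fun s : ℂ × ℂ => g s.2) (a, b) :=
      AnalyticAt.fun_comp (g := g) hg analyticAt_snd
    exact (AnalyticAt.mul (by fun_prop) h1).mul h2
  have hΦ : AnalyticAt ℂ (G ∘ ψ) (coord (a, b)) :=
    AnalyticAt.comp (by rw [hψ0]; exact hG) hψ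
  have hψc : Filter.Tendsto ψ (𝓝 (coord (a, b))) (𝓝 (a, b)) := by
    have := hψ.continuousAt.tendsto
    rwa [hψ0] at this
  have hcrit : ∀ᶠ s : ℂ × ℂ in 𝓝 (a, b), criticalPoly s.1 s.2 ≠ 0 := by
    have : ContinuousAt (fun s : ℂ × ℂ => criticalPoly s.1 s.2) (a, b) := by
      simp only [criticalPoly]
      fun_prop
    exact this.eventually_ne hc
  have c1 : Filter.Tendsto (fun s : ℂ × ℂ => s.1) (𝓝 (a, b)) (𝓝 a) := continuousAt_fst
  have c2 : Filter.Tendsto (fun s : ℂ × ℂ => s.2) (𝓝 (a, b)) (𝓝 b) := continuousAt_snd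
  have hev : ∀ᶠ p in 𝓝 (coord (a, b)),
      AnalyticAt ℂ (G ∘ ψ) p ∧ SatisfiesSystemAt (G ∘ ψ) p := by
    filter_upwards [hright, hΦ.eventually_analyticAt, hψc.eventually h.eventually_prod,
      hψc.eventually hcrit, hψc.eventually (c1.eventually hf.eventually_analyticAt),
      hψc.eventually (c2.eventually hg.eventually_analyticAt), hψc.eventually (c1.eventually hfL),
      hψc.eventually (c2.eventually hgL), hψc.eventually hleft.eventually_nhds]
      with p h1 h2 h3 h4 h5 h6 h7 h8 h9
    refine ⟨h2, ?_⟩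
    -- Writing p as `coord (ψ p)` moves the claim to the point `ψ p` of the t-plane, near which `G ∘
    -- ψ ∘ coord` still equals `G`.
    rw [← h1] at h2 ⊢
    refine satisfiesSystemAt_of_eventually h3 h4 h2 h5 h6 h7 h8 ?_
    filter_upwards [h9] with s hs
    have : (G ∘ ψ) (coord s) = G s := by rw [Function.comp_apply, hs]
    exact this.symm
  obtain ⟨V, hV, hVo, hVm⟩ := eventually_nhds_iff.mp hev
  refine ⟨V, G ∘ ψ, hVo, hVm, fun p hp => (hV p hp).1, ?_, fun p hp => (hV p hp).2⟩
  have ct : Filter.Tendsto (fun p : ℍ × ℍ => (t p.1, t p.2)) (𝓝 (τ₁, τ₂)) (𝓝 (a, b)) :=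
    ((continuous_t.comp continuous_fst).prodMk (continuous_t.comp continuous_snd)).tendsto (τ₁, τ₂)
  have cf : Filter.Tendsto (fun p : ℍ × ℍ => p.1) (𝓝 (τ₁, τ₂)) (𝓝 τ₁) := continuousAt_fst
  have cs : Filter.Tendsto (fun p : ℍ × ℍ => p.2) (𝓝 (τ₁, τ₂)) (𝓝 τ₂) := continuousAt_snd
  filter_upwards [ct.eventually hleft, cf.eventually (eventually_theta_eq τ₁ hfA),
    cs.eventually (eventually_theta_eq τ₂ hgA)] with p h1 h2 h3
  have : (G ∘ ψ) (coord (t p.1, t p.2)) = G (t p.1, t p.2) := by rw [Function.comp_apply, h1]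
  rw [F_eq, ← h2, ← h3]
  exact this.symm

/-! ### Density of the regular set -/

lemma nhds_t (τ : ℍ) : Filter.map t (𝓝 τ) = 𝓝 (t τ) := by
  have h := (analyticAt_tC τ.im_pos).hasStrictDerivAt.map_nhds_eq (deriv_tC_ne_zero τ.im_pos)
  rw [tC_coe] at h
  rw [← h, ← UpperHalfPlane.isOpenEmbedding_coe.map_nhds_eq, Filter.map_map]
  congr 1
  funext σ
  exact (tC_coe σ).symm

/-- Since t is open, it takes infinitely many values on a neighbourhood, while P has finitely many
roots. -/
lemma exists_t_eval_ne_zero {U : Set ℍ} {τ : ℍ} (hU : U ∈ 𝓝 τ) {P : Polynomial ℂ} (hP : P ≠ 0) :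
    ∃ σ ∈ U, P.eval (t σ) ≠ 0 := by
  by_contra! hcon
  have h1 : t '' U ∈ 𝓝 (t τ) := by
    rw [← nhds_t]
    exact Filter.image_mem_map hU
  have h2 : (t '' U).Infinite := infinite_of_mem_nhds _ h1
  refine h2 ((P.roots.toFinset.finite_toSet).subset ?_)
  rintro _ ⟨σ, hσ, rfl⟩
  simp [hP, hcon σ hσ]

open Polynomial in
theorem dense_regularSet : Dense regularSet := by
  rw [dense_iff_inter_open]
  rintro U hU ⟨⟨τ₁, τ₂⟩, hτ⟩
  obtain ⟨V, W, hV, hW, h1, h2, hVW⟩ := isOpen_prod_iff.mp hU τ₁ τ₂ hτ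
  obtain ⟨σ₁, hσ₁, he₁⟩ := exists_t_eval_ne_zero (hV.mem_nhds h1)
    (P := X ^ 2 + 1) (Polynomial.Monic.ne_zero (by monicity!))
  set a := t σ₁ with ha
  have ha0 : a ≠ 0 := t_ne_zero σ₁
  have ha1 : 1 - a ^ 2 ≠ 0 := one_sub_t_sq_ne_zero σ₁
  have hlin : ∀ c d : ℂ, c ≠ 0 → (C c * X + C d : ℂ[X]) ≠ 0 := fun c d hc h0 => by
    have := congrArg (fun P => P.coeff 1) h0
    simp [hc] at this
  have hm : a - 1 ≠ 0 := fun h0 => ha1 (by linear_combination (-(a + 1)) * h0)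
  have hp : a + 1 ≠ 0 := fun h0 => ha1 (by linear_combination (1 - a) * h0)
  -- For fixed t₁ = a, the six linear polynomials in t₂ are 1 + t₁t₂, t₁ + t₂, 1 - t₁t₂ and the
  -- three factors of `criticalPoly`.
  obtain ⟨σ₂, hσ₂, he₂⟩ := exists_t_eval_ne_zero (hW.mem_nhds h2)
    (mul_ne_zero (mul_ne_zero (mul_ne_zero (hlin a 1 ha0) (hlin 1 a one_ne_zero))
      (mul_ne_zero (hlin (-a) 1 (neg_ne_zero.mpr ha0)) (hlin (-1) a (neg_ne_zero.mpr one_ne_zero))))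
      (mul_ne_zero (hlin (a - 1) (-(a + 1)) hm) (hlin (a + 1) (a - 1) hp)))
  refine ⟨(σ₁, σ₂), hVW ⟨hσ₁, hσ₂⟩, mem_regularSet_iff.mpr ?_⟩
  simp only [eval_mul, eval_add, eval_C, eval_X, mul_ne_zero_iff] at he₂
  obtain ⟨⟨⟨k1, k2⟩, k3, k4⟩, k5, k6⟩ := he₂
  refine ⟨isGood_t ?_ ?_ ?_, ?_⟩
  · convert k1 using 1; ring
  · convert k2 using 1; ring
  · convert k3 using 1; ring
  · rw [criticalPoly]
    refine mul_ne_zero (mul_ne_zero ?_ ?_) ?_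
    · convert k4 using 1; ring
    · convert k5 using 1; ring
    · convert k6 using 1; ring

end Bimodular
end

noncomputable section
namespace Bimodular

/-! ### Transformation laws of the theta squares -/

lemma discTheta_nome {z : ℂ} : discTheta (nome z) = jacobiTheta (2 * z) := by
  refine tsum_congr fun n => ?_
  rw [← exp_eq_nome_pow]
  congr 1
  ring

lemma nome_add_intCast (z : ℂ) (n : ℤ) : nome (z + n) = nome z := by
  have h := Complex.exp_int_mul_two_pi_mul_I n
  rw [nome, nome, mul_add, Complex.exp_add, mul_comm _ (n : ℂ), h, mul_one]

lemma nome_add_half (z : ℂ) : nome (z + 1 / 2) = -nome z := by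
  rw [nome, nome, mul_add, Complex.exp_add,
    show (2 * Real.pi * Complex.I * (1 / 2) : ℂ) = Real.pi * Complex.I by ring,
    Complex.exp_pi_mul_I, mul_neg_one]

lemma nome_two_mul (z : ℂ) : nome (2 * z) = nome z ^ 2 := by
  rw [nome, nome, ← Complex.exp_nat_mul]
  congr 1
  push_cast
  ring

lemma discB_nome (z : ℂ) : discB (nome z) = discA (nome (z + 1 / 2)) := by
  rw [discB, discA, nome_add_half]

/-- Squaring removes the branch of the square root from Jacobi's inversion formula. -/
lemma jacobiTheta_sq_neg_inv {z : ℂ} (hz : 0 < z.im) :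
    jacobiTheta (-1 / z) ^ 2 = -Complex.I * z * jacobiTheta z ^ 2 := by
  have h := jacobiTheta_S_smul ⟨z, hz⟩
  have e : ((ModularGroup.S • (⟨z, hz⟩ : ℍ) : ℍ) : ℂ) = -1 / z := by
    rw [UpperHalfPlane.modular_S_smul]
    simp [neg_div, inv_neg]
  rw [e] at h
  rw [h, mul_pow, ← Complex.cpow_nat_mul]
  norm_num

lemma discA_nome_fricke {z : ℂ} (hz : 0 < z.im) :
    discA (nome (-1 / (4 * z))) = -2 * Complex.I * z * discA (nome z) := by
  have h2 : 0 < (2 * z).im := by simpa using hz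
  have e : 2 * (-1 / (4 * z)) = -1 / (2 * z) := by
    have : z ≠ 0 := fun h => by simp [h] at hz
    field_simp
    norm_num
  rw [discA, discA, discTheta_nome, discTheta_nome, e, jacobiTheta_sq_neg_inv h2]
  ring

lemma moebius_im_pos {a b c d : ℝ} (h : a * d - b * c = 1) {z : ℂ} (hz : 0 < z.im) :
    (c * z + d : ℂ) ≠ 0 ∧ 0 < ((a * z + b) / (c * z + d)).im := by
  have h0 : (c * z + d : ℂ) ≠ 0 := by
    intro h0
    have him := congrArg Complex.im h0
    have hre := congrArg Complex.re h0
    simp at him hre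
    rcases him with hc | hz'
    · rw [hc, zero_mul, zero_add] at hre
      rw [hc, hre] at h
      norm_num at h
    · exact hz.ne' hz'
  refine ⟨h0, ?_⟩
  have hn : 0 < Complex.normSq (c * z + d) := Complex.normSq_pos.mpr h0
  rw [Complex.div_im, ← sub_div]
  refine div_pos ?_ hn
  have : ((a * z + b : ℂ)).im * ((c * z + d : ℂ)).re - ((a * z + b : ℂ)).re * ((c * z + d : ℂ)).im =
      (a * d - b * c) * z.im := by
    simp
    ring
  rw [this, h, one_mul]
  exact hz

/-- The transformation law of `θ₃ ^ 2` under the matrix `(a, b; c, d)`. -/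
def ThetaLaw (a b c d : ℤ) : Prop :=
  ∀ z : ℂ, 0 < z.im → discA (nome ((a * z + b) / (c * z + d))) =
    ((ZMod.χ₄ (d : ZMod 4) : ℤ) : ℂ) * (c * z + d) * discA (nome z)

lemma ThetaLaw.mul_translation {a b c d : ℤ} (hc : 4 ∣ c) (h : ThetaLaw a b c d) (n : ℤ) :
    ThetaLaw a (b + a * n) c (d + c * n) := by
  intro z hz
  have h1 := h (z + n) (by simpa using hz)
  have h2 : ((d + c * n : ℤ) : ZMod 4) = (d : ZMod 4) := by
    have : ((c : ℤ) : ZMod 4) = 0 := (ZMod.intCast_zmod_eq_zero_iff_dvd c 4).mpr (by exact_mod_cast hc)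
    push_cast
    rw [this, zero_mul, add_zero]
  rw [nome_add_intCast] at h1
  rw [h2]
  push_cast
  rw [show (a * z + (b + a * n) : ℂ) = a * (z + n) + b by ring,
    show (c * z + (d + c * n) : ℂ) = c * (z + n) + d by ring]
  exact h1

/-- The map z ↦ z/(4mz + 1) is the translation by -m conjugated by z ↦ -1/(4z), so periodicity and
the Fricke law give its factor. -/
lemma discA_nome_lower {z : ℂ} (hz : 0 < z.im) (m : ℤ) :
    discA (nome (z / (4 * m * z + 1))) = (4 * m * z + 1) * discA (nome z) := by
  obtain ⟨h0, him⟩ := moebius_im_pos (a := 1) (b := 0) (c := 4 * m) (d := 1) (by norm_num) hz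
  push_cast at h0 him
  rw [one_mul, add_zero] at him
  have hz0 : z ≠ 0 := fun h => by simp [h] at hz
  have h1 := discA_nome_fricke him
  have h2 := discA_nome_fricke hz
  have e : -1 / (4 * (z / (4 * m * z + 1))) = -1 / (4 * z) + ((-m : ℤ) : ℂ) := by
    push_cast
    field_simp
    ring
  rw [e, nome_add_intCast, h2] at h1
  have h3 : -2 * Complex.I * (z / (4 * m * z + 1)) ≠ 0 :=
    mul_ne_zero (by simp) (div_ne_zero hz0 h0)
  refine mul_left_cancel₀ h3 ?_
  rw [← h1]
  generalize 4 * (m : ℂ) * z + 1 = w at h0 ⊢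
  field_simp

lemma ThetaLaw.mul_lower {a b c d : ℤ} (hdet : a * d - b * c = 1) (h : ThetaLaw a b c d) (m : ℤ) :
    ThetaLaw (a + 4 * b * m) b (c + 4 * d * m) d := by
  intro z hz
  obtain ⟨h0, him⟩ := moebius_im_pos (a := 1) (b := 0) (c := 4 * m) (d := 1) (by norm_num) hz
  push_cast at h0 him
  rw [one_mul, add_zero] at him
  have h1 := h _ him
  rw [discA_nome_lower hz] at h1
  obtain ⟨h2, -⟩ := moebius_im_pos (a := a) (b := b) (c := c) (d := d) (by exact_mod_cast hdet) him
  push_cast at h2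
  have e1 : (c * (z / (4 * m * z + 1)) + d : ℂ) = ((c + 4 * d * m) * z + d) / (4 * m * z + 1) := by
    generalize hw : 4 * (m : ℂ) * z + 1 = w at h0 ⊢
    field_simp
    rw [← hw]
    ring
  have e2 : (a * (z / (4 * m * z + 1)) + b : ℂ) = ((a + 4 * b * m) * z + b) / (4 * m * z + 1) := by
    generalize hw : 4 * (m : ℂ) * z + 1 = w at h0 ⊢
    field_simp
    rw [← hw]
    ring
  rw [e1, e2, div_div_div_cancel_right₀ h0] at h1
  push_cast
  rw [h1]
  generalize 4 * (m : ℂ) * z + 1 = w at h0 ⊢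
  field_simp

lemma exists_two_mul_abs_add_le (d : ℤ) {c : ℤ} (hc : c ≠ 0) : ∃ n : ℤ, 2 * |d + c * n| ≤ |c| := by
  have h1 := Int.emod_add_mul_ediv d c
  have h2 := Int.emod_nonneg d hc
  have h3 := Int.emod_lt_abs d hc
  by_cases h : 2 * (d % c) ≤ |c|
  · refine ⟨-(d / c), ?_⟩
    have : d + c * -(d / c) = d % c := by linarith
    rwa [this, abs_of_nonneg h2]
  · refine ⟨-(d / c) - SignType.sign c, ?_⟩
    have : d + c * (-(d / c) - SignType.sign c) = d % c - |c| := by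
      have := self_mul_sign c
      linear_combination -h1 - this
    rw [this, abs_of_neg (by linarith)]
    linarith

/-- Euclid's algorithm on the lower row: translations change d modulo c, the lower matrices change c
modulo 4d, and |c| decreases until c = 0, where only ± translations remain. -/
theorem thetaLaw_of_dvd : ∀ (N : ℕ) {a b c d : ℤ}, c.natAbs ≤ N → a * d - b * c = 1 → 4 ∣ c →
    ThetaLaw a b c d := by
  intro N
  induction N using Nat.strong_induction_on with
  | _ N ih =>
    intro a b c d hN hdet h4
    by_cases hc : c = 0
    · subst hc
      intro z hz
      have had : a * d = 1 := by linarith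
      rcases Int.mul_eq_one_iff_eq_one_or_neg_one.mp had with ⟨rfl, rfl⟩ | ⟨rfl, rfl⟩
      · simp [nome_add_intCast]
      · have e : (((-1 : ℤ) : ℂ) * z + b) / (((0 : ℤ) : ℂ) * z + ((-1 : ℤ) : ℂ)) = z + (-b : ℤ) := by
          push_cast; ring
        rw [e, nome_add_intCast]
        have : ZMod.χ₄ ((-1 : ℤ) : ZMod 4) = -1 := by decide
        rw [this]
        push_cast
        ring
    · obtain ⟨n, hn⟩ := exists_two_mul_abs_add_le d hc
      set d' := d + c * n with hd'
      set b' := b + a * n with hb'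
      have hdet' : a * d' - b' * c = 1 := by rw [hd', hb']; linear_combination hdet
      have hodd : ¬ 2 ∣ d' := by
        rintro ⟨k, hk⟩
        obtain ⟨l, hl⟩ := h4
        rw [hk, hl] at hdet'
        have : 2 * (a * k - 2 * (b' * l)) = 1 := by linear_combination hdet'
        omega
      have hd0 : 4 * d' ≠ 0 := by omega
      obtain ⟨m, hm⟩ := exists_two_mul_abs_add_le c hd0
      set c' := c + 4 * d' * m with hc'
      set a' := a + 4 * b' * m with ha'
      -- Equality is impossible, as 4 ∣ c would make d' even. Strictness is what makes the next
      -- reduction decrease |c|: 2|c'| ≤ 4|d'| < 2|c|.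
      have hlt : 2 * |d'| < |c| := by
        refine lt_of_le_of_ne hn fun h => hodd ?_
        obtain ⟨l, hl⟩ := h4
        rcases abs_choice d' with h1 | h1 <;> rcases abs_choice c with h2 | h2 <;>
          rw [h1, h2, hl] at h
        · exact ⟨l, by linarith⟩
        · exact ⟨-l, by linarith⟩
        · exact ⟨-l, by linarith⟩
        · exact ⟨l, by linarith⟩
      have hlt' : c'.natAbs < c.natAbs := by
        rw [abs_mul, show |(4 : ℤ)| = 4 from rfl] at hm
        zify
        linarith
      have hdet'' : a' * d' - b' * c' = 1 := by rw [ha', hc']; linear_combination hdet'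
      have h4' : 4 ∣ c' := by
        rw [hc', mul_assoc]
        exact h4.add (dvd_mul_right 4 _)
      have h1 := (ih c'.natAbs (by omega) le_rfl hdet'' h4').mul_lower hdet'' (-m)
      rw [show a' + 4 * b' * -m = a by rw [ha']; ring,
        show c' + 4 * d' * -m = c by rw [hc']; ring] at h1
      have h2 := h1.mul_translation h4 (-n)
      rwa [show b' + a * -n = b by rw [hb']; ring,
        show d' + c * -n = d by rw [hd']; ring] at h2

lemma thetaLaw {a b c d : ℤ} (hdet : a * d - b * c = 1) (h4 : 4 ∣ c) : ThetaLaw a b c d :=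
  thetaLaw_of_dvd _ le_rfl hdet h4

/-- The transformation law of `θ₄ ^ 2` under `Γ₀(8)`. -/
lemma discB_nome_moebius {a b c d : ℤ} (hdet : a * d - b * c = 1) (h8 : 8 ∣ c) {z : ℂ}
    (hz : 0 < z.im) : discB (nome ((a * z + b) / (c * z + d))) =
      ((ZMod.χ₄ (d : ZMod 4) : ℤ) : ℂ) * (c * z + d) * discB (nome z) := by
  obtain ⟨k, rfl⟩ := h8
  have had : 2 ∣ d - a := by
    have h1 : ¬ 2 ∣ a := by rintro ⟨l, rfl⟩; ring_nf at hdet; omega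
    have h2 : ¬ 2 ∣ d := by rintro ⟨l, rfl⟩; ring_nf at hdet; omega
    omega
  obtain ⟨l, hl⟩ := had
  have hd : d = a + 2 * l := by linarith
  obtain ⟨h0, -⟩ := moebius_im_pos (a := a) (b := b) (c := (8 * k : ℤ)) (d := d)
    (by exact_mod_cast hdet) hz
  -- This is the matrix conjugated by the half translation. It is integral because d - a = 2l is
  -- even, and d - 4k ≡ d modulo 4 keeps the character.
  have h := thetaLaw (a := a + 4 * k) (b := b + l - 2 * k) (c := 8 * k) (d := d - 4 * k)
    (by rw [hd] at hdet ⊢; linear_combination hdet) (by omega) (z + 1 / 2) (by simpa using hz)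
  have e2 : ((d - 4 * k : ℤ) : ZMod 4) = (d : ZMod 4) := by
    have : (4 : ZMod 4) = 0 := by decide
    push_cast
    rw [this, zero_mul, sub_zero]
  have e3 : (((8 * k : ℤ) : ℂ) * (z + 1 / 2) + ((d - 4 * k : ℤ) : ℂ)) =
      ((8 * k : ℤ) : ℂ) * z + d := by
    push_cast; ring
  have e1 : (((a + 4 * k : ℤ) : ℂ) * (z + 1 / 2) + ((b + l - 2 * k : ℤ) : ℂ)) /
      (((8 * k : ℤ) : ℂ) * z + d) = (a * z + b) / (((8 * k : ℤ) : ℂ) * z + d) + 1 / 2 := by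
    rw [eq_comm, div_add_div _ _ (by exact_mod_cast h0) two_ne_zero,
      div_eq_div_iff (mul_ne_zero (by exact_mod_cast h0) two_ne_zero) (by exact_mod_cast h0), hd]
    push_cast
    ring
  rw [e2, e3, e1] at h
  rw [discB_nome, discB_nome, h]

/-- The values of `θ₃ ^ 2` at `-1 / (8 z)`. -/
lemma discA_nome_fricke_eight {z : ℂ} (hz : 0 < z.im) :
    discA (nome (-1 / (8 * z))) = -2 * Complex.I * z * (discA (nome z) + discB (nome z)) := by
  have h := discA_nome_fricke (z := 2 * z) (by simpa using hz)
  rw [← discA_sq (norm_nome_lt_one hz), ← nome_two_mul,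
    show (8 * z : ℂ) = 4 * (2 * z) by ring, h]
  ring

/-- The values of `θ₄ ^ 2` at `-1 / (8 z)`. -/
lemma discB_nome_fricke_eight {z : ℂ} (hz : 0 < z.im) :
    discB (nome (-1 / (8 * z))) = -2 * Complex.I * z * (discA (nome z) - discB (nome z)) := by
  have hz0 : z ≠ 0 := fun h => by simp [h] at hz
  have hw : 0 < (-1 / (8 * z)).im := by
    have := (moebius_im_pos (a := 0) (b := -1 / √8) (c := √8) (d := 0) (by
      field_simp; norm_num) hz).2
    have h8 : ((√8 : ℝ) : ℂ) * (√8 : ℝ) = 8 := by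
      rw [← Complex.ofReal_mul, Real.mul_self_sqrt (by norm_num)]; norm_num
    have h80 : ((√8 : ℝ) : ℂ) ≠ 0 := by simp
    convert this using 2
    push_cast
    rw [← h8]
    field_simp
    ring
  -- Since z ↦ -1/(8z) is an involution, the law of A at the image point expresses A(z) through A
  -- and B there, and B can be solved for.
  have h1 := discA_nome_fricke_eight hw
  have h2 := discA_nome_fricke_eight hz
  rw [show -1 / (8 * (-1 / (8 * z))) = z by field_simp] at h1
  have h3 : 4 * z * discA (nome z) =
      Complex.I * (discA (nome (-1 / (8 * z))) + discB (nome (-1 / (8 * z)))) := by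
    rw [h1]
    field_simp
    ring
  linear_combination Complex.I * h3 - h2 +
    (discA (nome (-1 / (8 * z))) + discB (nome (-1 / (8 * z)))) * Complex.I_sq

end Bimodular
end

noncomputable section
namespace Bimodular

/-! ### The normalizer of `Γ₀(8)` -/

section Entries

variable (g h : SL(2, ℝ))

lemma mul_zero_zero : (g * h) 0 0 = g 0 0 * h 0 0 + g 0 1 * h 1 0 := by
  simp [Matrix.mul_apply, Fin.sum_univ_two]

lemma mul_zero_one : (g * h) 0 1 = g 0 0 * h 0 1 + g 0 1 * h 1 1 := by
  simp [Matrix.mul_apply, Fin.sum_univ_two]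

lemma mul_one_zero : (g * h) 1 0 = g 1 0 * h 0 0 + g 1 1 * h 1 0 := by
  simp [Matrix.mul_apply, Fin.sum_univ_two]

lemma mul_one_one : (g * h) 1 1 = g 1 0 * h 0 1 + g 1 1 * h 1 1 := by
  simp [Matrix.mul_apply, Fin.sum_univ_two]

lemma inv_zero_zero : g⁻¹ 0 0 = g 1 1 := by
  simp [Matrix.SpecialLinearGroup.coe_inv, Matrix.adjugate_fin_two]

lemma inv_zero_one : g⁻¹ 0 1 = -g 0 1 := by
  simp [Matrix.SpecialLinearGroup.coe_inv, Matrix.adjugate_fin_two]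

lemma inv_one_zero : g⁻¹ 1 0 = -g 1 0 := by
  simp [Matrix.SpecialLinearGroup.coe_inv, Matrix.adjugate_fin_two]

lemma inv_one_one : g⁻¹ 1 1 = g 0 0 := by
  simp [Matrix.SpecialLinearGroup.coe_inv, Matrix.adjugate_fin_two]

lemma det_entries : g 0 0 * g 1 1 - g 0 1 * g 1 0 = 1 := by
  have := g.det_coe
  rwa [Matrix.det_fin_two] at this

end Entries

/-- The image of `Γ₀(8)` in `SL(2, ℝ)`. -/
def ΓR : Subgroup SL(2, ℝ) := Γ.map toReal

lemma toReal_apply (γ : SL(2, ℤ)) (i j : Fin 2) : toReal γ i j = (γ i j : ℝ) := rfl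

lemma mem_Γ_iff {γ : SL(2, ℤ)} : γ ∈ Γ ↔ (8 : ℤ) ∣ γ 1 0 := by
  rw [Γ, CongruenceSubgroup.Gamma0_mem]
  exact_mod_cast ZMod.intCast_zmod_eq_zero_iff_dvd (γ 1 0) 8

lemma mem_ΓR_iff {g : SL(2, ℝ)} :
    g ∈ ΓR ↔ ∃ a b c d : ℤ, g 0 0 = a ∧ g 0 1 = b ∧ g 1 0 = 8 * c ∧ g 1 1 = d := by
  constructor
  · rintro ⟨γ, hγ, rfl⟩
    obtain ⟨c, hc⟩ := mem_Γ_iff.mp hγ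
    refine ⟨γ 0 0, γ 0 1, c, γ 1 1, rfl, rfl, ?_, rfl⟩
    rw [toReal_apply, hc]
    push_cast
    rfl
  · rintro ⟨a, b, c, d, h1, h2, h3, h4⟩
    have hdet := det_entries g
    rw [h1, h2, h3, h4] at hdet
    have hdet' : a * d - b * (8 * c) = 1 := by exact_mod_cast hdet
    refine ⟨⟨!![a, b; 8 * c, d], by rw [Matrix.det_fin_two_of]; exact hdet'⟩, ?_, ?_⟩
    · exact mem_Γ_iff.mpr ⟨c, rfl⟩
    · ext i j
      fin_cases i <;> fin_cases j
      · exact h1.symm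
      · exact h2.symm
      · refine Eq.trans ?_ h3.symm
        exact (by push_cast; rfl : (((8 * c : ℤ)) : ℝ) = 8 * c)
      · exact h4.symm

lemma mem_N_iff {g : SL(2, ℝ)} : g ∈ N ↔ ∀ h, h ∈ ΓR ↔ g * h * g⁻¹ ∈ ΓR :=
  Subgroup.mem_normalizer_iff

lemma ΓR_le_N : ΓR ≤ N := Subgroup.le_normalizer

lemma σ₁_zero_zero : σ₁ 0 0 = 0 := rfl
lemma σ₁_zero_one : σ₁ 0 1 = -1 / √8 := rfl
lemma σ₁_one_zero : σ₁ 1 0 = 8 / √8 := rfl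
lemma σ₁_one_one : σ₁ 1 1 = -4 / √8 := rfl
lemma σ₂_zero_zero : σ₂ 0 0 = 0 := rfl
lemma σ₂_zero_one : σ₂ 0 1 = -1 / √8 := rfl
lemma σ₂_one_zero : σ₂ 1 0 = 8 / √8 := rfl
lemma σ₂_one_one : σ₂ 1 1 = 0 := rfl

lemma sqrt_eight_mul_self : √8 * √8 = 8 := Real.mul_self_sqrt (by norm_num)

/-- The translation by `1 / 2`. -/
def halfTranslation : SL(2, ℝ) := ⟨!![1, 1 / 2; 0, 1], by simp⟩

lemma halfTranslation_zero_zero : halfTranslation 0 0 = 1 := rfl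
lemma halfTranslation_zero_one : halfTranslation 0 1 = 1 / 2 := rfl
lemma halfTranslation_one_zero : halfTranslation 1 0 = 0 := rfl
lemma halfTranslation_one_one : halfTranslation 1 1 = 1 := rfl

lemma SL_ext {g h : SL(2, ℝ)} (h1 : g 0 0 = h 0 0) (h2 : g 0 1 = h 0 1) (h3 : g 1 0 = h 1 0)
    (h4 : g 1 1 = h 1 1) : g = h := by
  ext i j
  fin_cases i <;> fin_cases j
  · exact h1
  · exact h2
  · exact h3
  · exact h4

lemma σ₁_mul_halfTranslation : σ₁ * halfTranslation = σ₂ := by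
  apply SL_ext <;>
    simp only [mul_zero_zero, mul_zero_one, mul_one_zero, mul_one_one, σ₁_zero_zero, σ₁_zero_one,
      σ₁_one_zero, σ₁_one_one, σ₂_zero_zero, σ₂_zero_one, σ₂_one_zero, σ₂_one_one,
      halfTranslation_zero_zero, halfTranslation_zero_one, halfTranslation_one_zero,
      halfTranslation_one_one] <;> ring

lemma sub_even_of_mem {a b c d : ℤ} (h : a * d - b * (8 * c) = 1) :
    ∃ k, d = a + 2 * k := by
  have h1 : ¬ 2 ∣ a := by
    rintro ⟨l, rfl⟩
    have : 2 * (l * d - 4 * (b * c)) = 1 := by linear_combination h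
    omega
  have h2 : ¬ 2 ∣ d := by
    rintro ⟨l, rfl⟩
    have : 2 * (a * l - 4 * (b * c)) = 1 := by linear_combination h
    omega
  exact ⟨(d - a) / 2, by omega⟩

lemma mem_N_of_forall {g : SL(2, ℝ)} (h1 : ∀ h ∈ ΓR, g * h * g⁻¹ ∈ ΓR)
    (h2 : ∀ h ∈ ΓR, g⁻¹ * h * g ∈ ΓR) : g ∈ N := by
  rw [mem_N_iff]
  refine fun h => ⟨h1 h, fun hh => ?_⟩
  have := h2 _ hh
  rwa [show g⁻¹ * (g * h * g⁻¹) * g = h by group] at this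

lemma exists_of_mem_ΓR {h : SL(2, ℝ)} (hh : h ∈ ΓR) : ∃ a b c d : ℤ, a * d - b * (8 * c) = 1 ∧
    h 0 0 = a ∧ h 0 1 = b ∧ h 1 0 = 8 * c ∧ h 1 1 = d := by
  obtain ⟨a, b, c, d, h1, h2, h3, h4⟩ := mem_ΓR_iff.mp hh
  have hdet := det_entries h
  rw [h1, h2, h3, h4] at hdet
  exact ⟨a, b, c, d, by exact_mod_cast hdet, h1, h2, h3, h4⟩

lemma σ₂_mem_N : σ₂ ∈ N := by
  have h8 := sqrt_eight_mul_self
  have h80 : √8 ≠ 0 := by simp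
  refine mem_N_of_forall (fun h hh => ?_) (fun h hh => ?_) <;>
  · obtain ⟨a, b, c, d, -, e1, e2, e3, e4⟩ := exists_of_mem_ΓR hh
    refine mem_ΓR_iff.mpr ⟨d, -c, -b, a, ?_⟩
    simp only [mul_zero_zero, mul_zero_one, mul_one_zero, mul_one_one, inv_zero_zero, inv_zero_one,
      inv_one_zero, inv_one_one, σ₂_zero_zero, σ₂_zero_one, σ₂_one_zero, σ₂_one_one, e1, e2, e3, e4]
    generalize √8 = w at h8 h80
    refine ⟨?_, ?_, ?_, ?_⟩ <;> field_simp <;> push_cast <;>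
      rw [show w ^ 2 = 8 by rw [sq, h8]] <;> ring

lemma halfTranslation_mem_N : halfTranslation ∈ N := by
  refine mem_N_of_forall (fun h hh => ?_) (fun h hh => ?_)
  · obtain ⟨a, b, c, d, hdet, e1, e2, e3, e4⟩ := exists_of_mem_ΓR hh
    obtain ⟨k, rfl⟩ := sub_even_of_mem hdet
    refine mem_ΓR_iff.mpr ⟨a + 4 * c, b + k - 2 * c, c, a + 2 * k - 4 * c, ?_⟩
    simp only [mul_zero_zero, mul_zero_one, mul_one_zero, mul_one_one, inv_zero_zero, inv_zero_one,
      inv_one_zero, inv_one_one, halfTranslation_zero_zero, halfTranslation_zero_one,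
      halfTranslation_one_zero, halfTranslation_one_one, e1, e2, e3, e4]
    push_cast
    refine ⟨?_, ?_, ?_, ?_⟩ <;> ring
  · obtain ⟨a, b, c, d, hdet, e1, e2, e3, e4⟩ := exists_of_mem_ΓR hh
    obtain ⟨k, rfl⟩ := sub_even_of_mem hdet
    refine mem_ΓR_iff.mpr ⟨a - 4 * c, b - k - 2 * c, c, a + 2 * k + 4 * c, ?_⟩
    simp only [mul_zero_zero, mul_zero_one, mul_one_zero, mul_one_one, inv_zero_zero, inv_zero_one,
      inv_one_zero, inv_one_one, halfTranslation_zero_zero, halfTranslation_zero_one,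
      halfTranslation_one_zero, halfTranslation_one_one, e1, e2, e3, e4]
    push_cast
    refine ⟨?_, ?_, ?_, ?_⟩ <;> ring

lemma σ₁_mem_N : σ₁ ∈ N := by
  rw [eq_mul_inv_of_mul_eq σ₁_mul_halfTranslation]
  exact mul_mem σ₂_mem_N (inv_mem halfTranslation_mem_N)

/-! ### Generators of the normalizer -/

/-- The subgroup generated by `Γ₀(8)`, `σ₁` and `σ₂`. -/
def generated : Subgroup SL(2, ℝ) := Subgroup.closure ((ΓR : Set SL(2, ℝ)) ∪ {σ₁, σ₂})

lemma ΓR_le_generated : ΓR ≤ generated := fun _ hg =>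
  Subgroup.subset_closure (Or.inl hg)

lemma σ₁_mem_generated : σ₁ ∈ generated := Subgroup.subset_closure (by simp)

lemma σ₂_mem_generated : σ₂ ∈ generated := Subgroup.subset_closure (by simp)

lemma halfTranslation_mem_generated : halfTranslation ∈ generated := by
  rw [eq_inv_mul_of_mul_eq σ₁_mul_halfTranslation]
  exact mul_mem (inv_mem σ₁_mem_generated) σ₂_mem_generated

/-- The conjugate of `halfTranslation` by `σ₂`. -/
def lowerTranslation : SL(2, ℝ) := σ₂ * halfTranslation * σ₂⁻¹

lemma lowerTranslation_mem_generated : lowerTranslation ∈ generated :=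
  mul_mem (mul_mem σ₂_mem_generated halfTranslation_mem_generated) (inv_mem σ₂_mem_generated)

lemma lowerTranslation_entries : lowerTranslation 0 0 = 1 ∧ lowerTranslation 0 1 = 0 ∧
    lowerTranslation 1 0 = -4 ∧ lowerTranslation 1 1 = 1 := by
  have h8 := sqrt_eight_mul_self
  have h80 : √8 ≠ 0 := by simp
  simp only [lowerTranslation, mul_zero_zero, mul_zero_one, mul_one_zero, mul_one_one,
    inv_zero_zero, inv_zero_one, inv_one_zero, inv_one_one, σ₂_zero_zero, σ₂_zero_one, σ₂_one_zero,
    σ₂_one_one, halfTranslation_zero_zero, halfTranslation_zero_one, halfTranslation_one_zero,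
    halfTranslation_one_one]
  generalize √8 = w at h8 h80
  refine ⟨?_, ?_, ?_, ?_⟩ <;> field_simp <;>
    (rw [show w ^ 2 = 8 by rw [sq, h8]]; ring)

/-- The matrices `(a, b / 2; 4 c, d)` with integers `a`, `b`, `c`, `d` belong to the group
generated by `Γ₀(8)`, `σ₁` and `σ₂`. -/
lemma mem_generated_of_entries {g : SL(2, ℝ)} {a b c d : ℤ} (h1 : g 0 0 = a)
    (h2 : g 0 1 = b / 2) (h3 : g 1 0 = 4 * c) (h4 : g 1 1 = d) : g ∈ generated := by
  -- If b and c are both even the matrix lies in Γ₀(8). Otherwise multiplication by a generated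
  -- translation repairs the parity, because a is odd.
  have mem_of_even_of_even : ∀ {g : SL(2, ℝ)} {a b c d : ℤ}, g 0 0 = a → g 0 1 = b / 2 → g 1 0 = 4 * c →
      g 1 1 = d → Even c → Even b → g ∈ generated := by
    rintro g a b c d h1 h2 h3 h4 ⟨k, rfl⟩ ⟨l, rfl⟩
    refine ΓR_le_generated (mem_ΓR_iff.mpr ⟨a, l, k, d, h1, ?_, ?_, h4⟩)
    · rw [h2]; push_cast; ring
    · rw [h3]; push_cast; ring
  have hodd : ∀ {g : SL(2, ℝ)} {a b c d : ℤ}, g 0 0 = a → g 0 1 = b / 2 → g 1 0 = 4 * c →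
      g 1 1 = d → Odd a := by
    intro g a b c d h1 h2 h3 h4
    have hdet := det_entries g
    rw [h1, h2, h3, h4] at hdet
    have hdet' : a * d = 1 + 2 * (b * c) := by
      have : (a * d : ℝ) = 1 + 2 * (b * c) := by linear_combination hdet
      exact_mod_cast this
    have : Odd (a * d) := ⟨b * c, by linear_combination hdet'⟩
    exact (Int.odd_mul.mp this).1
  have mem_of_even : ∀ {g : SL(2, ℝ)} {a b c d : ℤ}, g 0 0 = a → g 0 1 = b / 2 → g 1 0 = 4 * c →
      g 1 1 = d → Even c → g ∈ generated := by
    intro g a b c d h1 h2 h3 h4 hc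
    rcases Int.even_or_odd b with hb | hb
    · exact mem_of_even_of_even h1 h2 h3 h4 hc hb
    · have := mem_of_even_of_even (g := g * halfTranslation) (a := a) (b := a + b) (c := c) (d := 2 * c + d)
        (by rw [mul_zero_zero, h1, halfTranslation_zero_zero, halfTranslation_one_zero]; ring)
        (by rw [mul_zero_one, h1, h2, halfTranslation_zero_one, halfTranslation_one_one]
            push_cast; ring)
        (by rw [mul_one_zero, h3, halfTranslation_zero_zero, halfTranslation_one_zero]; ring)
        (by rw [mul_one_one, h3, h4, halfTranslation_zero_one, halfTranslation_one_one]
            push_cast; ring)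
        hc ((hodd h1 h2 h3 h4).add_odd hb)
      exact (Subgroup.mul_mem_cancel_right _ halfTranslation_mem_generated).mp this
  rcases Int.even_or_odd c with hc | hc
  · exact mem_of_even h1 h2 h3 h4 hc
  · obtain ⟨v1, v2, v3, v4⟩ := lowerTranslation_entries
    -- The matrix (1, 0; -4, 1) replaces c by c - a, which is even.
    have := mem_of_even (g := lowerTranslation * g) (a := a) (b := b) (c := c - a) (d := d - 2 * b)
        (by rw [mul_zero_zero, h1, v1, v2]; ring)
        (by rw [mul_zero_one, h2, v1, v2]; ring)
        (by rw [mul_one_zero, h1, h3, v3, v4]; push_cast; ring)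
        (by rw [mul_one_one, h2, h4, v3, v4]; push_cast; ring)
        (hc.sub_odd (hodd h1 h2 h3 h4))
    exact (Subgroup.mul_mem_cancel_left _ lowerTranslation_mem_generated).mp this

/-! ### Integrality conditions on the normalizer -/

lemma exists_integers_of_conj_mem {g h : SL(2, ℝ)} {a b c d : ℝ} (hh : g * h * g⁻¹ ∈ ΓR)
    (h1 : h 0 0 = a) (h2 : h 0 1 = b) (h3 : h 1 0 = c) (h4 : h 1 1 = d) : ∃ k l m : ℤ,
    (g 0 0 * a + g 0 1 * c) * g 1 1 - (g 0 0 * b + g 0 1 * d) * g 1 0 = k ∧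
    (g 0 0 * b + g 0 1 * d) * g 0 0 - (g 0 0 * a + g 0 1 * c) * g 0 1 = l ∧
    (g 1 0 * a + g 1 1 * c) * g 1 1 - (g 1 0 * b + g 1 1 * d) * g 1 0 = 8 * m := by
  obtain ⟨k, l, m, -, e1, e2, e3, -⟩ := mem_ΓR_iff.mp hh
  refine ⟨k, l, m, ?_, ?_, ?_⟩
  · rw [← e1, mul_zero_zero, mul_zero_zero, mul_zero_one, inv_zero_zero, inv_one_zero, h1, h2, h3,
      h4]
    ring
  · rw [← e2, mul_zero_one, mul_zero_zero, mul_zero_one, inv_zero_one, inv_one_one, h1, h2, h3, h4]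
    ring
  · rw [← e3, mul_one_zero, mul_one_zero, mul_one_one, inv_zero_zero, inv_one_zero, h1, h2, h3, h4]
    ring

/-- The integrality conditions on a matrix that normalizes `Γ₀(8)`. -/
lemma exists_integers_of_mem_N {g : SL(2, ℝ)} (hg : g ∈ N) : ∃ A R D Q M E K : ℤ,
    g 0 0 ^ 2 = A ∧ g 1 0 ^ 2 = 8 * R ∧ g 1 1 ^ 2 = D ∧ 8 * g 0 1 ^ 2 = Q ∧
    g 0 0 * g 1 1 = M ∧ g 0 0 * g 1 0 = E ∧ 8 * (g 0 0 * g 0 1) = K := by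
  rw [mem_N_iff] at hg
  have hT : (⟨!![1, 1; 0, 1], by simp⟩ : SL(2, ℝ)) ∈ ΓR :=
    mem_ΓR_iff.mpr ⟨1, 1, 0, 1, by simp⟩
  have hU : (⟨!![1, 0; 8, 1], by simp⟩ : SL(2, ℝ)) ∈ ΓR :=
    mem_ΓR_iff.mpr ⟨1, 0, 1, 1, by simp⟩
  -- This is the product of the two preceding matrices. Comparing upper left entries of the
  -- conjugates isolates 8 times the product of the diagonal entries of g.
  have hW : (⟨!![9, 1; 8, 1], by rw [Matrix.det_fin_two_of]; norm_num⟩ : SL(2, ℝ)) ∈ ΓR :=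
    mem_ΓR_iff.mpr ⟨9, 1, 1, 1, by simp⟩
  obtain ⟨a1, b1, c1, t1, t2, t3⟩ := exists_integers_of_conj_mem (a := 1) (b := 1) (c := 0) (d := 1)
     ((hg _).mp hT) rfl rfl rfl rfl
  obtain ⟨a2, b2, c2, u1, u2, u3⟩ := exists_integers_of_conj_mem (a := 1) (b := 0) (c := 8) (d := 1)
     ((hg _).mp hU) rfl rfl rfl rfl
  obtain ⟨a3, b3, c3, w1, w2, w3⟩ := exists_integers_of_conj_mem (a := 9) (b := 1) (c := 8) (d := 1)
     ((hg _).mp hW) rfl rfl rfl rfl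
  have hdet := det_entries g
  generalize g 0 0 = p at *
  generalize g 0 1 = q at *
  generalize g 1 0 = r at *
  generalize g 1 1 = s at *
  have hm : 8 * (p * s) = ((a3 - a1 - a2 + 1 : ℤ) : ℝ) := by
    push_cast
    linear_combination w1 - t1 - u1 + hdet
  have hsq : ((a3 - a1 - a2 + 1 : ℤ) : ℝ) ^ 2 = ((8 ^ 2 * (b1 * c2) : ℤ) : ℝ) := by
    rw [← hm]
    push_cast
    rw [← t2]
    linear_combination 8 * p ^ 2 * u3
  -- The square of this integer is 64p²s² with p² and s² integers, so the integer itself is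
  -- divisible by 8.
  have hdvd : (8 : ℤ) ∣ a3 - a1 - a2 + 1 :=
    (Int.pow_dvd_pow_iff two_ne_zero).mp ⟨b1 * c2, by exact_mod_cast hsq⟩
  obtain ⟨M, hM⟩ := hdvd
  refine ⟨b1, -c1, c2, -b2, M, 1 - a1, b1 + b2 - b3, ?_, ?_, ?_, ?_, ?_, ?_, ?_⟩
  · linear_combination t2
  · push_cast; linear_combination -t3
  · linear_combination u3 / 8
  · push_cast; linear_combination -u2
  · rw [hM] at hm; push_cast at hm; linear_combination hm / 8
  · push_cast; linear_combination hdet - t1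
  · push_cast; linear_combination t2 + u2 - w2

/-- Two coprime integers whose product is twice a square. -/
lemma sq_or_sq_of_mul_eq_two_mul_sq {A R e : ℤ} (hA : 0 ≤ A) (hR : 0 ≤ R) (hco : IsCoprime A R)
    (h : A * R = 2 * e ^ 2) :
    (∃ a f : ℤ, A = a ^ 2 ∧ R = 2 * f ^ 2) ∨ ∃ a f : ℤ, R = a ^ 2 ∧ A = 2 * f ^ 2 := by
  have key : ∀ {A R : ℤ}, 0 ≤ A → 0 ≤ R → IsCoprime A R → A * R = 2 * e ^ 2 → 2 ∣ R →
      ∃ a f : ℤ, A = a ^ 2 ∧ R = 2 * f ^ 2 := by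
    rintro A R hA hR hco h ⟨R', rfl⟩
    have hco' : IsCoprime A R' := hco.of_mul_right_right
    have h' : A * R' = e ^ 2 := by linarith
    obtain ⟨a, ha⟩ := Int.sq_of_isCoprime hco' h'
    obtain ⟨f, hf⟩ := Int.sq_of_isCoprime hco'.symm (by rw [mul_comm]; exact h')
    refine ⟨a, f, ?_, ?_⟩
    · rcases ha with ha | ha
      · exact ha
      · have : a ^ 2 = 0 := by nlinarith [sq_nonneg a]
        rw [ha, this, neg_zero]
    · rcases hf with hf | hf
      · rw [hf]
      · have : f ^ 2 = 0 := by nlinarith [sq_nonneg f]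
        rw [hf, this, neg_zero]
  have h2 : (2 : ℤ) ∣ A * R := ⟨e ^ 2, h⟩
  rcases Int.prime_two.dvd_or_dvd h2 with h3 | h3
  · exact Or.inr (key hR hA hco.symm (by rw [mul_comm]; exact h) h3)
  · exact Or.inl (key hA hR hco h h3)

lemma exists_eq_of_sq_eq {p : ℝ} {a : ℤ} (h : p ^ 2 = (a : ℝ) ^ 2) : ∃ k : ℤ, p = k ∧ k ^ 2 = a ^ 2 := by
  rcases sq_eq_sq_iff_eq_or_eq_neg.mp h with h | h
  · exact ⟨a, h, rfl⟩
  · exact ⟨-a, by push_cast; exact h, by ring⟩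

/-- The first column is integral with lower entry divisible by 4; the conditions of
`exists_integers_of_mem_N` then force the second column into the shape of
`mem_generated_of_entries`. -/
lemma mem_generated_of_sq {g : SL(2, ℝ)} (hg : g ∈ N) {a f : ℤ} (ha : g 0 0 ^ 2 = (a : ℝ) ^ 2)
    (hf : g 1 0 ^ 2 = 16 * (f : ℝ) ^ 2) : g ∈ generated := by
  obtain ⟨A, R, D, Q, M, E, K, hA, hR, hD, hQ, hM, hE, hK⟩ := exists_integers_of_mem_N hg
  have hdet := det_entries g
  obtain ⟨p, hp, -⟩ := exists_eq_of_sq_eq ha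
  obtain ⟨r, hr, hr2⟩ := exists_eq_of_sq_eq (p := g 1 0) (a := 4 * f) (by push_cast; rw [hf]; ring)
  have hr4 : (4 : ℤ) ∣ r := (Int.pow_dvd_pow_iff two_ne_zero).mp ⟨f ^ 2, by rw [hr2]; ring⟩
  obtain ⟨c, rfl⟩ := hr4
  -- If p = 0, the squared determinant condition reads Q·2c² = 1, which fails by parity.
  have hp0 : p ≠ 0 := by
    rintro rfl
    have h1 : ((Q * (2 * c ^ 2) : ℤ) : ℝ) = ((1 : ℤ) : ℝ) := by
      push_cast
      rw [← hQ]
      rw [hp, hr] at hdet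
      push_cast at hdet
      linear_combination (1 - 4 * g 0 1 * c) * hdet
    have h2 : Q * (2 * c ^ 2) = 1 := by exact_mod_cast h1
    have h3 : 2 * (Q * c ^ 2) = 1 := by linarith
    omega
  have hpR : (p : ℝ) ≠ 0 := by exact_mod_cast hp0
  rw [hp] at hM hK
  have hpM : p ∣ M := (Int.pow_dvd_pow_iff two_ne_zero).mp ⟨D, by
    have : (M : ℝ) ^ 2 = (p : ℝ) ^ 2 * D := by rw [← hM, ← hD]; ring
    exact_mod_cast this⟩
  have hpK : p ∣ K := (Int.pow_dvd_pow_iff two_ne_zero).mp ⟨8 * Q, by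
    have : (K : ℝ) ^ 2 = (p : ℝ) ^ 2 * (8 * Q) := by rw [← hK, ← hQ]; ring
    exact_mod_cast this⟩
  obtain ⟨d, rfl⟩ := hpM
  obtain ⟨w, rfl⟩ := hpK
  have hd : g 1 1 = d := mul_left_cancel₀ hpR (by rw [hM]; push_cast; rfl)
  have hw : 8 * g 0 1 = w := mul_left_cancel₀ hpR (by push_cast at hK; linear_combination hK)
  have hw2 : w ^ 2 = 8 * Q := by
    have : (w : ℝ) ^ 2 = 8 * Q := by rw [← hw, ← hQ]; ring
    exact_mod_cast this
  -- From w² = 8Q the integer w = 8·g₀₁ is divisible by 4, so g₀₁ is half an integer.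
  have hw4 : (4 : ℤ) ∣ w := by
    have h1 : (2 : ℤ) ∣ w := Int.prime_two.dvd_of_dvd_pow (n := 2) ⟨4 * Q, by linarith⟩
    obtain ⟨v, rfl⟩ := h1
    have h2 : (2 : ℤ) ∣ v := Int.prime_two.dvd_of_dvd_pow (n := 2) ⟨Q, by linarith⟩
    obtain ⟨u, rfl⟩ := h2
    exact ⟨u, by ring⟩
  obtain ⟨b, rfl⟩ := hw4
  refine mem_generated_of_entries hp (b := b) ?_ (c := c) ?_ hd
  · push_cast at hw; linear_combination hw / 8
  · rw [hr]; push_cast; rfl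

theorem N_le_generated : N ≤ generated := by
  intro g hg
  obtain ⟨A, R, D, Q, M, E, K, hA, hR, hD, hQ, hM, hE, hK⟩ := exists_integers_of_mem_N hg
  have hdet := det_entries g
  have hA0 : 0 ≤ A := by
    have : (0 : ℝ) ≤ A := by rw [← hA]; positivity
    exact_mod_cast this
  have hR0 : 0 ≤ R := by
    have : (0 : ℝ) ≤ 8 * R := by rw [← hR]; positivity
    have : (0 : ℝ) ≤ R := by linarith
    exact_mod_cast this
  have hAD : M ^ 2 = A * D := by
    have : (M : ℝ) ^ 2 = A * D := by rw [← hM, ← hA, ← hD]; ring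
    exact_mod_cast this
  have hQR : (M - 1) ^ 2 = Q * R := by
    have : ((M : ℝ) - 1) ^ 2 = Q * R := by
      have h1 : (M : ℝ) - 1 = g 0 1 * g 1 0 := by linear_combination hdet - hM
      rw [h1, ← hQ]
      linear_combination g 0 1 ^ 2 * hR
    exact_mod_cast this
  -- A divides M² and R divides (M - 1)², and M and M - 1 are coprime.
  have hco : IsCoprime A R := by
    have h1 : IsCoprime (M ^ 2) ((M - 1) ^ 2) := IsCoprime.pow ⟨1, -1, by ring⟩
    rw [hAD, hQR] at h1
    exact h1.of_mul_left_left.of_mul_right_right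
  have hER : E ^ 2 = 8 * (A * R) := by
    have : (E : ℝ) ^ 2 = 8 * (A * R) := by
      rw [← hE, ← hA]
      linear_combination g 0 0 ^ 2 * hR
    exact_mod_cast this
  have hE4 : (4 : ℤ) ∣ E := by
    have h1 : (2 : ℤ) ∣ E := Int.prime_two.dvd_of_dvd_pow (n := 2) ⟨4 * (A * R), by linarith⟩
    obtain ⟨v, rfl⟩ := h1
    have h2 : (2 : ℤ) ∣ v := Int.prime_two.dvd_of_dvd_pow (n := 2) ⟨A * R, by linarith⟩
    obtain ⟨u, rfl⟩ := h2
    exact ⟨u, by ring⟩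
  obtain ⟨e, rfl⟩ := hE4
  -- Now AR = 2e² with A and R coprime. If A is the square, g has the integral shape; if R is, then
  -- σ₂g has it.
  rcases sq_or_sq_of_mul_eq_two_mul_sq hA0 hR0 hco (e := e) (by linarith) with
    ⟨a, f, rfl, rfl⟩ | ⟨a, f, rfl, rfl⟩
  · refine mem_generated_of_sq hg (a := a) (f := f) ?_ ?_
    · rw [hA]; push_cast; rfl
    · rw [hR]; push_cast; ring
  · have h8 := sqrt_eight_mul_self
    have h80 : √8 ≠ 0 := by simp
    have h1 : σ₂ * g ∈ generated := by
      refine mem_generated_of_sq (mul_mem σ₂_mem_N hg) (a := a) (f := f) ?_ ?_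
      · rw [mul_zero_zero, σ₂_zero_zero, σ₂_zero_one]
        push_cast at hR
        have : (0 * g 0 0 + -1 / √8 * g 1 0) ^ 2 = g 1 0 ^ 2 / (√8 * √8) := by ring
        rw [this, hR, h8]
        ring
      · rw [mul_one_zero, σ₂_one_zero, σ₂_one_one]
        push_cast at hA
        have : (8 / √8 * g 0 0 + 0 * g 1 0) ^ 2 = 64 * g 0 0 ^ 2 / (√8 * √8) := by ring
        rw [this, hA, h8]
        ring
    exact (Subgroup.mul_mem_cancel_left _ σ₂_mem_generated).mp h1

end Bimodular
end

noncomputable section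
namespace Bimodular

/-! ### Boundedness at the cusps -/

open ModularGroup UpperHalfPlane

/-- The square of Jacobi's theta function. -/
def jacobiSq (τ : ℍ) : ℂ := jacobiTheta τ ^ 2

lemma denom_T (τ : ℍ) : denom (T : SL(2, ℤ)) τ = 1 := by
  change (((T 1 0 : ℤ) : ℝ) : ℂ) * τ + (((T 1 1 : ℤ) : ℝ) : ℂ) = 1
  simp [T]

lemma denom_S (τ : ℍ) : denom (S : SL(2, ℤ)) τ = τ := by
  change (((S 1 0 : ℤ) : ℝ) : ℂ) * τ + (((S 1 1 : ℤ) : ℝ) : ℂ) = τ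
  simp [S]

lemma jacobiTheta_add_two (z : ℂ) : jacobiTheta (z + 2) = jacobiTheta z := by
  rw [add_comm, jacobiTheta_two_add]

lemma jacobiSq_slash_T : jacobiSq ∣[(1 : ℤ)] T = fun τ : ℍ => jacobiTheta (τ + 1) ^ 2 := by
  funext τ
  rw [ModularForm.SL_slash_apply, modular_T_smul, jacobiSq]
  simp [denom_T, add_comm]

lemma jacobiSq_slash_T_T : (jacobiSq ∣[(1 : ℤ)] T) ∣[(1 : ℤ)] T = jacobiSq := by
  funext τ
  rw [ModularForm.SL_slash_apply, modular_T_smul, jacobiSq_slash_T, jacobiSq]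
  have : ((1 : ℝ) +ᵥ τ : ℍ) + (1 : ℂ) = τ + 2 := by
    rw [coe_vadd]; push_cast; ring
  rw [denom_T, one_zpow, mul_one]
  beta_reduce
  rw [this, jacobiTheta_add_two]

lemma jacobiSq_slash_S : jacobiSq ∣[(1 : ℤ)] S = (-Complex.I) • jacobiSq := by
  funext τ
  have h := jacobiTheta_sq_neg_inv τ.im_pos
  have h0 := UpperHalfPlane.ne_zero τ
  rw [ModularForm.SL_slash_apply, modular_S_smul, jacobiSq, Pi.smul_apply, jacobiSq, smul_eq_mul]
  have e : (-(τ : ℂ))⁻¹ = -1 / τ := by rw [inv_neg, neg_div, one_div]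
  simp only [e, h]
  rw [denom_S, zpow_neg_one]
  field_simp

lemma slash_neg_one (f : ℍ → ℂ) : f ∣[(1 : ℤ)] (-1 : SL(2, ℤ)) = -f := by
  funext τ
  rw [ModularForm.SL_slash_apply]
  simp [denom]

/-- This is the third conjugate, classically a multiple of θ₂². It comes from
`discB_nome_fricke_eight` at τ/4, and the right side is visibly bounded as Im τ → ∞. -/
lemma jacobiSq_slash_T_S (τ : ℍ) : ((jacobiSq ∣[(1 : ℤ)] T) ∣[(1 : ℤ)] S) τ =
    -Complex.I / 2 * (jacobiTheta (τ / 2) ^ 2 - jacobiTheta (τ / 2 + 1) ^ 2) := by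
  have h0 := UpperHalfPlane.ne_zero τ
  have him : 0 < ((τ : ℂ) / 4).im := by
    have := τ.im_pos
    simp only [Complex.div_ofNat_im, coe_im]
    positivity
  have h := discB_nome_fricke_eight him
  rw [discB_nome, discB_nome, discA, discA, discA, discTheta_nome, discTheta_nome,
    discTheta_nome] at h
  rw [ModularForm.SL_slash_apply, modular_S_smul, jacobiSq_slash_T]
  have e1 : 2 * (-1 / (8 * ((τ : ℂ) / 4)) + 1 / 2) = (-(τ : ℂ))⁻¹ + 1 := by
    field_simp; ring
  have e2 : 2 * ((τ : ℂ) / 4) = τ / 2 := by ring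
  have e3 : 2 * ((τ : ℂ) / 4 + 1 / 2) = τ / 2 + 1 := by ring
  rw [e1, e2, e3] at h
  simp only [h]
  rw [denom_S, zpow_neg_one]
  field_simp
  ring

/-- The multiples of the conjugates of `jacobiSq`. -/
def IsJacobiConjugate (f : ℍ → ℂ) : Prop := ∃ c : ℂ, f = c • jacobiSq ∨
  f = c • jacobiSq ∣[(1 : ℤ)] T ∨ f = c • (jacobiSq ∣[(1 : ℤ)] T) ∣[(1 : ℤ)] S

lemma S_mul_S : S * S = -1 := by decide

lemma T_S_T : T * S * T = S * T⁻¹ * S⁻¹ := by decide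

lemma slash_S_inv (f : ℍ → ℂ) : f ∣[(1 : ℤ)] S⁻¹ = -(f ∣[(1 : ℤ)] S) := by
  rw [show S⁻¹ = S * (-1) by decide, SlashAction.slash_mul, slash_neg_one]

lemma jacobiSq_slash_T_inv : jacobiSq ∣[(1 : ℤ)] T⁻¹ = jacobiSq ∣[(1 : ℤ)] T := by
  conv_lhs => rw [← jacobiSq_slash_T_T]
  rw [← SlashAction.slash_mul _ T T⁻¹, mul_inv_cancel, SlashAction.slash_one]

/-- The relation TST = ST⁻¹S⁻¹ reduces the action of T on the third conjugate to known actions, so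
the three conjugates are closed up to scalars. -/
lemma jacobiSq_slash_T_S_T : ((jacobiSq ∣[(1 : ℤ)] T) ∣[(1 : ℤ)] S) ∣[(1 : ℤ)] T =
    Complex.I • (jacobiSq ∣[(1 : ℤ)] T) ∣[(1 : ℤ)] S := by
  rw [← SlashAction.slash_mul, ← SlashAction.slash_mul, ← mul_assoc, T_S_T, SlashAction.slash_mul,
    SlashAction.slash_mul, jacobiSq_slash_S, ModularForm.SL_smul_slash, ModularForm.SL_smul_slash,
    jacobiSq_slash_T_inv, slash_S_inv, smul_neg, _root_.neg_smul, neg_neg]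

lemma jacobiSq_slash_T_S_T_inv : ((jacobiSq ∣[(1 : ℤ)] T) ∣[(1 : ℤ)] S) ∣[(1 : ℤ)] T⁻¹ =
    (-Complex.I) • (jacobiSq ∣[(1 : ℤ)] T) ∣[(1 : ℤ)] S := by
  have h := congrArg (fun f => (-Complex.I) • f ∣[(1 : ℤ)] T⁻¹) jacobiSq_slash_T_S_T
  simp only [ModularForm.SL_smul_slash, smul_smul] at h
  rw [← SlashAction.slash_mul _ T T⁻¹, mul_inv_cancel, SlashAction.slash_one] at h
  simpa using h.symm

lemma IsJacobiConjugate.smul {f : ℍ → ℂ} (hf : IsJacobiConjugate f) (a : ℂ) :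
    IsJacobiConjugate (a • f) := by
  obtain ⟨c, rfl | rfl | rfl⟩ := hf
  · exact ⟨a * c, Or.inl (smul_smul _ _ _)⟩
  · exact ⟨a * c, Or.inr (Or.inl (smul_smul _ _ _))⟩
  · exact ⟨a * c, Or.inr (Or.inr (smul_smul _ _ _))⟩

lemma IsJacobiConjugate.slash_S {f : ℍ → ℂ} (hf : IsJacobiConjugate f) :
    IsJacobiConjugate (f ∣[(1 : ℤ)] S) := by
  obtain ⟨c, rfl | rfl | rfl⟩ := hf <;> rw [ModularForm.SL_smul_slash] <;>
    refine IsJacobiConjugate.smul ?_ c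
  · exact ⟨_, Or.inl jacobiSq_slash_S⟩
  · exact ⟨1, Or.inr (Or.inr (one_smul _ _).symm)⟩
  · refine ⟨-1, Or.inr (Or.inl ?_)⟩
    rw [← SlashAction.slash_mul, S_mul_S, slash_neg_one, _root_.neg_smul, one_smul]

lemma IsJacobiConjugate.slash_T {f : ℍ → ℂ} (hf : IsJacobiConjugate f) :
    IsJacobiConjugate (f ∣[(1 : ℤ)] T) := by
  obtain ⟨c, rfl | rfl | rfl⟩ := hf <;> rw [ModularForm.SL_smul_slash] <;>
    refine IsJacobiConjugate.smul ?_ c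
  · exact ⟨1, Or.inr (Or.inl (one_smul _ _).symm)⟩
  · exact ⟨1, Or.inl (by rw [jacobiSq_slash_T_T, one_smul])⟩
  · exact ⟨_, Or.inr (Or.inr jacobiSq_slash_T_S_T)⟩

lemma IsJacobiConjugate.slash_T_inv {f : ℍ → ℂ} (hf : IsJacobiConjugate f) :
    IsJacobiConjugate (f ∣[(1 : ℤ)] T⁻¹) := by
  obtain ⟨c, rfl | rfl | rfl⟩ := hf <;> rw [ModularForm.SL_smul_slash] <;>
    refine IsJacobiConjugate.smul ?_ c
  · exact ⟨1, Or.inr (Or.inl (by rw [jacobiSq_slash_T_inv, one_smul]))⟩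
  · refine ⟨1, Or.inl ?_⟩
    rw [← SlashAction.slash_mul, mul_inv_cancel, SlashAction.slash_one, one_smul]
  · exact ⟨_, Or.inr (Or.inr jacobiSq_slash_T_S_T_inv)⟩

/-- S and T generate SL(2, ℤ), and each generator and its inverse permute the three conjugates up to
scalars. -/
lemma isJacobiConjugate_slash (γ : SL(2, ℤ)) : IsJacobiConjugate (jacobiSq ∣[(1 : ℤ)] γ) := by
  have hγ : γ ∈ Subgroup.closure {S, T} := by simp [SpecialLinearGroup.SL2Z_generators]
  induction hγ using Subgroup.closure_induction_right with
  | one => exact ⟨1, Or.inl (by rw [SlashAction.slash_one, one_smul])⟩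
  | mul_right g _ h hh ih =>
    rw [SlashAction.slash_mul]
    rcases hh with rfl | rfl
    exacts [ih.slash_S, ih.slash_T]
  | mul_inv_cancel g _ h hh ih =>
    rw [SlashAction.slash_mul]
    rcases hh with rfl | rfl
    · rw [slash_S_inv, ← neg_one_smul ℂ]
      exact ih.slash_S.smul _
    · exact ih.slash_T_inv

lemma exists_jacobiTheta_bound : ∃ M : ℝ, ∀ z : ℂ, 1 ≤ z.im → ‖jacobiTheta z ^ 2‖ ≤ M := by
  refine ⟨(2 / (1 - Real.exp (-Real.pi)) + 1) ^ 2, fun z hz => ?_⟩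
  have h1 := norm_jacobiTheta_sub_one_le (zero_lt_one.trans_le hz)
  have h2 : Real.exp (-Real.pi * z.im) ≤ Real.exp (-Real.pi) := by
    rw [Real.exp_le_exp]
    nlinarith [Real.pi_pos]
  have h3 : Real.exp (-Real.pi) < 1 := by
    rw [Real.exp_lt_one_iff]
    linarith [Real.pi_pos]
  have h4 : 2 / (1 - Real.exp (-Real.pi * z.im)) * Real.exp (-Real.pi * z.im) ≤
      2 / (1 - Real.exp (-Real.pi)) := by
    calc _ ≤ 2 / (1 - Real.exp (-Real.pi)) * 1 := by
          gcongr
          linarith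
      _ = _ := mul_one _
  rw [norm_pow]
  gcongr
  calc ‖jacobiTheta z‖ = ‖(jacobiTheta z - 1) + 1‖ := by rw [sub_add_cancel]
    _ ≤ ‖jacobiTheta z - 1‖ + ‖(1 : ℂ)‖ := norm_add_le _ _
    _ ≤ _ := by rw [norm_one]; linarith

lemma IsJacobiConjugate.isBoundedAtImInfty {f : ℍ → ℂ} (hf : IsJacobiConjugate f) :
    IsBoundedAtImInfty f := by
  obtain ⟨M, hM⟩ := exists_jacobiTheta_bound
  rw [isBoundedAtImInfty_iff]
  obtain ⟨c, rfl | rfl | rfl⟩ := hf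
  · refine ⟨‖c‖ * M, 1, fun τ hτ => ?_⟩
    rw [Pi.smul_apply, smul_eq_mul, norm_mul, jacobiSq]
    gcongr
    exact hM _ hτ
  · refine ⟨‖c‖ * M, 1, fun τ hτ => ?_⟩
    rw [Pi.smul_apply, smul_eq_mul, norm_mul, jacobiSq_slash_T]
    gcongr
    exact hM _ (by simpa using hτ)
  · refine ⟨‖c‖ * (‖-Complex.I / 2‖ * (M + M)), 2, fun τ hτ => ?_⟩
    rw [Pi.smul_apply, smul_eq_mul, norm_mul, jacobiSq_slash_T_S, norm_mul]
    have h : 1 ≤ ((τ : ℂ) / 2).im := by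
      simp only [Complex.div_ofNat_im, coe_im]
      linarith
    gcongr
    refine (norm_sub_le _ _).trans (add_le_add (hM _ h) (hM _ (by simpa using h)))

/-- The matrix `(2, b; 0, 1)`. -/
def doubling (b : ℝ) : GL (Fin 2) ℝ :=
  Matrix.GeneralLinearGroup.mkOfDetNeZero !![2, b; 0, 1] (by simp)

lemma isCusp_doubling_smul {c : OnePoint ℝ} (b : ℤ) (hc : IsCusp c 𝒮ℒ) :
    IsCusp (doubling b • c) 𝒮ℒ := by
  rw [isCusp_SL2Z_iff] at hc ⊢
  obtain ⟨r, rfl⟩ := hc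
  induction r using OnePoint.rec with
  | infty =>
    refine ⟨OnePoint.infty, ?_⟩
    rw [OnePoint.map_infty, OnePoint.smul_infty_eq_self_iff.mpr]
    rfl
  | coe r =>
    refine ⟨((2 * r + b : ℚ) : OnePoint ℚ), ?_⟩
    rw [OnePoint.map_some, OnePoint.map_some, OnePoint.smul_some_eq_ite]
    simp [doubling, Matrix.GeneralLinearGroup.mkOfDetNeZero]

lemma jacobiSq_slash_doubling (b : ℝ) :
    jacobiSq ∣[(1 : ℤ)] doubling b = fun τ : ℍ => jacobiTheta (2 * τ + b) ^ 2 := by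
  funext τ
  have hd : 0 < (doubling b).det.val := by simp [doubling, Matrix.GeneralLinearGroup.mkOfDetNeZero]
  have h1 : ((doubling b • τ : ℍ) : ℂ) = 2 * τ + b := by
    rw [coe_smul_of_det_pos hd]
    simp [num, denom, doubling, Matrix.GeneralLinearGroup.mkOfDetNeZero]
  rw [ModularForm.slash_apply, jacobiSq, h1]
  simp [σ, denom, doubling, Matrix.GeneralLinearGroup.mkOfDetNeZero]

/-- The function is `jacobiSq` slashed by (2, b; 0, 1). This rational matrix sends cusps to cusps,
so boundedness at every cusp is inherited from `jacobiSq`. -/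
lemma isBoundedAtImInfty_slash (b : ℤ) (γ : SL(2, ℤ)) :
    IsBoundedAtImInfty ((fun τ : ℍ => jacobiTheta (2 * τ + (b : ℝ)) ^ 2) ∣[(1 : ℤ)] γ) := by
  rw [← jacobiSq_slash_doubling]
  have hc : IsCusp (Matrix.SpecialLinearGroup.mapGL ℝ γ • OnePoint.infty) 𝒮ℒ :=
    isCusp_SL2Z_iff'.mpr ⟨γ, rfl⟩
  have h := (OnePoint.isBoundedAt_iff_forall_SL2Z (f := jacobiSq) (k := 1)
    (isCusp_doubling_smul b hc)).mpr fun δ _ => (isJacobiConjugate_slash δ).isBoundedAtImInfty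
  rw [OnePoint.IsBoundedAt.smul_iff, OnePoint.isBoundedAt_iff rfl] at h
  exact h

lemma isBoundedAtImInfty_theta3_sq_slash (γ : SL(2, ℤ)) :
    IsBoundedAtImInfty ((fun τ => theta3 τ ^ 2) ∣[(1 : ℤ)] γ) := by
  have h := isBoundedAtImInfty_slash 0 γ
  convert h using 3 with τ
  rw [theta3_sq, discA, discTheta_nome]
  simp

lemma isBoundedAtImInfty_theta4_sq_slash (γ : SL(2, ℤ)) :
    IsBoundedAtImInfty ((fun τ => theta4 τ ^ 2) ∣[(1 : ℤ)] γ) := by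
  have h := isBoundedAtImInfty_slash 1 γ
  convert h using 3 with τ
  rw [theta4_sq, discB_nome, discA, discTheta_nome]
  simp [mul_add]

/-- In this form F has no denominators and is, in each variable, a linear combination of θ₃² and
θ₄²; holomorphy, growth and transformation laws are read off from it. -/
lemma F_eq_add (τ₁ τ₂ : ℍ) :
    F τ₁ τ₂ = (theta3 τ₁ ^ 2 * theta3 τ₂ ^ 2 + theta4 τ₁ ^ 2 * theta4 τ₂ ^ 2) / 2 := by
  have h1 := theta3_sq_ne_zero τ₁
  have h2 := theta3_sq_ne_zero τ₂
  rw [F, t, t]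
  generalize theta3 τ₁ ^ 2 = a at *
  generalize theta3 τ₂ ^ 2 = b at *
  field_simp

lemma F_comm (τ₁ τ₂ : ℍ) : F τ₁ τ₂ = F τ₂ τ₁ := by
  rw [F_eq_add, F_eq_add]
  ring

lemma isBoundedAtImInfty_F_left (τ₂ : ℍ) (γ : SL(2, ℤ)) :
    IsBoundedAtImInfty ((fun τ₁ : ℍ => F τ₁ τ₂) ∣[(1 : ℤ)] γ) := by
  have e : (fun τ₁ : ℍ => F τ₁ τ₂) = (theta3 τ₂ ^ 2 / 2) • (fun τ => theta3 τ ^ 2) +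
      (theta4 τ₂ ^ 2 / 2) • (fun τ => theta4 τ ^ 2) := by
    funext τ
    rw [F_eq_add]
    simp
    ring
  rw [e, SlashAction.add_slash, ModularForm.SL_smul_slash, ModularForm.SL_smul_slash]
  exact ((isBoundedAtImInfty_theta3_sq_slash γ).const_mul_left _).add
    ((isBoundedAtImInfty_theta4_sq_slash γ).const_mul_left _)

lemma isBoundedAtImInfty_F_right (τ₁ : ℍ) (γ : SL(2, ℤ)) :
    IsBoundedAtImInfty ((fun τ₂ : ℍ => F τ₁ τ₂) ∣[(1 : ℤ)] γ) := by
  simp only [fun τ => F_comm τ₁ τ]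
  exact isBoundedAtImInfty_F_left τ₁ γ

/-! ### Holomorphy of F -/

lemma analyticAt_discA_nome {z : ℂ} (hz : 0 < z.im) : AnalyticAt ℂ (fun w => discA (nome w)) z :=
  (analyticAt_discA (norm_nome_lt_one hz)).comp (analyticAt_nome z)

lemma analyticAt_discB_nome {z : ℂ} (hz : 0 < z.im) : AnalyticAt ℂ (fun w => discB (nome w)) z :=
  (analyticAt_discB (norm_nome_lt_one hz)).comp (analyticAt_nome z)

lemma eventually_im_pos_prod {p : ℂ × ℂ} (hp : p ∈ halfPlaneSq) :
    ∀ᶠ z in 𝓝 p, z ∈ halfPlaneSq :=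
  ((Complex.continuous_im.comp continuous_fst).continuousAt.eventually (lt_mem_nhds hp.1)).and
    ((Complex.continuous_im.comp continuous_snd).continuousAt.eventually (lt_mem_nhds hp.2))

lemma isHolomorphic_F : IsHolomorphic F := by
  intro p hp
  have a1 : AnalyticAt ℂ (fun z : ℂ × ℂ => discA (nome z.1)) p :=
    AnalyticAt.fun_comp (g := fun w => discA (nome w)) (analyticAt_discA_nome hp.1) analyticAt_fst
  have a2 : AnalyticAt ℂ (fun z : ℂ × ℂ => discA (nome z.2)) p :=
    AnalyticAt.fun_comp (g := fun w => discA (nome w)) (analyticAt_discA_nome hp.2) analyticAt_snd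
  have b1 : AnalyticAt ℂ (fun z : ℂ × ℂ => discB (nome z.1)) p :=
    AnalyticAt.fun_comp (g := fun w => discB (nome w)) (analyticAt_discB_nome hp.1) analyticAt_fst
  have b2 : AnalyticAt ℂ (fun z : ℂ × ℂ => discB (nome z.2)) p :=
    AnalyticAt.fun_comp (g := fun w => discB (nome w)) (analyticAt_discB_nome hp.2) analyticAt_snd
  refine (((a1.fun_mul a2).fun_add (b1.fun_mul b2)).fun_div analyticAt_const two_ne_zero).congr ?_
  filter_upwards [eventually_im_pos_prod hp] with z hz
  rw [lift, F_eq_add, theta3_sq, theta3_sq, theta4_sq, theta4_sq, coe_ofComplex hz.1,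
    coe_ofComplex hz.2]

end Bimodular
end

noncomputable section
namespace Bimodular

/-! ### The action of `Γ₀(8)` in each variable -/

lemma toReal_smul (γ : SL(2, ℤ)) (τ : ℍ) : toReal γ • τ = γ • τ := by
  ext1
  rw [UpperHalfPlane.coe_specialLinearGroup_apply, UpperHalfPlane.coe_specialLinearGroup_apply]
  rfl

lemma coe_χ₁ (γ : Γ) :
    ((χ₁ γ : ℂˣ) : ℂ) = ((ZMod.χ₄ (((γ : SL(2, ℤ)) 1 1 : ℤ) : ZMod 4) : ℤ) : ℂ) := by
  change ((ZMod.χ₄ (ZMod.castHom (by norm_num : 4 ∣ 8) (ZMod 4)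
    (((γ : SL(2, ℤ)) 1 1 : ℤ) : ZMod 8)) : ℤ) : ℂ) = _
  rw [map_intCast]

lemma coe_smul_int (γ : SL(2, ℤ)) (τ : ℍ) :
    ((γ • τ : ℍ) : ℂ) = ((γ 0 0 : ℤ) * τ + (γ 0 1 : ℤ)) / ((γ 1 0 : ℤ) * τ + (γ 1 1 : ℤ)) := by
  rw [UpperHalfPlane.coe_specialLinearGroup_apply]
  simp

lemma autFactor_toReal (γ : SL(2, ℤ)) (τ : ℍ) :
    autFactor (toReal γ) τ = (γ 1 0 : ℤ) * τ + (γ 1 1 : ℤ) := by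
  rw [autFactor, toReal_apply, toReal_apply]
  push_cast
  rfl

lemma det_int (γ : SL(2, ℤ)) : γ 0 0 * γ 1 1 - γ 0 1 * γ 1 0 = 1 := by
  have := γ.det_coe
  rwa [Matrix.det_fin_two] at this

lemma theta3_sq_smul (γ : Γ) (τ : ℍ) : theta3 ((γ : SL(2, ℤ)) • τ) ^ 2 =
    (χ₁ γ : ℂ) * autFactor (toReal γ) τ * theta3 τ ^ 2 := by
  have h4 : (4 : ℤ) ∣ (γ : SL(2, ℤ)) 1 0 := dvd_trans (by norm_num) (mem_Γ_iff.mp γ.2)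
  rw [theta3_sq, theta3_sq, coe_smul_int, thetaLaw (det_int _) h4 τ τ.im_pos, coe_χ₁,
    autFactor_toReal]

lemma theta4_sq_smul (γ : Γ) (τ : ℍ) : theta4 ((γ : SL(2, ℤ)) • τ) ^ 2 =
    (χ₁ γ : ℂ) * autFactor (toReal γ) τ * theta4 τ ^ 2 := by
  rw [theta4_sq, theta4_sq, coe_smul_int, discB_nome_moebius (det_int _) (mem_Γ_iff.mp γ.2) τ.im_pos,
    coe_χ₁, autFactor_toReal]

lemma autFactor_ne_zero (g : SL(2, ℝ)) (τ : ℍ) : autFactor g τ ≠ 0 := by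
  have h := det_entries g
  exact (moebius_im_pos h τ.im_pos).1

lemma t_smul (γ : Γ) (τ : ℍ) : t ((γ : SL(2, ℤ)) • τ) = t τ := by
  rw [t, theta3_sq_smul, theta4_sq_smul,
    mul_div_mul_left _ _ (mul_ne_zero (Units.ne_zero _) (autFactor_ne_zero _ _)), t]

lemma F_smul_left (γ : Γ) (τ₁ τ₂ : ℍ) : F ((γ : SL(2, ℤ)) • τ₁) τ₂ =
    (χ₁ γ : ℂ) * autFactor (toReal γ) τ₁ * F τ₁ τ₂ := by
  rw [F_eq_add, F_eq_add, theta3_sq_smul, theta4_sq_smul]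
  ring

lemma F_smul_right (γ : Γ) (τ₁ τ₂ : ℍ) : F τ₁ ((γ : SL(2, ℤ)) • τ₂) =
    (χ₁ γ : ℂ) * autFactor (toReal γ) τ₂ * F τ₁ τ₂ := by
  rw [F_comm, F_smul_left, F_comm]

/-! ### The diagonal action of the normalizer -/

/-- `x` and `y` are invariant under the diagonal action of `g`, and `F` has the factor `ε`. -/
structure IsMultiplier (g : SL(2, ℝ)) (ε : ℂˣ) : Prop where
  coord_x : ∀ τ₁ τ₂ : ℍ, x (g • τ₁) (g • τ₂) = x τ₁ τ₂
  coord_y : ∀ τ₁ τ₂ : ℍ, y (g • τ₁) (g • τ₂) = y τ₁ τ₂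
  form : ∀ τ₁ τ₂ : ℍ, F (g • τ₁) (g • τ₂) = ε * autFactor g τ₁ * autFactor g τ₂ * F τ₁ τ₂

lemma coe_smul_real (g : SL(2, ℝ)) (τ : ℍ) :
    ((g • τ : ℍ) : ℂ) = ((g 0 0 : ℝ) * τ + (g 0 1 : ℝ)) / autFactor g τ := by
  rw [UpperHalfPlane.coe_specialLinearGroup_apply]
  rfl

lemma autFactor_mul (g h : SL(2, ℝ)) (τ : ℍ) :
    autFactor (g * h) τ = autFactor g (h • τ) * autFactor h τ := by
  have h0 := autFactor_ne_zero h τ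
  rw [autFactor.eq_1 g, coe_smul_real, add_mul, mul_assoc, div_mul_cancel₀ _ h0, autFactor,
    autFactor, mul_one_zero, mul_one_one]
  push_cast
  ring

lemma autFactor_one (τ : ℍ) : autFactor 1 τ = 1 := by simp [autFactor]

lemma IsMultiplier.mul {g h : SL(2, ℝ)} {ε δ : ℂˣ} (hg : IsMultiplier g ε)
    (hh : IsMultiplier h δ) : IsMultiplier (g * h) (ε * δ) where
  coord_x τ₁ τ₂ := by rw [mul_smul, mul_smul, hg.coord_x, hh.coord_x]
  coord_y τ₁ τ₂ := by rw [mul_smul, mul_smul, hg.coord_y, hh.coord_y]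
  form τ₁ τ₂ := by
    rw [mul_smul, mul_smul, hg.form, hh.form, autFactor_mul, autFactor_mul, Units.val_mul]
    ring

lemma isMultiplier_one : IsMultiplier 1 1 where
  coord_x τ₁ τ₂ := by rw [one_smul, one_smul]
  coord_y τ₁ τ₂ := by rw [one_smul, one_smul]
  form τ₁ τ₂ := by simp [autFactor_one]

lemma IsMultiplier.inv {g : SL(2, ℝ)} {ε : ℂˣ} (hg : IsMultiplier g ε) :
    IsMultiplier g⁻¹ ε⁻¹ where
  coord_x τ₁ τ₂ := by
    have := hg.coord_x (g⁻¹ • τ₁) (g⁻¹ • τ₂)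
    rwa [smul_inv_smul, smul_inv_smul, eq_comm] at this
  coord_y τ₁ τ₂ := by
    have := hg.coord_y (g⁻¹ • τ₁) (g⁻¹ • τ₂)
    rwa [smul_inv_smul, smul_inv_smul, eq_comm] at this
  form τ₁ τ₂ := by
    have h := hg.form (g⁻¹ • τ₁) (g⁻¹ • τ₂)
    rw [smul_inv_smul, smul_inv_smul] at h
    have h1 : autFactor g (g⁻¹ • τ₁) * autFactor g⁻¹ τ₁ = 1 := by
      rw [← autFactor_mul, mul_inv_cancel, autFactor_one]
    have h2 : autFactor g (g⁻¹ • τ₂) * autFactor g⁻¹ τ₂ = 1 := by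
      rw [← autFactor_mul, mul_inv_cancel, autFactor_one]
    have h3 : (ε : ℂ) * (ε⁻¹ : ℂˣ) = 1 := by rw [← Units.val_mul, mul_inv_cancel, Units.val_one]
    rw [h]
    linear_combination -F (g⁻¹ • τ₁) (g⁻¹ • τ₂) * (h3 * (autFactor g (g⁻¹ • τ₁) * autFactor g⁻¹ τ₁)
      * (autFactor g (g⁻¹ • τ₂) * autFactor g⁻¹ τ₂) +
      h1 * (autFactor g (g⁻¹ • τ₂) * autFactor g⁻¹ τ₂) + h2)

lemma exists_F_ne_zero : ∃ τ₁ τ₂ : ℍ, F τ₁ τ₂ ≠ 0 := by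
  obtain ⟨⟨τ₁, τ₂⟩, h⟩ := dense_regularSet.nonempty
  refine ⟨τ₁, τ₂, ?_⟩
  rw [F]
  exact mul_ne_zero (mul_ne_zero (div_ne_zero h.1 two_ne_zero) (theta3_sq_ne_zero _))
    (theta3_sq_ne_zero _)

/-- As F and the automorphy factors are nonzero somewhere, the multiplier can be cancelled out.
Uniqueness turns a choice of multipliers into a homomorphism. -/
lemma IsMultiplier.unique {g : SL(2, ℝ)} {ε δ : ℂˣ} (h : IsMultiplier g ε)
    (h' : IsMultiplier g δ) : ε = δ := by
  obtain ⟨τ₁, τ₂, h0⟩ := exists_F_ne_zero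
  have e := (h.form τ₁ τ₂).symm.trans (h'.form τ₁ τ₂)
  have := mul_right_cancel₀ h0 e
  have := mul_right_cancel₀ (autFactor_ne_zero _ _) this
  exact Units.ext (mul_right_cancel₀ (autFactor_ne_zero _ _) this)

lemma isMultiplier_toReal (γ : Γ) : IsMultiplier (toReal γ) (χ₁ γ ^ 2) where
  coord_x τ₁ τ₂ := by rw [toReal_smul, toReal_smul, x, x, t_smul, t_smul]
  coord_y τ₁ τ₂ := by rw [toReal_smul, toReal_smul, y, y, t_smul, t_smul]
  form τ₁ τ₂ := by
    rw [toReal_smul, toReal_smul, F_smul_left, F_smul_right, Units.val_pow_eq_pow_val]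
    ring

lemma coordX_inv {a b : ℂ} (ha : a ≠ 0) (hb : b ≠ 0) : coordX a⁻¹ b⁻¹ = coordX a b := by
  -- Numerator and denominator acquire the same nonzero factor, so the equality also holds at poles,
  -- where the quotient takes the value 0.
  have h : (1 / (a * b)) ^ 4 ≠ 0 := pow_ne_zero 4 (one_div_ne_zero (mul_ne_zero ha hb))
  rw [coordX, coordX, ← mul_div_mul_left ((a + b) ^ 2 * (1 - a * b) ^ 2) _ h]
  congr 1 <;> field_simp <;> ring

lemma coordY_inv {a b : ℂ} (ha : a ≠ 0) (hb : b ≠ 0) : coordY a⁻¹ b⁻¹ = coordY a b := by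
  have h : (1 / (a * b)) ^ 4 ≠ 0 := pow_ne_zero 4 (one_div_ne_zero (mul_ne_zero ha hb))
  rw [coordY, coordY, ← mul_div_mul_left (a * b * (1 - a ^ 2) * (1 - b ^ 2)) _ h]
  congr 1 <;> field_simp <;> ring

lemma coordX_cayley {a b : ℂ} (ha : 1 + a ≠ 0) (hb : 1 + b ≠ 0) :
    coordX ((1 - a) / (1 + a)) ((1 - b) / (1 + b)) = coordX a b := by
  -- Up to the factor 2/((1 + a)(1 + b)), the substitution exchanges a + b with 1 - ab and fixes 1 +
  -- ab.
  have h : (2 / ((1 + a) * (1 + b))) ^ 4 ≠ 0 :=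
    pow_ne_zero 4 (div_ne_zero two_ne_zero (mul_ne_zero ha hb))
  rw [coordX, coordX, ← mul_div_mul_left ((a + b) ^ 2 * (1 - a * b) ^ 2) _ h]
  congr 1 <;> field_simp <;> ring

lemma coordY_cayley {a b : ℂ} (ha : 1 + a ≠ 0) (hb : 1 + b ≠ 0) :
    coordY ((1 - a) / (1 + a)) ((1 - b) / (1 + b)) = coordY a b := by
  have h : (2 / ((1 + a) * (1 + b))) ^ 4 ≠ 0 :=
    pow_ne_zero 4 (div_ne_zero two_ne_zero (mul_ne_zero ha hb))
  rw [coordY, coordY, ← mul_div_mul_left (a * b * (1 - a ^ 2) * (1 - b ^ 2)) _ h]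
  congr 1 <;> field_simp <;> ring

lemma coe_halfTranslation_smul (τ : ℍ) : ((halfTranslation • τ : ℍ) : ℂ) = τ + 1 / 2 := by
  rw [coe_smul_real, autFactor, halfTranslation_zero_zero, halfTranslation_zero_one,
    halfTranslation_one_zero, halfTranslation_one_one]
  simp

lemma theta3_sq_halfTranslation_smul (τ : ℍ) : theta3 (halfTranslation • τ) ^ 2 = theta4 τ ^ 2 := by
  rw [theta3_sq, theta4_sq, coe_halfTranslation_smul, discB_nome]

lemma theta4_sq_halfTranslation_smul (τ : ℍ) : theta4 (halfTranslation • τ) ^ 2 = theta3 τ ^ 2 := by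
  rw [theta3_sq, theta4_sq, coe_halfTranslation_smul, discB, nome_add_half, neg_neg, discA]

lemma t_halfTranslation_smul (τ : ℍ) : t (halfTranslation • τ) = (t τ)⁻¹ := by
  rw [t, theta3_sq_halfTranslation_smul, theta4_sq_halfTranslation_smul, t, inv_div]

lemma autFactor_halfTranslation (τ : ℍ) : autFactor halfTranslation τ = 1 := by
  rw [autFactor, halfTranslation_one_zero, halfTranslation_one_one]
  simp

/-- The half translation exchanges θ₃² and θ₄², which leaves F unchanged and inverts t. -/
lemma isMultiplier_halfTranslation : IsMultiplier halfTranslation 1 where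
  coord_x τ₁ τ₂ := by
    rw [x_eq, x_eq, t_halfTranslation_smul, t_halfTranslation_smul,
      coordX_inv (t_ne_zero _) (t_ne_zero _)]
  coord_y τ₁ τ₂ := by
    rw [y_eq, y_eq, t_halfTranslation_smul, t_halfTranslation_smul,
      coordY_inv (t_ne_zero _) (t_ne_zero _)]
  form τ₁ τ₂ := by
    rw [F_eq_add, F_eq_add, theta3_sq_halfTranslation_smul, theta4_sq_halfTranslation_smul,
      theta3_sq_halfTranslation_smul, theta4_sq_halfTranslation_smul, autFactor_halfTranslation,
      autFactor_halfTranslation, Units.val_one]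
    ring

lemma coe_sqrt_eight_mul_self : ((√8 : ℝ) : ℂ) * (√8 : ℝ) = 8 := by
  rw [← Complex.ofReal_mul, sqrt_eight_mul_self]
  norm_num

lemma autFactor_σ₂ (τ : ℍ) : autFactor σ₂ τ = (√8 : ℝ) * τ := by
  have h : (8 : ℝ) / √8 = √8 := Real.div_sqrt
  rw [autFactor, σ₂_one_zero, σ₂_one_one, h]
  simp

lemma coe_σ₂_smul (τ : ℍ) : ((σ₂ • τ : ℍ) : ℂ) = -1 / (8 * τ) := by
  rw [coe_smul_real, autFactor_σ₂, σ₂_zero_zero, σ₂_zero_one, ← coe_sqrt_eight_mul_self]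
  push_cast
  rw [zero_mul, zero_add, div_div, mul_assoc]

lemma theta3_sq_σ₂_smul (τ : ℍ) :
    theta3 (σ₂ • τ) ^ 2 = -2 * Complex.I * τ * (theta3 τ ^ 2 + theta4 τ ^ 2) := by
  rw [theta3_sq, theta3_sq, theta4_sq, coe_σ₂_smul, discA_nome_fricke_eight τ.im_pos]

lemma theta4_sq_σ₂_smul (τ : ℍ) :
    theta4 (σ₂ • τ) ^ 2 = -2 * Complex.I * τ * (theta3 τ ^ 2 - theta4 τ ^ 2) := by
  rw [theta3_sq, theta4_sq, theta4_sq, coe_σ₂_smul, discB_nome_fricke_eight τ.im_pos]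

lemma t_σ₂_smul (τ : ℍ) : t (σ₂ • τ) = (1 - t τ) / (1 + t τ) := by
  have h0 : -2 * Complex.I * (τ : ℂ) ≠ 0 := mul_ne_zero (by simp) (UpperHalfPlane.ne_zero τ)
  have h3 := theta3_sq_ne_zero τ
  rw [t, theta3_sq_σ₂_smul, theta4_sq_σ₂_smul, mul_div_mul_left _ _ h0, t, one_sub_div h3,
    one_add_div h3, div_div_div_cancel_right₀ h3]

/-- The sum (A₁ + B₁)(A₂ + B₂) + (A₁ - B₁)(A₂ - B₂) is 2(A₁A₂ + B₁B₂). The sign arises from (-2i)²·2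
= -8, against √8·√8 = 8 in the automorphy factors. -/
lemma isMultiplier_σ₂ : IsMultiplier σ₂ (-1) where
  coord_x τ₁ τ₂ := by
    rw [x_eq, x_eq, t_σ₂_smul, t_σ₂_smul, coordX_cayley (one_add_t_ne_zero _) (one_add_t_ne_zero _)]
  coord_y τ₁ τ₂ := by
    rw [y_eq, y_eq, t_σ₂_smul, t_σ₂_smul, coordY_cayley (one_add_t_ne_zero _) (one_add_t_ne_zero _)]
  form τ₁ τ₂ := by
    rw [F_eq_add, F_eq_add, theta3_sq_σ₂_smul, theta4_sq_σ₂_smul, theta3_sq_σ₂_smul,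
      theta4_sq_σ₂_smul, autFactor_σ₂, autFactor_σ₂, Units.val_neg, Units.val_one]
    linear_combination
      (τ₁ * τ₂ * (theta3 τ₁ ^ 2 * theta3 τ₂ ^ 2 + theta4 τ₁ ^ 2 * theta4 τ₂ ^ 2) / 2) *
        coe_sqrt_eight_mul_self +
      4 * (τ₁ * τ₂ * (theta3 τ₁ ^ 2 * theta3 τ₂ ^ 2 + theta4 τ₁ ^ 2 * theta4 τ₂ ^ 2)) *
        Complex.I_sq

lemma isMultiplier_σ₁ : IsMultiplier σ₁ (-1) := by
  have h := isMultiplier_σ₂.mul isMultiplier_halfTranslation.inv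
  rwa [← eq_mul_inv_of_mul_eq σ₁_mul_halfTranslation, inv_one, mul_one] at h

lemma exists_isMultiplier {g : SL(2, ℝ)} (hg : g ∈ N) : ∃ ε, IsMultiplier g ε := by
  refine Subgroup.closure_induction (p := fun g _ => ∃ ε, IsMultiplier g ε) ?_
    ⟨_, isMultiplier_one⟩ (fun _ _ _ _ ⟨_, h⟩ ⟨_, h'⟩ => ⟨_, h.mul h'⟩)
    (fun _ _ ⟨_, h⟩ => ⟨_, h.inv⟩) (N_le_generated hg)
  rintro g (⟨γ, hγ, rfl⟩ | rfl | rfl)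
  exacts [⟨_, isMultiplier_toReal ⟨γ, hγ⟩⟩, ⟨_, isMultiplier_σ₁⟩, ⟨_, isMultiplier_σ₂⟩]

/-- The character of `N(Γ₀(8))` that belongs to `F`. -/
def χ₂ : N →* ℂˣ :=
  MonoidHom.mk' (fun g => (exists_isMultiplier g.2).choose) fun g h =>
    (exists_isMultiplier (g * h).2).choose_spec.unique
      ((exists_isMultiplier g.2).choose_spec.mul (exists_isMultiplier h.2).choose_spec)

lemma isMultiplier_χ₂ (g : N) : IsMultiplier g (χ₂ g) := (exists_isMultiplier g.2).choose_spec

lemma compatibleCharacters : CompatibleCharacters χ₁ χ₂ := by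
  intro γ g hg
  refine (isMultiplier_χ₂ g).unique ?_
  rw [hg]
  exact isMultiplier_toReal γ

/-- Compatibility fixes the values on Γ₀(8), and Γ₀(8), σ₁ and σ₂ generate the normalizer. -/
lemma eq_of_compatible {χ χ' : N →* ℂˣ} (hχ : CompatibleCharacters χ₁ χ)
    (hχ' : CompatibleCharacters χ₁ χ') (h₁ : χ ⟨σ₁, σ₁_mem_N⟩ = χ' ⟨σ₁, σ₁_mem_N⟩)
    (h₂ : χ ⟨σ₂, σ₂_mem_N⟩ = χ' ⟨σ₂, σ₂_mem_N⟩) : χ = χ' := by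
  have h : generated ≤ (χ.eqLocus χ').map N.subtype := by
    rw [generated, Subgroup.closure_le]
    rintro _ (⟨γ, hγ, rfl⟩ | rfl | rfl)
    · exact ⟨⟨toReal γ, ΓR_le_N ⟨γ, hγ, rfl⟩⟩,
        (hχ ⟨γ, hγ⟩ _ rfl).trans (hχ' ⟨γ, hγ⟩ _ rfl).symm, rfl⟩
    · exact ⟨_, h₁, rfl⟩
    · exact ⟨_, h₂, rfl⟩
  ext1 g
  obtain ⟨g', hg', e⟩ := h (N_le_generated g.2)
  rw [← Subtype.ext (a1 := g') (a2 := g) e]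
  exact hg'

/-! ### The main theorem -/

lemma isAdmissiblePair : IsAdmissiblePair Γ N :=
  ⟨CongruenceSubgroup.Gamma0_is_congruence 8, ΓR_le_N, le_rfl⟩

/-- Density of the regular set prevents the denominators of x and y from vanishing identically near
a point. -/
lemma frequently_ne_zero {P : ℂ → ℂ → ℂ} (hP : ∀ a b, IsGood a b → P a b ≠ 0) {p : ℂ × ℂ}
    (hp : p ∈ halfPlaneSq) : ∃ᶠ z in 𝓝 p, P (tC z.1) (tC z.2) ≠ 0 := by
  rw [Filter.frequently_iff]
  intro U hU
  let τ : ℍ × ℍ := (⟨p.1, hp.1⟩, ⟨p.2, hp.2⟩)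
  have hc : Continuous fun σ : ℍ × ℍ => ((σ.1 : ℂ), (σ.2 : ℂ)) :=
    (UpperHalfPlane.continuous_coe.comp continuous_fst).prodMk
      (UpperHalfPlane.continuous_coe.comp continuous_snd)
  obtain ⟨σ, hσ, hσU⟩ := dense_regularSet.inter_nhds_nonempty
    (hc.continuousAt.preimage_mem_nhds (x := τ) hU)
  refine ⟨_, hσU, ?_⟩
  simp only [tC_coe]
  exact hP _ _ (mem_regularSet_iff.mp hσ).1

lemma analyticAt_tC_fst {p : ℂ × ℂ} (hp : p ∈ halfPlaneSq) :
    AnalyticAt ℂ (fun z : ℂ × ℂ => tC z.1) p :=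
  AnalyticAt.fun_comp (g := tC) (analyticAt_tC hp.1) analyticAt_fst

lemma analyticAt_tC_snd {p : ℂ × ℂ} (hp : p ∈ halfPlaneSq) :
    AnalyticAt ℂ (fun z : ℂ × ℂ => tC z.2) p :=
  AnalyticAt.fun_comp (g := tC) (analyticAt_tC hp.2) analyticAt_snd

lemma isMeromorphic_x : IsMeromorphic x := by
  intro p hp
  have h1 := analyticAt_tC_fst hp
  have h2 := analyticAt_tC_snd hp
  refine ⟨fun z => (tC z.1 + tC z.2) ^ 2 * (1 - tC z.1 * tC z.2) ^ 2,
    fun z => (1 + tC z.1 * tC z.2) ^ 4,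
    ((h1.fun_add h2).fun_pow 2).fun_mul ((analyticAt_const.fun_sub (h1.fun_mul h2)).fun_pow 2),
    (analyticAt_const.fun_add (h1.fun_mul h2)).fun_pow 4,
    frequently_ne_zero (P := fun a b => (1 + a * b) ^ 4) (fun a b h => pow_ne_zero 4 h.one_add) hp,
    Filter.Eventually.of_forall fun z _ => rfl⟩

lemma isMeromorphic_y : IsMeromorphic y := by
  intro p hp
  have h1 := analyticAt_tC_fst hp
  have h2 := analyticAt_tC_snd hp
  refine ⟨fun z => tC z.1 * tC z.2 * (1 - tC z.1 ^ 2) * (1 - tC z.2 ^ 2),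
    fun z => (tC z.1 + tC z.2) ^ 2 * (1 - tC z.1 * tC z.2) ^ 2,
    ((h1.fun_mul h2).fun_mul (analyticAt_const.fun_sub (h1.fun_pow 2))).fun_mul
      (analyticAt_const.fun_sub (h2.fun_pow 2)),
    ((h1.fun_add h2).fun_pow 2).fun_mul ((analyticAt_const.fun_sub (h1.fun_mul h2)).fun_pow 2),
    frequently_ne_zero (P := fun a b => (a + b) ^ 2 * (1 - a * b) ^ 2)
      (fun a b h => mul_ne_zero (pow_ne_zero 2 h.add) (pow_ne_zero 2 h.one_sub)) hp,
    Filter.Eventually.of_forall fun z _ => rfl⟩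

theorem isBimodularFunction_x : IsBimodularFunction Γ N x where
  pair := isAdmissiblePair
  meromorphic := isMeromorphic_x
  invariant :=
    { left := fun γ τ₁ τ₂ => by rw [x, t_smul]; simp [x]
      right := fun γ τ₁ τ₂ => by rw [x, t_smul]; simp [x]
      diag := fun γ τ₁ τ₂ => by rw [(isMultiplier_χ₂ γ).coord_x]; simp }

theorem isBimodularFunction_y : IsBimodularFunction Γ N y where
  pair := isAdmissiblePair
  meromorphic := isMeromorphic_y
  invariant :=
    { left := fun γ τ₁ τ₂ => by rw [y, t_smul]; simp [y]
      right := fun γ τ₁ τ₂ => by rw [y, t_smul]; simp [y]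
      diag := fun γ τ₁ τ₂ => by rw [(isMultiplier_χ₂ γ).coord_y]; simp }

theorem isBimodularForm_F : IsBimodularForm Γ N 1 χ₁ χ₂ F where
  pair := isAdmissiblePair
  compatible := compatibleCharacters
  holomorphic := isHolomorphic_F
  bounded_left := isBoundedAtImInfty_F_left
  bounded_right := isBoundedAtImInfty_F_right
  invariant :=
    { left := fun γ τ₁ τ₂ => by rw [F_smul_left, zpow_one]
      right := fun γ τ₁ τ₂ => by rw [F_smul_right, zpow_one]
      diag := fun γ τ₁ τ₂ => by rw [(isMultiplier_χ₂ γ).form, zpow_one, zpow_one] }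

end Bimodular
end

theorem mainTheorem10 :
    Bimodular.IsBimodularFunction Bimodular.Γ Bimodular.N Bimodular.x ∧
    Bimodular.IsBimodularFunction Bimodular.Γ Bimodular.N Bimodular.y ∧
    (∃ (h₁ : Bimodular.σ₁ ∈ Bimodular.N) (h₂ : Bimodular.σ₂ ∈ Bimodular.N)
        (χ₂ : Bimodular.N →* ℂˣ),
      χ₂ ⟨Bimodular.σ₁, h₁⟩ = -1 ∧ χ₂ ⟨Bimodular.σ₂, h₂⟩ = -1 ∧
      Bimodular.IsBimodularForm Bimodular.Γ Bimodular.N 1 Bimodular.χ₁ χ₂ Bimodular.F ∧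
      ∀ χ' : Bimodular.N →* ℂˣ, Bimodular.CompatibleCharacters Bimodular.χ₁ χ' →
        χ' ⟨Bimodular.σ₁, h₁⟩ = -1 → χ' ⟨Bimodular.σ₂, h₂⟩ = -1 → χ' = χ₂) ∧
    Dense Bimodular.regularSet ∧
    ∀ τ₁ τ₂ : UpperHalfPlane, (τ₁, τ₂) ∈ Bimodular.regularSet →
      Bimodular.SatisfiesSystemNear τ₁ τ₂ := by
  have h₁ : Bimodular.χ₂ ⟨Bimodular.σ₁, Bimodular.σ₁_mem_N⟩ = -1 :=
    (Bimodular.isMultiplier_χ₂ _).unique Bimodular.isMultiplier_σ₁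
  have h₂ : Bimodular.χ₂ ⟨Bimodular.σ₂, Bimodular.σ₂_mem_N⟩ = -1 :=
    (Bimodular.isMultiplier_χ₂ _).unique Bimodular.isMultiplier_σ₂
  exact ⟨Bimodular.isBimodularFunction_x, Bimodular.isBimodularFunction_y,
    ⟨Bimodular.σ₁_mem_N, Bimodular.σ₂_mem_N, Bimodular.χ₂, h₁, h₂, Bimodular.isBimodularForm_F,
      fun χ' hχ' e₁ e₂ => Bimodular.eq_of_compatible hχ' Bimodular.compatibleCharacters
        (e₁.trans h₁.symm) (e₂.trans h₂.symm)⟩,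
    Bimodular.dense_regularSet, fun τ₁ τ₂ h => Bimodular.satisfiesSystemNear_of_mem h⟩
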